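/- Let $p\in(0,1)$ with $p\neq\frac12$. For each $n$ consider $n$ independent random binary strings, each consisting of independent bits that are $1$ with probability $p$ and $0$ with probability $1-p$ (asymmetric Bernoulli model). Radix Selection with $b=2$ buckets selects the string of rank $\ell\in\{1,\dots,n\}$ (in lexicographic order) as follows: starting with the set of all $n$ strings, in stage $k=1,2,\dots$ it splits the current set according to the $k$-th bit and continues with the part that contains the string sought; it stops as soon as the current set contains no other string. A stage performed on a set of $j$ strings costs $j$ bucket operations. Let $Y_n(\ell)$ be the total number of bucket operations, and put $Y_n(n+1):=Y_n(n)$. Define $$X_n(t):=\frac{Y_n(\lfloor tn\rfloor+1)-m(t)\,n}{\sqrt n},\qquad m(t):=\frac{2p-1}{p(1-p)}\,t+\frac1p,\qquad t\in[0,1].$$ Then, as $n\to\infty$, the processes $X_n=(X_n(t))_{0\le t\le1}$ converge weakly, as random elements of the space $D[0,1]$ of càdlàg functions on $[0,1]$ equipped with the Skorokhod metric $d_{sk}(x,y)=\inf_\lambda\max\{\sup_t|\lambda(t)-t|,\ \sup_t|x(t)-y(\lambda(t))|\}$ ($\lambda$ ranging over the increasing bijections of $[0,1]$), to a random element $G=(G(t))_{t\in[0,1]}$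 of $D[0,1]$ that is a centered Gaussian process with covariance function, for $s,t\in[0,1]$, $$\mathbb E[G(s)G(t)]=-\prod_{k=1}^{r(s,t)}p[g(t,k)]+\sum_{k=1}^{r(s,t)}\frac{\prod_{j=1}^{k}p[g(t,j)]}{p[1-g(t,k)]}.$$ Here $p[0]:=1-p$, $p[1]:=p$, the functions $g:[0,1]\times\mathbb N_0\to\{0,1\}$ and $h:[0,1]\times\mathbb N_0\to[0,1]$ are given by $g(t,0)=0$, $h(t,0)=t$ and, for $k\ge1$, $$\bigl(g(t,k),h(t,k)\bigr)=\begin{cases}\bigl(0,\ \frac{h(t,k-1)}{1-p}\bigr), & h(t,k-1)<1-p,\\[2pt] \bigl(1,\ \frac{h(t,k-1)-(1-p)}{p}\bigr), & h(t,k-1)\ge 1-p,\end{cases}$$ and $r(s,t)=\max\{n\in\mathbb N_0: g(s,\ell)=g(t,\ell)\text{ for }1\le\ell\le n\}\in\mathbb N_0\cup\{\infty\}$ (with $r(s,t)=\infty$ if there is no maximum). -/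

import Mathlib

open MeasureTheory ProbabilityTheory Filter Topology unitInterval

noncomputable section

namespace RadixSelection

/-! ### The space of càdlàg functions on `[0,1]` with the Skorokhod metric -/

/-- The space `D[0,1]` of real functions on `[0,1]` that are right-continuous and have left limits
(at `t = 0` the left neighbourhood filter is trivial, so nothing is asked there). -/
structure CadlagSpace where
  toFun : I → ℝ
  right_cont : ∀ t : I, ContinuousWithinAt toFun (Set.Ici t) t
  left_lim : ∀ t : I, ∃ l : ℝ, Tendsto toFun (𝓝[<] t) (𝓝 l)

instance : CoeFun CadlagSpace (fun _ => I → ℝ) := ⟨CadlagSpace.toFun⟩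

/-- The Skorokhod distance
`d(x, y) = inf_λ max (sup_t |λ t - t|) (sup_t |x t - y (λ t)|)`, where `λ` runs over the increasing
bijections of `[0,1]` onto itself. -/
def skorokhodEDist (x y : CadlagSpace) : ENNReal :=
  ⨅ lam : I ≃o I, max (⨆ t : I, edist (lam t) t) (⨆ t : I, edist (x t) (y (lam t)))

theorem skorokhodEDist_self (x : CadlagSpace) : skorokhodEDist x x = 0 := by
  refine le_antisymm ?_ zero_le
  refine (iInf_le _ (OrderIso.refl I)).trans ?_
  simp

theorem skorokhodEDist_le_symm (x y : CadlagSpace) :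
    skorokhodEDist x y ≤ skorokhodEDist y x := by
  refine le_iInf fun lam => (iInf_le _ lam.symm).trans ?_
  refine max_le_max (iSup_le fun t => ?_) (iSup_le fun t => ?_)
  · refine le_trans ?_ (le_iSup _ (lam.symm t))
    rw [lam.apply_symm_apply, edist_comm]
  · refine le_trans ?_ (le_iSup _ (lam.symm t))
    rw [lam.apply_symm_apply, edist_comm]

theorem skorokhodEDist_triangle (x y z : CadlagSpace) :
    skorokhodEDist x z ≤ skorokhodEDist x y + skorokhodEDist y z := by
  unfold skorokhodEDist
  refine ENNReal.le_iInf_add_iInf fun a b => ?_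
  refine (iInf_le _ (a.trans b)).trans (max_le (iSup_le fun t => ?_) (iSup_le fun t => ?_))
  · calc edist (b (a t)) t ≤ edist (b (a t)) (a t) + edist (a t) t := edist_triangle _ _ _
      _ = edist (a t) t + edist (b (a t)) (a t) := add_comm _ _
      _ ≤ _ := add_le_add (le_max_of_le_left (le_iSup (fun t => edist (a t) t) t))
          (le_max_of_le_left (le_iSup (fun t => edist (b t) t) (a t)))
  · calc edist (x t) (z (b (a t))) ≤ edist (x t) (y (a t)) + edist (y (a t)) (z (b (a t))) :=
          edist_triangle _ _ _
      _ ≤ _ := add_le_add (le_max_of_le_right (le_iSup (fun t => edist (x t) (y (a t))) t))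
          (le_max_of_le_right (le_iSup (fun t => edist (y t) (z (b t))) (a t)))

/-- `D[0,1]` carries the topology of the Skorokhod distance. -/
instance : PseudoEMetricSpace CadlagSpace where
  edist := skorokhodEDist
  edist_self := skorokhodEDist_self
  edist_comm x y := le_antisymm (skorokhodEDist_le_symm x y) (skorokhodEDist_le_symm y x)
  edist_triangle := skorokhodEDist_triangle

/-- `D[0,1]` carries the Borel `σ`-algebra of the Skorokhod topology. -/
instance : MeasurableSpace CadlagSpace := borel CadlagSpace

instance : BorelSpace CadlagSpace := ⟨rfl⟩

/-! ### Radix Selection with two buckets -/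

/-- The run of Radix Selection on `n` binary strings `s 0, …, s (n-1)` (bits are indexed from `0`)
when rank `l` is to be selected: after `k` partitioning stages, the set of the data in the current
bucket and the rank, within this bucket, of the datum that is sought. A stage splits the current
bucket by the next bit and continues with the part that contains the sought rank. -/
def selectState {n : ℕ} (s : Fin n → ℕ → Fin 2) (l : ℕ) : ℕ → Finset (Fin n) × ℕ
  | 0 => (Finset.univ, l)
  | k + 1 =>
    let S := (selectState s l k).1
    let j := (selectState s l k).2
    let S₀ := S.filter (fun i => s i k = 0)
    let S₁ := S.filter (fun i => s i k = 1)
    if j ≤ S₀.card then (S₀, j) else (S₁, j - S₀.card)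

/-- The number `Y_n(l)` of bucket operations of Radix Selection with two buckets: every stage costs
one operation for each datum in the current bucket, and the algorithm stops as soon as the current
bucket contains no further data. (If the algorithm does not stop, which requires two identical
strings, the sum has infinitely many nonzero terms and takes the default value `0`.) -/
def bucketOps {n : ℕ} (s : Fin n → ℕ → Fin 2) (l : ℕ) : ℕ :=
  ∑' k : ℕ, if 2 ≤ (selectState s l k).1.card then (selectState s l k).1.card else 0

/-! ### The normalized process -/

/-- `m(t) = (2p-1)/(p(1-p)) * t + 1/p`. -/
def meanFun (p t : ℝ) : ℝ := (2 * p - 1) / (p * (1 - p)) * t + 1 / p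

/-- `X_n(t) = (Y_n(⌊tn⌋+1) - m(t) n) / √n`, with `Y_n(n+1) := Y_n(n)`. -/
def normalizedOps (p : ℝ) {n : ℕ} (s : Fin n → ℕ → Fin 2) (t : I) : ℝ :=
  ((bucketOps s (min (⌊(t : ℝ) * n⌋₊ + 1) n) : ℝ) - meanFun p t * n) / √(n : ℝ)

theorem eventually_floor_right (n : ℕ) (t : I) :
    ∀ᶠ u : I in 𝓝[≥] t, ⌊(u : ℝ) * n⌋₊ = ⌊(t : ℝ) * n⌋₊ := by
  have hc : Continuous fun u : I => (u : ℝ) * n := by fun_prop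
  have h1 : ∀ᶠ u : I in 𝓝[≥] t, (u : ℝ) * n < ⌊(t : ℝ) * n⌋₊ + 1 :=
    nhdsWithin_le_nhds (hc.continuousAt.eventually_lt_const (Nat.lt_floor_add_one _))
  filter_upwards [h1, self_mem_nhdsWithin] with u hu htu
  have h0 : (t : ℝ) * n ≤ u * n :=
    mul_le_mul_of_nonneg_right (by exact_mod_cast (htu : t ≤ u)) (Nat.cast_nonneg n)
  rw [Nat.floor_eq_iff (mul_nonneg u.2.1 (Nat.cast_nonneg n))]
  exact ⟨(Nat.floor_le (mul_nonneg t.2.1 (Nat.cast_nonneg n))).trans h0, hu⟩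

theorem eventually_floor_left (n : ℕ) (t : I) :
    ∀ᶠ u : I in 𝓝[<] t, ⌊(u : ℝ) * n⌋₊ = ⌈(t : ℝ) * n⌉₊ - 1 := by
  have hc : Continuous fun u : I => (u : ℝ) * n := by fun_prop
  rcases Nat.eq_zero_or_pos n with rfl | hn
  · simp
  have hn' : (0 : ℝ) < n := by exact_mod_cast hn
  rcases eq_or_lt_of_le (mul_nonneg t.2.1 hn'.le) with h | h
  · filter_upwards [self_mem_nhdsWithin] with u hu
    have hu' : (u : ℝ) < t := by exact_mod_cast (hu : u < t)
    have := mul_lt_mul_of_pos_right hu' hn'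
    have := mul_nonneg u.2.1 hn'.le
    linarith
  have hpos : 0 < ⌈(t : ℝ) * n⌉₊ := Nat.ceil_pos.2 h
  have hcast : ((⌈(t : ℝ) * n⌉₊ - 1 : ℕ) : ℝ) = (⌈(t : ℝ) * n⌉₊ : ℝ) - 1 := by
    rw [Nat.cast_sub hpos, Nat.cast_one]
  have hlt : ((⌈(t : ℝ) * n⌉₊ - 1 : ℕ) : ℝ) < t * n := by
    have := Nat.ceil_lt_add_one h.le
    rw [hcast]; linarith
  have h1 : ∀ᶠ u : I in 𝓝[<] t, ((⌈(t : ℝ) * n⌉₊ - 1 : ℕ) : ℝ) < (u : ℝ) * n :=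
    nhdsWithin_le_nhds (hc.continuousAt.eventually_const_lt hlt)
  filter_upwards [h1, self_mem_nhdsWithin] with u hu htu
  have hu' : (u : ℝ) < t := by exact_mod_cast (htu : u < t)
  have h2 := mul_lt_mul_of_pos_right hu' hn'
  have h3 := Nat.le_ceil ((t : ℝ) * n)
  rw [Nat.floor_eq_iff (mul_nonneg u.2.1 hn'.le)]
  refine ⟨hu.le, ?_⟩
  rw [hcast]; linarith

theorem continuous_meanFun (p : ℝ) : Continuous fun u : I => meanFun p u := by
  unfold meanFun; fun_prop

/-- The path `t ↦ X_n(t)` as an element of `D[0,1]`. -/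
def normalizedPath (p : ℝ) {n : ℕ} (s : Fin n → ℕ → Fin 2) : CadlagSpace where
  toFun := normalizedOps p s
  right_cont t := by
    have hm : ContinuousAt (fun u : I => ((bucketOps s (min (⌊(t : ℝ) * n⌋₊ + 1) n) : ℝ) -
        meanFun p u * n) / √(n : ℝ)) t := by
      have := continuous_meanFun p
      exact Continuous.continuousAt (by fun_prop)
    refine hm.continuousWithinAt.congr_of_eventuallyEq ?_ rfl
    filter_upwards [eventually_floor_right n t] with u hu
    simp only [normalizedOps, hu]
  left_lim t := by
    have hm : ContinuousAt (fun u : I => ((bucketOps s (min (⌈(t : ℝ) * n⌉₊ - 1 + 1) n) : ℝ) -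
        meanFun p u * n) / √(n : ℝ)) t := by
      have := continuous_meanFun p
      exact Continuous.continuousAt (by fun_prop)
    refine ⟨_, (hm.tendsto.mono_left nhdsWithin_le_nhds).congr' ?_⟩
    filter_upwards [eventually_floor_left n t] with u hu
    simp only [normalizedOps, hu]

/-! ### The covariance function -/

/-- `p[0] = 1 - p` and `p[1] = p`. -/
def bitProb (p : ℝ) (i : Fin 2) : ℝ := if i = 0 then 1 - p else p

/-- `h(t,0) = t`, and `h(t,k)` is `h(t,k-1)/(1-p)` if `h(t,k-1) < 1-p` and
`(h(t,k-1)-(1-p))/p` otherwise. -/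
def hFun (p t : ℝ) : ℕ → ℝ
  | 0 => t
  | k + 1 => if hFun p t k < 1 - p then hFun p t k / (1 - p) else (hFun p t k - (1 - p)) / p

/-- `g(t,0) = 0`, and `g(t,k)` is `0` if `h(t,k-1) < 1-p` and `1` otherwise. -/
def gFun (p t : ℝ) : ℕ → Fin 2
  | 0 => 0
  | k + 1 => if hFun p t k < 1 - p then 0 else 1

/-- `r(s,t) = max {n | g(s,l) = g(t,l) for 1 ≤ l ≤ n}`, which is `∞` if there is no maximum. -/
def rFun (p s t : ℝ) : ℕ∞ :=
  ⨆ (n : ℕ) (_ : ∀ l : ℕ, 1 ≤ l → l ≤ n → gFun p s l = gFun p t l), (n : ℕ∞)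

/-- The covariance function
`-∏_{k=1}^{r} p[g(t,k)] + ∑_{k=1}^{r} (∏_{j=1}^{k} p[g(t,j)]) / p[1-g(t,k)]` with `r = r(s,t)`;
sum and product are over the `k` with `1 ≤ k ≤ r(s,t)`, where `r(s,t)` may be infinite. -/
def covFun (p s t : ℝ) : ℝ :=
  -(∏' k : {k : ℕ // 1 ≤ k ∧ (k : ℕ∞) ≤ rFun p s t}, bitProb p (gFun p t k)) +
    ∑' k : {k : ℕ // 1 ≤ k ∧ (k : ℕ∞) ≤ rFun p s t},
      (∏ j ∈ Finset.Icc 1 (k : ℕ), bitProb p (gFun p t j)) / bitProb p (1 - gFun p t k)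

end RadixSelection

end

/-! The cost of a selection is the sum of the bucket sizes along one path in the binary tree of
prefixes. If a bucket has size N and A data lie below it, then N/p + ((2p-1)/(p(1-p)))(y - A) serves
as the mean remaining cost. It drops by exactly N when the split is exactly proportional, so the
cost telescopes (`sum_cnt_eq`). What remains is √n times a weighted sum of the normalized splitting
errors `noise` at the nodes of the path, plus a small boundary term. The function m comes from the
root term.

Two approximations reduce this to finitely many nodes. First, ranks become points of [0,1]: a
piecewise linear time change maps the block of ranks of each word of length K onto its cylinder
interval. It is uniformly close to the identity because block frequencies are close to
probabilities, and it turns the path of a rank into the expansion of a point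
(`bits_timeChange_eq_rankBits`). This is where the Skorokhod metric enters. Second, the deep levels
are negligible. Fourth moments bound the largest noise on level k by about ρ^(k/4) + n^(-1/4), where
ρ = p² + (1-p)², and about n^(1/8) levels separate all strings with high probability
(`exists_forall_measureReal_edist_le`).

For fixed K, linear combinations of the noise are normalized sums of i.i.d. centered variables with
orthogonal increments. Characteristic functions therefore give a limit of independent Gaussian
variables, with variance π(u)p(1-p) at the node u of probability π(u)
(`tendstoInDistribution_restrictLT_noise`). The limit process is the almost surely uniformly
convergent series of these Gaussian variables along the expansion of t. Its covariance is read off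
the shared nodes: each node followed by a common bit gives a term of the sum, and the node of first
disagreement gives the negative product (`tendsto_covSum`). A bounded-Lipschitz argument lets n tend
to infinity before K (`tendstoInDistribution_normalizedPath`). -/

noncomputable section

namespace RadixSelection

section

/-! ### Binary words and counts -/

/-- The first `k` bits of `x`, the latest bit first. -/
def prefixWord (x : ℕ → Fin 2) : ℕ → List (Fin 2)
  | 0 => []
  | k + 1 => x k :: prefixWord x k

@[simp] theorem length_prefixWord (x : ℕ → Fin 2) (k : ℕ) : (prefixWord x k).length = k := by
  induction k with
  | zero => rfl
  | succ k ih => simp [prefixWord, ih]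

theorem prefixWord_congr {x y : ℕ → Fin 2} {k : ℕ} (h : ∀ j < k, x j = y j) :
    prefixWord x k = prefixWord y k := by
  induction k with
  | zero => rfl
  | succ k ih => simp [prefixWord, h k (by omega), ih fun j hj => h j (by omega)]

theorem apply_eq_of_prefixWord_eq {x y : ℕ → Fin 2} {k : ℕ}
    (h : prefixWord x k = prefixWord y k) : ∀ j < k, x j = y j := by
  induction k with
  | zero => intro j hj; omega
  | succ k ih =>
    simp only [prefixWord, List.cons.injEq] at h
    intro j hj
    rcases Nat.lt_succ_iff_lt_or_eq.1 hj with h' | rfl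
    · exact ih h.2 j h'
    · exact h.1

/-- The words of length `k`. -/
def words : ℕ → Finset (List (Fin 2))
  | 0 => {[]}
  | k + 1 => (Finset.univ ×ˢ words k).map
      ⟨fun x : Fin 2 × List (Fin 2) => x.1 :: x.2, fun x y h => by
        simp only [List.cons.injEq] at h; exact Prod.ext h.1 h.2⟩

theorem mem_words {k : ℕ} {u : List (Fin 2)} : u ∈ words k ↔ u.length = k := by
  induction k generalizing u with
  | zero => simp [words]
  | succ k ih =>
    cases u with
    | nil => simp [words]
    | cons b u =>
      simp only [words, Finset.mem_map, Finset.mem_product, Finset.mem_univ, true_and, ih,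
        List.length_cons, Nat.add_right_cancel_iff]
      exact ⟨fun ⟨x, hx, h⟩ => (List.cons.inj h).2 ▸ hx, fun h => ⟨(b, u), h, rfl⟩⟩

theorem sum_words_succ {M : Type*} [AddCommMonoid M] (k : ℕ) (f : List (Fin 2) → M) :
    ∑ u ∈ words (k + 1), f u = ∑ u ∈ words k, (f (0 :: u) + f (1 :: u)) := by
  rw [words, Finset.sum_map, Finset.sum_product, Fin.sum_univ_two, Finset.sum_add_distrib]
  rfl

theorem sum_words_zero {M : Type*} [AddCommMonoid M] (f : List (Fin 2) → M) :
    ∑ u ∈ words 0, f u = f [] := by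
  simp [words]

/-- The probability that a random string starts with a given word. -/
def wordProb (p : ℝ) : List (Fin 2) → ℝ
  | [] => 1
  | b :: u => bitProb p b * wordProb p u

theorem bitProb_zero (p : ℝ) : bitProb p 0 = 1 - p := by simp [bitProb]

theorem bitProb_one (p : ℝ) : bitProb p 1 = p := by simp [bitProb]

theorem bitProb_pos {p : ℝ} (hp0 : 0 < p) (hp1 : p < 1) (b : Fin 2) : 0 < bitProb p b := by
  unfold bitProb; split_ifs <;> linarith

theorem wordProb_pos {p : ℝ} (hp0 : 0 < p) (hp1 : p < 1) (u : List (Fin 2)) :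
    0 < wordProb p u := by
  induction u with
  | nil => simp [wordProb]
  | cons b u ih => exact mul_pos (bitProb_pos hp0 hp1 b) ih

/-- The case m = 1 is total mass. The case m = 2 is the probability that two independent strings
agree on k bits; it governs both the separation of the strings and the decay of the noise. -/
theorem sum_wordProb_pow (p : ℝ) (k m : ℕ) :
    ∑ u ∈ words k, wordProb p u ^ m = ((1 - p) ^ m + p ^ m) ^ k := by
  induction k with
  | zero => simp [sum_words_zero, wordProb]
  | succ k ih =>
    rw [sum_words_succ, pow_succ, ← ih, Finset.sum_mul]
    refine Finset.sum_congr rfl fun u _ => ?_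
    simp only [wordProb, bitProb_zero, bitProb_one, mul_pow]
    ring

theorem sum_wordProb (p : ℝ) (k : ℕ) : ∑ u ∈ words k, wordProb p u = 1 := by
  simpa using sum_wordProb_pow p k 1

variable {n : ℕ}

/-- The data that start with the word `u`. -/
def cyl (s : Fin n → ℕ → Fin 2) (u : List (Fin 2)) : Finset (Fin n) :=
  Finset.univ.filter fun i => prefixWord (s i) u.length = u

/-- The number of data that start with the word `u`. -/
def cnt (s : Fin n → ℕ → Fin 2) (u : List (Fin 2)) : ℕ := (cyl s u).card

/-- The number of data that are smaller than every string that starts with `u`. -/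
def cntBelow (s : Fin n → ℕ → Fin 2) : List (Fin 2) → ℕ
  | [] => 0
  | b :: u => cntBelow s u + if b = 0 then 0 else cnt s (0 :: u)

theorem cyl_cons (s : Fin n → ℕ → Fin 2) (b : Fin 2) (u : List (Fin 2)) :
    cyl s (b :: u) = (cyl s u).filter fun i => s i u.length = b := by
  ext i
  simp [cyl, prefixWord, and_comm]

theorem cnt_nil (s : Fin n → ℕ → Fin 2) : cnt s [] = n := by
  simp [cnt, cyl, prefixWord]

theorem cnt_cons_add (s : Fin n → ℕ → Fin 2) (u : List (Fin 2)) :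
    cnt s (0 :: u) + cnt s (1 :: u) = cnt s u := by
  have h : cyl s (1 :: u) = (cyl s u).filter fun i => ¬ s i u.length = 0 := by
    rw [cyl_cons]; congr 1; ext i; generalize s i u.length = b; revert b; decide
  rw [cnt, cnt, h, cyl_cons, Finset.card_filter_add_card_filter_not, cnt]

theorem cntBelow_cons_zero (s : Fin n → ℕ → Fin 2) (u : List (Fin 2)) :
    cntBelow s (0 :: u) = cntBelow s u := by simp [cntBelow]

theorem cntBelow_cons_one (s : Fin n → ℕ → Fin 2) (u : List (Fin 2)) :
    cntBelow s (1 :: u) = cntBelow s u + cnt s (0 :: u) := by simp [cntBelow]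

/-! ### The run of the algorithm in terms of counts -/

/-- The bits that Radix Selection follows when it looks for rank `l`. -/
def rankBits (s : Fin n → ℕ → Fin 2) (l k : ℕ) : Fin 2 :=
  if (selectState s l k).2 ≤ ((selectState s l k).1.filter fun i => s i k = 0).card then 0 else 1

/-- This reduces the algorithm to prefix counts. Truncated subtraction does no harm, since
`Nat.sub_sub` needs no side condition. -/
theorem selectState_eq (s : Fin n → ℕ → Fin 2) (l k : ℕ) :
    selectState s l k =
      (cyl s (prefixWord (rankBits s l) k), l - cntBelow s (prefixWord (rankBits s l) k)) := by
  induction k with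
  | zero => simp [selectState, prefixWord, cyl, cntBelow]
  | succ k ih =>
    have hb := rankBits.eq_1 s l k
    simp only [selectState, prefixWord]
    split_ifs with h
    · rw [if_pos h] at hb
      rw [hb, cyl_cons, cntBelow_cons_zero, ih, length_prefixWord]
    · rw [if_neg h] at hb
      rw [hb, cyl_cons, cntBelow_cons_one, ih, length_prefixWord, Nat.sub_sub]
      simp [cnt, cyl_cons]

theorem rankBits_eq (s : Fin n → ℕ → Fin 2) (l k : ℕ) :
    rankBits s l k = if l - cntBelow s (prefixWord (rankBits s l) k) ≤
      cnt s (0 :: prefixWord (rankBits s l) k) then 0 else 1 := by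
  conv_lhs => rw [rankBits, selectState_eq]
  simp [cnt, cyl_cons]

theorem cntBelow_lt_rank_and_le (s : Fin n → ℕ → Fin 2) {l : ℕ} (hl : 1 ≤ l) (hn : l ≤ n)
    (k : ℕ) :
    cntBelow s (prefixWord (rankBits s l) k) < l ∧
      l ≤ cntBelow s (prefixWord (rankBits s l) k) + cnt s (prefixWord (rankBits s l) k) := by
  induction k with
  | zero => simp [prefixWord, cntBelow, cnt_nil]; omega
  | succ k ih =>
    have h1 := rankBits_eq s l k
    have h2 := cnt_cons_add s (prefixWord (rankBits s l) k)
    simp only [prefixWord]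
    split_ifs at h1 with h
    · rw [h1, cntBelow_cons_zero]; omega
    · rw [h1, cntBelow_cons_one]; omega

/-- Bucket sizes decrease along a path, so nothing is paid from level L on. The infinite sum then
has finite support and its default value plays no role. -/
theorem bucketOps_eq (s : Fin n → ℕ → Fin 2) (l L : ℕ) (hL : ∀ u ∈ words L, cnt s u ≤ 1) :
    bucketOps s l = ∑ k ∈ Finset.range L,
      if 2 ≤ cnt s (prefixWord (rankBits s l) k) then cnt s (prefixWord (rankBits s l) k)
        else 0 := by
  have hanti : ∀ k, L ≤ k → cnt s (prefixWord (rankBits s l) k) ≤ 1 := by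
    intro k hk
    induction k, hk using Nat.le_induction with
    | base => exact hL _ (mem_words.2 (by simp))
    | succ k _ ih =>
      refine le_trans (Finset.card_le_card ?_) ih
      rw [prefixWord, cyl_cons]
      exact Finset.filter_subset _ _
  simp only [bucketOps, selectState_eq]
  refine tsum_eq_sum fun k hk => if_neg ?_
  have := hanti k (by simpa using hk)
  simp only [cnt] at this
  omega

/-! ### Telescoping the cost along a path -/

/-- The coefficient of the noise at a node when the next bit is `b`. -/
def coef (p : ℝ) (b : Fin 2) : ℝ := if b = 0 then 1 / p else -1 / (1 - p)

/-- The normalized fluctuation, at the node `u`, of the number of data that continue with `0`. -/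
def noise (p : ℝ) (s : Fin n → ℕ → Fin 2) (u : List (Fin 2)) : ℝ :=
  (cnt s (0 :: u) - (1 - p) * cnt s u) / √(n : ℝ)

/-- The sum of `coef * w` along the first `K` nodes of the path `x`. -/
def pathSum (p : ℝ) (w : List (Fin 2) → ℝ) (K : ℕ) (x : ℕ → Fin 2) : ℝ :=
  ∑ k ∈ Finset.range K, coef p (x k) * w (prefixWord x k)

/-- With c = (2p-1)/(p(1-p)) = 1/(1-p) - 1/p, the potential N/p + c(y - A) changes on each branch by
N up to a multiple of the splitting error. The multiples are the values of `coef`. The identity is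
exact for every y and every path x. -/
theorem sum_cnt_eq {p : ℝ} (hp0 : 0 < p) (hp1 : p < 1) (s : Fin n → ℕ → Fin 2) (x : ℕ → Fin 2)
    (y : ℝ) (L : ℕ) :
    ∑ k ∈ Finset.range L, (cnt s (prefixWord x k) : ℝ) =
      ((2 * p - 1) / (p * (1 - p)) * y + n / p) -
      ((2 * p - 1) / (p * (1 - p)) * (y - cntBelow s (prefixWord x L)) +
        cnt s (prefixWord x L) / p) + √(n : ℝ) * pathSum p (noise p s) L x := by
  have hq : (1 - p) ≠ 0 := by linarith
  have hp : p ≠ 0 := hp0.ne'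
  induction L with
  | zero => simp [pathSum, prefixWord, cntBelow, cnt_nil]
  | succ L ih =>
    rw [Finset.sum_range_succ, ih, pathSum, pathSum, Finset.sum_range_succ, mul_add]
    have h2 : (cnt s (0 :: prefixWord x L) : ℝ) + cnt s (1 :: prefixWord x L) =
      cnt s (prefixWord x L) := by exact_mod_cast cnt_cons_add s (prefixWord x L)
    have hnoise : √(n : ℝ) * (coef p (x L) * noise p s (prefixWord x L)) =
        coef p (x L) * (cnt s (0 :: prefixWord x L) - (1 - p) * cnt s (prefixWord x L)) := by
      rcases Nat.eq_zero_or_pos n with rfl | hn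
      · simp [cnt, cyl]
      · have : √(n : ℝ) ≠ 0 := by positivity
        rw [noise]; field_simp
    rw [hnoise]
    simp only [prefixWord]
    rcases Fin.exists_fin_two.1 ⟨x L, rfl⟩ with h | h
    · rw [h, cntBelow_cons_zero, ← h2]
      simp only [coef, if_true]
      field_simp
      ring
    · rw [h, cntBelow_cons_one, ← h2]
      simp only [coef, one_ne_zero, if_false]
      push_cast
      field_simp
      ring

end

section

/-! ### The binary expansion of a point of `[0,1]` -/

/-- The bits `g(t,1), g(t,2), …`. -/
def bits (p t : ℝ) (k : ℕ) : Fin 2 := gFun p t (k + 1)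

theorem bits_eq (p t : ℝ) (k : ℕ) : bits p t k = if hFun p t k < 1 - p then 0 else 1 := rfl

/-- The induction must carry one-sided convergence: at the threshold 1 - p the upper branch is
taken, and only an approach from the right stays in it. -/
theorem tendsto_hFun_right {p : ℝ} (hp0 : 0 < p) (hp1 : p < 1) (t : ℝ) (k : ℕ) :
    Tendsto (fun u => hFun p u k) (𝓝[≥] t) (𝓝[≥] hFun p t k) := by
  induction k with
  | zero => exact tendsto_id
  | succ k ih =>
    by_cases h : hFun p t k < 1 - p
    · have h1 : ∀ᶠ u in 𝓝[≥] t, hFun p u k < 1 - p :=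
        ih.eventually (nhdsWithin_le_nhds (eventually_lt_nhds h))
      have h2 : Tendsto (fun y => y / (1 - p)) (𝓝[≥] hFun p t k) (𝓝[≥] (hFun p t k / (1 - p))) :=
        ContinuousWithinAt.tendsto_nhdsWithin (by fun_prop) fun y hy =>
          div_le_div_of_nonneg_right hy (sub_pos.2 hp1).le
      rw [show hFun p t (k + 1) = hFun p t k / (1 - p) by simp [hFun, h]]
      refine (h2.comp ih).congr' ?_
      filter_upwards [h1] with u hu
      simp [hFun, hu]
    · have h1 : ∀ᶠ u in 𝓝[≥] t, ¬ hFun p u k < 1 - p := by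
        filter_upwards [ih.eventually self_mem_nhdsWithin] with u hu
        exact not_lt.2 ((not_lt.1 h).trans hu)
      have h2 : Tendsto (fun y => (y - (1 - p)) / p) (𝓝[≥] hFun p t k)
          (𝓝[≥] ((hFun p t k - (1 - p)) / p)) :=
        ContinuousWithinAt.tendsto_nhdsWithin (by fun_prop) fun y hy =>
          div_le_div_of_nonneg_right (sub_le_sub_right hy _) hp0.le
      rw [show hFun p t (k + 1) = (hFun p t k - (1 - p)) / p by simp [hFun, h]]
      refine (h2.comp ih).congr' ?_
      filter_upwards [h1] with u hu
      simp [hFun, hu]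

theorem eventually_bits_right {p : ℝ} (hp0 : 0 < p) (hp1 : p < 1) (t : ℝ) (k : ℕ) :
    ∀ᶠ u in 𝓝[≥] t, bits p u k = bits p t k := by
  have ih := tendsto_hFun_right hp0 hp1 t k
  by_cases h : hFun p t k < 1 - p
  · filter_upwards [ih.eventually (nhdsWithin_le_nhds (eventually_lt_nhds h))] with u hu
    simp [bits_eq, h, hu]
  · filter_upwards [ih.eventually self_mem_nhdsWithin] with u hu
    have : ¬ hFun p u k < 1 - p := not_lt.2 ((not_lt.1 h).trans hu)
    simp [bits_eq, h, this]

/-- The limit l may differ from `hFun p t k`: a value tending to 1 - p from strictly below stays in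
the lower branch. Hence the case distinction on l ≤ 1 - p, against the strict inequality in `hFun`.
-/
theorem exists_tendsto_hFun_left {p : ℝ} (hp0 : 0 < p) (hp1 : p < 1) (t : ℝ) (k : ℕ) :
    ∃ l, Tendsto (fun u => hFun p u k) (𝓝[<] t) (𝓝[<] l) := by
  induction k with
  | zero => exact ⟨t, tendsto_id⟩
  | succ k ih =>
    obtain ⟨l, ih⟩ := ih
    by_cases h : l ≤ 1 - p
    · have h1 : ∀ᶠ u in 𝓝[<] t, hFun p u k < 1 - p := by
        filter_upwards [ih.eventually self_mem_nhdsWithin] with u hu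
        exact lt_of_lt_of_le hu h
      have h2 : Tendsto (fun y => y / (1 - p)) (𝓝[<] l) (𝓝[<] (l / (1 - p))) :=
        ContinuousWithinAt.tendsto_nhdsWithin (by fun_prop) fun y hy =>
          div_lt_div_of_pos_right hy (sub_pos.2 hp1)
      refine ⟨_, (h2.comp ih).congr' ?_⟩
      filter_upwards [h1] with u hu
      simp [hFun, hu]
    · have h1 : ∀ᶠ u in 𝓝[<] t, 1 - p < hFun p u k :=
        ih.eventually (nhdsWithin_le_nhds (eventually_gt_nhds (not_le.1 h)))
      have h2 : Tendsto (fun y => (y - (1 - p)) / p) (𝓝[<] l) (𝓝[<] ((l - (1 - p)) / p)) :=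
        ContinuousWithinAt.tendsto_nhdsWithin (by fun_prop) fun y hy =>
          div_lt_div_of_pos_right (sub_lt_sub_right hy _) hp0
      refine ⟨_, (h2.comp ih).congr' ?_⟩
      filter_upwards [h1] with u hu
      simp [hFun, hu.not_gt]

theorem exists_eventually_bits_left {p : ℝ} (hp0 : 0 < p) (hp1 : p < 1) (t : ℝ) :
    ∃ x : ℕ → Fin 2, ∀ k, ∀ᶠ u in 𝓝[<] t, bits p u k = x k := by
  have h : ∀ k, ∃ b : Fin 2, ∀ᶠ u in 𝓝[<] t, bits p u k = b := by
    intro k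
    obtain ⟨l, ih⟩ := exists_tendsto_hFun_left hp0 hp1 t k
    by_cases h : l ≤ 1 - p
    · refine ⟨0, ?_⟩
      filter_upwards [ih.eventually self_mem_nhdsWithin] with u hu
      simp [bits_eq, lt_of_lt_of_le hu h]
    · refine ⟨1, ?_⟩
      filter_upwards [ih.eventually (nhdsWithin_le_nhds (eventually_gt_nhds (not_le.1 h)))]
        with u hu
      simp [bits_eq, (show 1 - p < hFun p u k from hu).not_gt]
  choose x hx using h
  exact ⟨x, hx⟩

theorem tendsto_coe_right (t : I) : Tendsto ((↑) : I → ℝ) (𝓝[≥] t) (𝓝[≥] (t : ℝ)) :=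
  ContinuousWithinAt.tendsto_nhdsWithin (by fun_prop) fun _ hu => hu

theorem tendsto_coe_left (t : I) : Tendsto ((↑) : I → ℝ) (𝓝[<] t) (𝓝[<] (t : ℝ)) :=
  ContinuousWithinAt.tendsto_nhdsWithin (by fun_prop) fun _ hu => hu

theorem eventually_forall_lt {α : Type*} {l : Filter α} {q : ℕ → α → Prop}
    (h : ∀ k, ∀ᶠ a in l, q k a) (K : ℕ) : ∀ᶠ a in l, ∀ k < K, q k a :=
  (Set.finite_lt_nat K).eventually_all.2 fun k _ => h k

/-! ### Step paths and series paths -/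

theorem pathSum_congr {p : ℝ} {w : List (Fin 2) → ℝ} {K : ℕ} {x y : ℕ → Fin 2}
    (h : ∀ k < K, x k = y k) : pathSum p w K x = pathSum p w K y := by
  refine Finset.sum_congr rfl fun k hk => ?_
  have hk := Finset.mem_range.1 hk
  rw [h k hk, prefixWord_congr fun j hj => h j (hj.trans hk)]

/-- The limit of `pathSum p w K x` as `K → ∞`. -/
def pathSeries (p : ℝ) (w : List (Fin 2) → ℝ) (x : ℕ → Fin 2) : ℝ :=
  ∑' k, coef p (x k) * w (prefixWord x k)

/-- A bound for `|coef p b|`. -/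
def coefBound (p : ℝ) : ℝ := 1 / p + 1 / (1 - p)

theorem coefBound_pos {p : ℝ} (hp0 : 0 < p) (hp1 : p < 1) : 0 < coefBound p := by
  have : 0 < 1 - p := by linarith
  unfold coefBound; positivity

theorem abs_coef_le {p : ℝ} (hp0 : 0 < p) (hp1 : p < 1) (b : Fin 2) :
    |coef p b| ≤ coefBound p := by
  have hq : 0 < 1 - p := by linarith
  have h1 : 0 < 1 / p := by positivity
  have h2 : 0 < 1 / (1 - p) := by positivity
  unfold coef coefBound
  split_ifs
  · rw [abs_of_pos h1]; linarith
  · rw [neg_div, abs_neg, abs_of_pos h2]; linarith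

/-- Dominated convergence: each term involves finitely many bits and is eventually constant. Both
càdlàg properties of the series path follow from this. -/
theorem tendsto_pathSeries {α : Type*} {l : Filter α} {p : ℝ} (hp0 : 0 < p) (hp1 : p < 1)
    {w : List (Fin 2) → ℝ} {D : ℕ → ℝ} (hD : Summable D) (hw : ∀ u, |w u| ≤ D u.length)
    {x : α → ℕ → Fin 2} {y : ℕ → Fin 2} (h : ∀ k, ∀ᶠ a in l, x a k = y k) :
    Tendsto (fun a => pathSeries p w (x a)) l (𝓝 (pathSeries p w y)) := by
  refine tendsto_tsum_of_dominated_convergence (hD.mul_left (coefBound p)) (fun k => ?_) ?_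
  · refine tendsto_const_nhds.congr' ?_
    filter_upwards [eventually_forall_lt h (k + 1)] with a ha
    rw [ha k (by omega), prefixWord_congr fun j hj => ha j (by omega)]
  · refine Eventually.of_forall fun a k => ?_
    rw [Real.norm_eq_abs, abs_mul]
    refine mul_le_mul (abs_coef_le hp0 hp1 _) ?_ (abs_nonneg _) (coefBound_pos hp0 hp1).le
    simpa using hw (prefixWord (x a) k)

/-- The path `t ↦ pathSeries p w (bits p t)` for summably bounded weights. -/
def seriesPath {p : ℝ} (hp0 : 0 < p) (hp1 : p < 1) (w : List (Fin 2) → ℝ) {D : ℕ → ℝ}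
    (hD : Summable D) (hw : ∀ u, |w u| ≤ D u.length) : CadlagSpace where
  toFun t := pathSeries p w (bits p t)
  right_cont t := tendsto_pathSeries hp0 hp1 hD hw fun k =>
    (tendsto_coe_right t).eventually (eventually_bits_right hp0 hp1 t k)
  left_lim t := by
    obtain ⟨x, hx⟩ := exists_eventually_bits_left hp0 hp1 t
    exact ⟨_, tendsto_pathSeries hp0 hp1 hD hw fun k => (tendsto_coe_left t).eventually (hx k)⟩

/-- The path `t ↦ pathSum p w K (bits p t)`, a step function. -/
def stepPath {p : ℝ} (hp0 : 0 < p) (hp1 : p < 1) (K : ℕ) (w : List (Fin 2) → ℝ) :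
    CadlagSpace where
  toFun t := pathSum p w K (bits p t)
  right_cont t := by
    refine tendsto_const_nhds.congr' ?_
    filter_upwards [eventually_forall_lt (fun k =>
      (tendsto_coe_right t).eventually (eventually_bits_right hp0 hp1 t k)) K] with u hu
    exact (pathSum_congr hu).symm
  left_lim t := by
    obtain ⟨x, hx⟩ := exists_eventually_bits_left hp0 hp1 t
    refine ⟨pathSum p w K x, tendsto_const_nhds.congr' ?_⟩
    filter_upwards [eventually_forall_lt (fun k => (tendsto_coe_left t).eventually (hx k)) K]
      with u hu
    exact (pathSum_congr hu).symm

/-- The Skorokhod distance is at most the uniform distance. -/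
theorem edist_le_of_forall_abs_sub_le {x y : CadlagSpace} {c : ℝ} (h : ∀ t, |x t - y t| ≤ c) :
    edist x y ≤ ENNReal.ofReal c := by
  refine (iInf_le _ (OrderIso.refl I)).trans (max_le ?_ (iSup_le fun t => ?_))
  · simp
  · rw [edist_dist, Real.dist_eq]
    exact ENNReal.ofReal_le_ofReal (h t)

/-! ### Cylinder intervals -/

/-- The left end point of the interval of the points whose expansion starts with `u`. -/
def wordLeft (p : ℝ) : List (Fin 2) → ℝ
  | [] => 0
  | b :: u => wordLeft p u + if b = 0 then 0 else (1 - p) * wordProb p u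

/-- The cylinder of v is parametrized affinely by the remainder h. The induction feeds (1-p)h or
(1-p) + ph, the inverse branches of the map behind `hFun`, into the parent cylinder. -/
theorem prefixWord_bits {p : ℝ} (hp0 : 0 < p) (hp1 : p < 1) (v : List (Fin 2)) :
    ∀ h : ℝ, 0 ≤ h → h < 1 →
      prefixWord (bits p (wordLeft p v + wordProb p v * h)) v.length = v ∧
        hFun p (wordLeft p v + wordProb p v * h) v.length = h := by
  have hq : 0 < 1 - p := by linarith
  induction v with
  | nil => intro h _ _; simp [prefixWord, wordLeft, wordProb, hFun]
  | cons b u ih =>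
    intro h h0 h1
    rcases Fin.exists_fin_two.1 ⟨b, rfl⟩ with rfl | rfl
    · obtain ⟨i1, i2⟩ := ih ((1 - p) * h) (by positivity) (by nlinarith)
      have he : wordLeft p (0 :: u) + wordProb p (0 :: u) * h =
          wordLeft p u + wordProb p u * ((1 - p) * h) := by
        simp [wordLeft, wordProb, bitProb_zero]; ring
      have hlt : (1 - p) * h < 1 - p := by nlinarith
      rw [he, List.length_cons, prefixWord, i1, bits_eq, hFun, i2, if_pos hlt, if_pos hlt]
      exact ⟨rfl, by field_simp⟩
    · obtain ⟨i1, i2⟩ := ih ((1 - p) + p * h) (by positivity) (by nlinarith)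
      have he : wordLeft p (1 :: u) + wordProb p (1 :: u) * h =
          wordLeft p u + wordProb p u * ((1 - p) + p * h) := by
        simp [wordLeft, wordProb, bitProb_one]; ring
      have hlt : ¬ (1 - p) + p * h < 1 - p := by
        have := mul_nonneg hp0.le h0; linarith
      rw [he, List.length_cons, prefixWord, i1, bits_eq, hFun, i2, if_neg hlt, if_neg hlt]
      exact ⟨rfl, by field_simp; ring⟩

/-- The point 1 lies in no half-open cylinder interval and is treated apart: it is fixed by the
upper branch. -/
theorem hFun_one {p : ℝ} (hp0 : 0 < p) (k : ℕ) : hFun p 1 k = 1 := by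
  induction k with
  | zero => rfl
  | succ k ih =>
    rw [hFun, ih, if_neg (by linarith)]
    field_simp; ring

theorem bits_one {p : ℝ} (hp0 : 0 < p) (k : ℕ) : bits p 1 k = 1 := by
  rw [bits_eq, hFun_one hp0, if_neg (by linarith)]

end

section

variable {n : ℕ}

/-! ### The time change -/

/-- The length of the part of the block of `u` that lies to the left of `x`. -/
def cellPart (s : Fin n → ℕ → Fin 2) (u : List (Fin 2)) (x : ℝ) : ℝ :=
  min x (cntBelow s u + cnt s u) - min x (cntBelow s u)

theorem cellPart_nonneg (s : Fin n → ℕ → Fin 2) (u : List (Fin 2)) (x : ℝ) :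
    0 ≤ cellPart s u x :=
  sub_nonneg.2 (min_le_min_left _ (by simp))

theorem cellPart_mono (s : Fin n → ℕ → Fin 2) (u : List (Fin 2)) : Monotone (cellPart s u) := by
  intro x y hxy
  have : (0 : ℝ) ≤ cnt s u := by positivity
  unfold cellPart
  grind

theorem cellPart_of_le {s : Fin n → ℕ → Fin 2} {u : List (Fin 2)} {x : ℝ}
    (h : x ≤ cntBelow s u) : cellPart s u x = 0 := by
  have : (0 : ℝ) ≤ cnt s u := by positivity
  rw [cellPart, min_eq_left h, min_eq_left (by linarith), sub_self]

theorem cellPart_of_ge {s : Fin n → ℕ → Fin 2} {u : List (Fin 2)} {x : ℝ}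
    (h : cntBelow s u + cnt s u ≤ x) : cellPart s u x = cnt s u := by
  have : (0 : ℝ) ≤ cnt s u := by positivity
  rw [cellPart, min_eq_right h, min_eq_right (by linarith)]; ring

theorem cellPart_of_mem {s : Fin n → ℕ → Fin 2} {u : List (Fin 2)} {x : ℝ}
    (h1 : cntBelow s u ≤ x) (h2 : x ≤ cntBelow s u + cnt s u) :
    cellPart s u x = x - cntBelow s u := by
  rw [cellPart, min_eq_left h2, min_eq_right h1]

theorem cast_cnt_cons_add (s : Fin n → ℕ → Fin 2) (u : List (Fin 2)) :
    (cnt s (0 :: u) : ℝ) + cnt s (1 :: u) = cnt s u := by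
  exact_mod_cast cnt_cons_add s u

theorem cellPart_cons_add (s : Fin n → ℕ → Fin 2) (u : List (Fin 2)) (x : ℝ) :
    cellPart s (0 :: u) x + cellPart s (1 :: u) x = cellPart s u x := by
  simp only [cellPart, cntBelow_cons_zero, cntBelow_cons_one, ← cast_cnt_cons_add s u]
  push_cast
  rw [add_assoc]; ring

theorem sum_cellPart (s : Fin n → ℕ → Fin 2) (K : ℕ) {x : ℝ} (h0 : 0 ≤ x) (h1 : x ≤ n) :
    ∑ u ∈ words K, cellPart s u x = x := by
  induction K with
  | zero => simp [sum_words_zero, cellPart, cntBelow, cnt_nil, h0, h1]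
  | succ K ih => simp only [sum_words_succ, cellPart_cons_add, ih]

/-- The piecewise linear function that maps the block of each word of length `K` onto its
cylinder interval. -/
def timeChange (p : ℝ) (s : Fin n → ℕ → Fin 2) (K : ℕ) (x : ℝ) : ℝ :=
  ∑ u ∈ words K, wordProb p u * (cellPart s u x / cnt s u)

/-- Blocks of distinct words of equal length do not overlap, so at x every block other than that of
v is either still empty or already full. -/
theorem le_or_ge_of_ne {s : Fin n → ℕ → Fin 2} {x : ℝ} {v : List (Fin 2)} :
    ∀ {w : List (Fin 2)}, w.length = v.length → w ≠ v → cntBelow s v ≤ x →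
      x < cntBelow s v + cnt s v → x ≤ cntBelow s w ∨ cntBelow s w + cnt s w ≤ x := by
  induction v with
  | nil => intro w hw hne; simp at hw; exact absurd hw hne
  | cons b v ih =>
    rintro (_ | ⟨c, w⟩) hw hne h1 h2
    · simp at hw
    have hv := cast_cnt_cons_add s v
    have hww := cast_cnt_cons_add s w
    have e1 := cntBelow_cons_zero s v
    have e2 := cntBelow_cons_one s v
    have e3 := cntBelow_cons_zero s w
    have e4 := cntBelow_cons_one s w
    have p1 : (0 : ℝ) ≤ cnt s (0 :: v) := by positivity
    have p2 : (0 : ℝ) ≤ cnt s (1 :: v) := by positivity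
    have p3 : (0 : ℝ) ≤ cnt s (0 :: w) := by positivity
    have p4 : (0 : ℝ) ≤ cnt s (1 :: w) := by positivity
    by_cases hvw : w = v
    · subst hvw
      rcases Fin.exists_fin_two.1 ⟨b, rfl⟩ with rfl | rfl <;>
      rcases Fin.exists_fin_two.1 ⟨c, rfl⟩ with rfl | rfl
      · exact absurd rfl hne
      · left; rw [e2]; rw [e1] at h2; push_cast; linarith
      · right; rw [e1]; rw [e2] at h1; push_cast at h1; linarith
      · exact absurd rfl hne
    · have hpar : (cntBelow s v : ℝ) ≤ x ∧ x < cntBelow s v + cnt s v := by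
        rcases Fin.exists_fin_two.1 ⟨b, rfl⟩ with rfl | rfl
        · rw [e1] at h1 h2; constructor <;> linarith
        · rw [e2] at h1 h2; push_cast at h1 h2; constructor <;> linarith
      rcases ih (by simpa using hw) hvw hpar.1 hpar.2 with h | h <;>
      rcases Fin.exists_fin_two.1 ⟨c, rfl⟩ with rfl | rfl
      · left; rwa [e3]
      · left; rw [e4]; push_cast; linarith
      · right; rw [e3]; linarith
      · right; rw [e4]; push_cast; linarith

theorem cnt_pos_of_cnt_pos_succ {s : Fin n → ℕ → Fin 2} {k : ℕ}
    (h : ∀ u ∈ words (k + 1), 0 < cnt s u) : ∀ u ∈ words k, 0 < cnt s u := by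
  intro u hu
  have := h (0 :: u) (mem_words.2 (by simp [mem_words.1 hu]))
  have := cnt_cons_add s u
  omega

/-- Here the global sum is identified with the affine map from the block of v to its cylinder, which
is the form that `prefixWord_bits` takes. -/
theorem timeChange_of_mem (p : ℝ) {s : Fin n → ℕ → Fin 2} {x : ℝ} {v : List (Fin 2)}
    (hpos : ∀ u ∈ words v.length, 0 < cnt s u) (h1 : cntBelow s v ≤ x)
    (h2 : x < cntBelow s v + cnt s v) :
    timeChange p s v.length x =
      wordLeft p v + wordProb p v * ((x - cntBelow s v) / cnt s v) := by
  induction v with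
  | nil =>
    simp only [timeChange, List.length_nil, sum_words_zero, wordLeft, zero_add]
    rw [cellPart_of_mem h1 h2.le]
  | cons b v ih =>
    have hpos' := cnt_pos_of_cnt_pos_succ hpos
    have hv := cast_cnt_cons_add s v
    have e1 := cntBelow_cons_zero s v
    have e2 := cntBelow_cons_one s v
    have p1 : (0 : ℝ) < cnt s (0 :: v) := by
      exact_mod_cast hpos (0 :: v) (mem_words.2 (by simp))
    have p2 : (0 : ℝ) < cnt s (1 :: v) := by
      exact_mod_cast hpos (1 :: v) (mem_words.2 (by simp))
    have hpar : (cntBelow s v : ℝ) ≤ x ∧ x < cntBelow s v + cnt s v := by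
      rcases Fin.exists_fin_two.1 ⟨b, rfl⟩ with rfl | rfl
      · rw [e1] at h1 h2; constructor <;> linarith
      · rw [e2] at h1 h2; push_cast at h1 h2; constructor <;> linarith
    have ih' := ih hpos' hpar.1 hpar.2
    -- Refining by one level changes only the term of v: an empty block contributes 0 before and
    -- after, and the probability of a full block is the sum over its children.
    have hdiff : timeChange p s (v.length + 1) x - timeChange p s v.length x =
        wordProb p (0 :: v) * (cellPart s (0 :: v) x / cnt s (0 :: v)) +
        wordProb p (1 :: v) * (cellPart s (1 :: v) x / cnt s (1 :: v)) -
        wordProb p v * (cellPart s v x / cnt s v) := by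
      rw [timeChange, timeChange, sum_words_succ, ← Finset.sum_sub_distrib]
      refine Finset.sum_eq_single v (fun w hw hne => ?_) fun h => absurd (mem_words.2 rfl) h
      have hlen := mem_words.1 hw
      have q0 : (0 : ℝ) < cnt s w := by exact_mod_cast hpos' w hw
      have q1 : (0 : ℝ) < cnt s (0 :: w) := by
        exact_mod_cast hpos (0 :: w) (mem_words.2 (by simp [hlen]))
      have q2 : (0 : ℝ) < cnt s (1 :: w) := by
        exact_mod_cast hpos (1 :: w) (mem_words.2 (by simp [hlen]))
      have hw' := cast_cnt_cons_add s w
      rcases le_or_ge_of_ne hlen hne hpar.1 hpar.2 with h | h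
      · rw [cellPart_of_le h, cellPart_of_le (by rwa [cntBelow_cons_zero]),
          cellPart_of_le (by rw [cntBelow_cons_one]; push_cast; linarith)]
        simp
      · rw [cellPart_of_ge h, cellPart_of_ge (by rw [cntBelow_cons_zero]; linarith),
          cellPart_of_ge (by rw [cntBelow_cons_one]; push_cast; linarith),
          div_self q0.ne', div_self q1.ne', div_self q2.ne']
        simp only [wordProb, bitProb_zero, bitProb_one]; ring
    rw [List.length_cons, eq_add_of_sub_eq hdiff, ih', cellPart_of_mem hpar.1 hpar.2.le]
    rcases Fin.exists_fin_two.1 ⟨b, rfl⟩ with rfl | rfl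
    · rw [cellPart_of_mem h1 h2.le, cellPart_of_le (u := 1 :: v)
        (by rw [e2]; rw [e1] at h2; push_cast; exact h2.le)]
      simp only [wordLeft, if_true]; ring
    · rw [cellPart_of_mem h1 h2.le, cellPart_of_ge (u := 0 :: v)
        (by rw [e1]; rw [e2] at h1; push_cast at h1; exact h1), div_self p1.ne']
      simp only [wordLeft, one_ne_zero, if_false, wordProb, bitProb_zero]; ring

variable {p : ℝ} {s : Fin n → ℕ → Fin 2} {K : ℕ}

theorem continuous_timeChange (p : ℝ) (s : Fin n → ℕ → Fin 2) (K : ℕ) :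
    Continuous (timeChange p s K) := by
  unfold timeChange cellPart
  fun_prop

theorem timeChange_zero (p : ℝ) (s : Fin n → ℕ → Fin 2) (K : ℕ) : timeChange p s K 0 = 0 :=
  Finset.sum_eq_zero fun u _ => by rw [cellPart_of_le (by positivity)]; simp

theorem cntBelow_add_cnt_le (s : Fin n → ℕ → Fin 2) (u : List (Fin 2)) :
    cntBelow s u + cnt s u ≤ n := by
  induction u with
  | nil => simp [cntBelow, cnt_nil]
  | cons b u ih =>
    have := cnt_cons_add s u
    rcases Fin.exists_fin_two.1 ⟨b, rfl⟩ with rfl | rfl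
    · rw [cntBelow_cons_zero]; omega
    · rw [cntBelow_cons_one]; omega

theorem timeChange_self (hpos : ∀ u ∈ words K, 0 < cnt s u) : timeChange p s K n = 1 := by
  rw [← sum_wordProb p K]
  refine Finset.sum_congr rfl fun u hu => ?_
  have : (0 : ℝ) < cnt s u := by exact_mod_cast hpos u hu
  rw [cellPart_of_ge (by exact_mod_cast cntBelow_add_cnt_le s u), div_self this.ne', mul_one]

theorem timeChange_mono (hp0 : 0 < p) (hp1 : p < 1) : Monotone (timeChange p s K) := fun x y hxy =>
  Finset.sum_le_sum fun u _ => mul_le_mul_of_nonneg_left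
    (div_le_div_of_nonneg_right (cellPart_mono s u hxy) (by positivity))
    (wordProb_pos hp0 hp1 u).le

/-- The cell parts add up to the argument, so at least one of them grows strictly; its slope is
positive. -/
theorem timeChange_lt (hp0 : 0 < p) (hp1 : p < 1) (hpos : ∀ u ∈ words K, 0 < cnt s u) {x y : ℝ} (h0 : 0 ≤ x)
    (hxy : x < y) (h1 : y ≤ n) : timeChange p s K x < timeChange p s K y := by
  have hsum : ∑ u ∈ words K, cellPart s u x < ∑ u ∈ words K, cellPart s u y := by
    rwa [sum_cellPart s K h0 (hxy.le.trans h1), sum_cellPart s K (h0.trans hxy.le) h1]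
  obtain ⟨u, hu, hlt⟩ := Finset.exists_lt_of_sum_lt hsum
  refine Finset.sum_lt_sum (fun u _ => mul_le_mul_of_nonneg_left
    (div_le_div_of_nonneg_right (cellPart_mono s u hxy.le) (by positivity))
    (wordProb_pos hp0 hp1 u).le) ⟨u, hu, ?_⟩
  have : (0 : ℝ) < cnt s u := by exact_mod_cast hpos u hu
  exact mul_lt_mul_of_pos_left (div_lt_div_of_pos_right hlt this) (wordProb_pos hp0 hp1 u)

theorem exists_orderIso (hp0 : 0 < p) (hp1 : p < 1) (hn : 0 < n)
    (hpos : ∀ u ∈ words K, 0 < cnt s u) :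
    ∃ lam : I ≃o I, ∀ t : I, (lam t : ℝ) = timeChange p s K (t * n) := by
  have hn' : (0 : ℝ) < n := by exact_mod_cast hn
  have hmono := timeChange_mono hp0 hp1 (s := s) (K := K)
  have hx : ∀ t : I, 0 ≤ (t : ℝ) * n ∧ (t : ℝ) * n ≤ n := fun t =>
    ⟨mul_nonneg t.2.1 hn'.le, mul_le_of_le_one_left hn'.le t.2.2⟩
  let f : I → I := fun t => ⟨timeChange p s K (t * n),
    (timeChange_zero p s K).symm.le.trans (hmono (hx t).1),
    (hmono (hx t).2).trans (timeChange_self hpos).le⟩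
  have hf : StrictMono f := fun t u htu => by
    have : (t : ℝ) < u := htu
    exact timeChange_lt hp0 hp1 hpos (hx t).1 (mul_lt_mul_of_pos_right this hn') (hx u).2
  have hsurj : Function.Surjective f := by
    intro y
    have hcont : ContinuousOn (fun t : ℝ => timeChange p s K (t * n)) (Set.Icc 0 1) := by
      have := continuous_timeChange p s K
      exact Continuous.continuousOn (by fun_prop)
    have hy : (y : ℝ) ∈ Set.Icc (timeChange p s K ((0 : ℝ) * n)) (timeChange p s K ((1 : ℝ) * n)) := by
      rw [zero_mul, one_mul, timeChange_zero, timeChange_self hpos]; exact y.2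
    obtain ⟨t, ht, hty⟩ := intermediate_value_Icc zero_le_one hcont hy
    exact ⟨⟨t, ht⟩, Subtype.ext hty⟩
  exact ⟨StrictMono.orderIsoOfSurjective f hf hsurj, fun t => rfl⟩

theorem abs_timeChange_sub_le (hn : 0 < n) (hpos : ∀ u ∈ words K, 0 < cnt s u) {t : ℝ}
    (h0 : 0 ≤ t) (h1 : t ≤ 1) :
    |timeChange p s K (t * n) - t| ≤ ∑ u ∈ words K, |(cnt s u : ℝ) / n - wordProb p u| := by
  have hn' : (0 : ℝ) < n := by exact_mod_cast hn
  -- The identity map has the same expansion, with frequencies in place of probabilities. The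
  -- filling ratios lie in [0,1], so the two maps differ by at most the sum of the differences of
  -- the weights.
  have ht : t = ∑ u ∈ words K, (cnt s u : ℝ) / n * (cellPart s u (t * n) / cnt s u) := by
    have h := sum_cellPart s K (mul_nonneg h0 hn'.le) (mul_le_of_le_one_left hn'.le h1)
    have : t = (∑ u ∈ words K, cellPart s u (t * n)) / n := by rw [h]; field_simp
    conv_lhs => rw [this]
    rw [Finset.sum_div]
    refine Finset.sum_congr rfl fun u hu => ?_
    have : (0 : ℝ) < cnt s u := by exact_mod_cast hpos u hu
    field_simp
  conv_lhs => rw [timeChange]; enter [1, 2]; rw [ht]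
  rw [← Finset.sum_sub_distrib]
  refine (Finset.abs_sum_le_sum_abs _ _).trans (Finset.sum_le_sum fun u hu => ?_)
  have : (0 : ℝ) < cnt s u := by exact_mod_cast hpos u hu
  rw [← sub_mul, abs_mul, abs_sub_comm]
  refine mul_le_of_le_one_right (abs_nonneg _) ?_
  rw [abs_of_nonneg (div_nonneg (cellPart_nonneg _ _ _) this.le), div_le_one this,
    ← cellPart_of_ge (s := s) (u := u) (x := max (t * n) (cntBelow s u + cnt s u))
      (le_max_right _ _)]
  exact cellPart_mono s u (le_max_left _ _)

end

section

variable {n : ℕ} {p : ℝ} {s : Fin n → ℕ → Fin 2} {K L : ℕ}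

/-! ### Comparison of the normalized path with a step path -/

/-- The largest datum is sought, and the 1-child is nonempty at each of these levels. This is the
case t = 1, where the convention Y_n(n+1) = Y_n(n) applies. -/
theorem rankBits_self (hpos : ∀ u ∈ words K, 0 < cnt s u) :
    ∀ k < K, rankBits s n k = 1 := by
  have hpos' : ∀ k ≤ K, ∀ u ∈ words k, 0 < cnt s u := by
    intro k hk
    induction hk using Nat.decreasingInduction with
    | self => exact hpos
    | of_succ k _ ih => exact cnt_pos_of_cnt_pos_succ ih
  have key : ∀ k ≤ K, cntBelow s (prefixWord (rankBits s n) k) +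
      cnt s (prefixWord (rankBits s n) k) = n ∧ ∀ j < k, rankBits s n j = 1 := by
    intro k
    induction k with
    | zero => intro _; simp [prefixWord, cntBelow, cnt_nil]
    | succ k ih =>
      intro hk
      obtain ⟨h1, h2⟩ := ih (by omega)
      have h3 := cnt_cons_add s (prefixWord (rankBits s n) k)
      have h4 := hpos' (k + 1) hk (1 :: prefixWord (rankBits s n) k) (mem_words.2 (by simp))
      have h5 := rankBits_eq s n k
      rw [if_neg (by omega)] at h5
      refine ⟨?_, fun j hj => ?_⟩
      · rw [prefixWord, h5, cntBelow_cons_one]; omega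
      · rcases Nat.lt_succ_iff_lt_or_eq.1 hj with h | rfl
        · exact h2 j h
        · exact h5
  exact (key K le_rfl).2

/-- The datum of rank l occupies [l-1, l), which contains tn for l = ⌊tn⌋ + 1 and t < 1. So tn lies
in the block of the word that the algorithm follows, and the time change sends it into the cylinder
of that word. -/
theorem bits_timeChange_eq_rankBits (hp0 : 0 < p) (hp1 : p < 1) (hn : 0 < n)
    (hpos : ∀ u ∈ words K, 0 < cnt s u) (t : I) :
    ∀ k < K, bits p (timeChange p s K (t * n)) k =
      rankBits s (min (⌊(t : ℝ) * n⌋₊ + 1) n) k := by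
  have hn' : (0 : ℝ) < n := by exact_mod_cast hn
  rcases eq_or_lt_of_le t.2.2 with ht | ht
  · intro k hk
    rw [ht, one_mul, Nat.floor_natCast, min_eq_right (by omega), rankBits_self hpos k hk,
      timeChange_self hpos, bits_one hp0]
  · have hfl : ⌊(t : ℝ) * n⌋₊ < n := (Nat.floor_lt (mul_nonneg t.2.1 hn'.le)).2 (by nlinarith)
    rw [min_eq_left (by omega)]
    set l := ⌊(t : ℝ) * n⌋₊ + 1 with hl
    set v := prefixWord (rankBits s l) K with hv
    obtain ⟨h1, h2⟩ := cntBelow_lt_rank_and_le s (l := l) (by omega) (by omega) K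
    rw [← hv] at h1 h2
    have hlen : v.length = K := by simp [hv]
    have hpv : (0 : ℝ) < cnt s v := by exact_mod_cast hpos v (mem_words.2 hlen)
    have hx1 : (cntBelow s v : ℝ) ≤ t * n :=
      le_trans (by exact_mod_cast Nat.lt_succ_iff.1 h1) (Nat.floor_le (mul_nonneg t.2.1 hn'.le))
    have hx2 : (t : ℝ) * n < cntBelow s v + cnt s v :=
      lt_of_lt_of_le (Nat.lt_floor_add_one _) (by exact_mod_cast h2)
    have htc := timeChange_of_mem p (s := s) (v := v) (by rwa [hlen]) hx1 hx2
    rw [hlen] at htc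
    refine apply_eq_of_prefixWord_eq ?_
    have := (prefixWord_bits hp0 hp1 v ((t * n - cntBelow s v) / cnt s v)
      (div_nonneg (by linarith) hpv.le) ((div_lt_one hpv).2 (by linarith))).1
    rwa [hlen, ← htc] at this

theorem abs_normalizedOps_sub_pathSum_le (hp0 : 0 < p) (hp1 : p < 1) (hn : 0 < n)
    (hL : ∀ u ∈ words L, cnt s u ≤ 1) (t : I) :
    |normalizedOps p s t -
      pathSum p (noise p s) L (rankBits s (min (⌊(t : ℝ) * n⌋₊ + 1) n))| ≤
      (L + 2 * coefBound p) / √(n : ℝ) := by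
  have hn' : (0 : ℝ) < n := by exact_mod_cast hn
  have hsq : 0 < √(n : ℝ) := Real.sqrt_pos.2 hn'
  have hq : 0 < 1 - p := by linarith
  have hx0 : 0 ≤ (t : ℝ) * n := mul_nonneg t.2.1 hn'.le
  set l := min (⌊(t : ℝ) * n⌋₊ + 1) n with hl
  have hl1 : 1 ≤ l := le_min (by omega) hn
  have hln : l ≤ n := min_le_right _ _
  have hxl : (t : ℝ) * n ≤ l := by
    rw [hl, Nat.cast_min]
    exact le_min (by exact_mod_cast (Nat.lt_floor_add_one _).le)
      (mul_le_of_le_one_left hn'.le t.2.2)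
  have hlx : (l : ℝ) ≤ t * n + 1 := by
    have h1 : (l : ℝ) ≤ ⌊(t : ℝ) * n⌋₊ + 1 := by exact_mod_cast min_le_left _ _
    have := Nat.floor_le hx0
    linarith
  set x := rankBits s l
  obtain ⟨h1, h2⟩ := cntBelow_lt_rank_and_le s hl1 hln L
  change cntBelow s (prefixWord x L) < l at h1
  change l ≤ cntBelow s (prefixWord x L) + cnt s (prefixWord x L) at h2
  have hN := hL (prefixWord x L) (mem_words.2 (by simp))
  have hA1 : (cntBelow s (prefixWord x L) : ℝ) + 1 ≤ l := by exact_mod_cast h1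
  have hA2 : (l : ℝ) ≤ cntBelow s (prefixWord x L) + cnt s (prefixWord x L) := by exact_mod_cast h2
  have hN' : (cnt s (prefixWord x L) : ℝ) ≤ 1 := by exact_mod_cast hN
  have hN0 : (0 : ℝ) ≤ cnt s (prefixWord x L) := by positivity
  -- Taking y = tn rather than y = l makes the root term equal to m(t)n exactly. The rounding goes
  -- into the boundary term M.
  have hsum := sum_cnt_eq hp0 hp1 s x (t * n) L
  have hb : (bucketOps s l : ℝ) = ∑ k ∈ Finset.range L,
      (if 2 ≤ cnt s (prefixWord x k) then (cnt s (prefixWord x k) : ℝ) else 0) := by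
    rw [bucketOps_eq s l L hL]; push_cast; rfl
  have hb1 : (bucketOps s l : ℝ) ≤ ∑ k ∈ Finset.range L, (cnt s (prefixWord x k) : ℝ) := by
    rw [hb]
    refine Finset.sum_le_sum fun k _ => ?_
    split_ifs
    · exact le_rfl
    · positivity
  -- Buckets of size one cost nothing but are counted in the telescoped sum; each level accounts for
  -- at most one unit.
  have hb2 : ∑ k ∈ Finset.range L, (cnt s (prefixWord x k) : ℝ) ≤ bucketOps s l + L := by
    have : (bucketOps s l : ℝ) + L = ∑ k ∈ Finset.range L,
      ((if 2 ≤ cnt s (prefixWord x k) then (cnt s (prefixWord x k) : ℝ) else 0) + 1) := by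
      rw [Finset.sum_add_distrib, ← hb]; simp
    rw [this]
    refine Finset.sum_le_sum fun k _ => ?_
    split_ifs with h
    · linarith
    · rw [zero_add]; exact_mod_cast Nat.lt_succ_iff.1 (not_le.1 h)
  set M := (2 * p - 1) / (p * (1 - p)) * (t * n - cntBelow s (prefixWord x L)) +
        cnt s (prefixWord x L) / p with hM
  have hMb : |M| ≤ 2 * coefBound p := by
    have hm : (2 * p - 1) / (p * (1 - p)) = 1 / (1 - p) - 1 / p := by field_simp; ring
    have i1 : 0 < 1 / p := by positivity
    have i2 : 0 < 1 / (1 - p) := by positivity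
    have hy0 : 0 ≤ (t : ℝ) * n - cntBelow s (prefixWord x L) := by linarith
    have hy1 : (t : ℝ) * n - cntBelow s (prefixWord x L) ≤ 1 := by linarith
    rw [hM, hm, coefBound, div_eq_mul_one_div (cnt s (prefixWord x L) : ℝ) p, abs_le]
    generalize (t : ℝ) * n - cntBelow s (prefixWord x L) = y at *
    generalize (cnt s (prefixWord x L) : ℝ) = N at *
    have j1 := mul_nonneg i1.le hy0
    have j2 := mul_nonneg i2.le hy0
    have j3 := mul_nonneg i1.le hN0
    have j4 := mul_le_mul_of_nonneg_left hy1 i1.le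
    have j5 := mul_le_mul_of_nonneg_left hy1 i2.le
    have j6 := mul_le_mul_of_nonneg_left hN' i1.le
    constructor <;> nlinarith
  have hmean : meanFun p t * n = (2 * p - 1) / (p * (1 - p)) * (t * n) + n / p := by
    rw [meanFun]; ring
  have hX : normalizedOps p s t - pathSum p (noise p s) L x =
      (bucketOps s l - ∑ k ∈ Finset.range L, (cnt s (prefixWord x k) : ℝ) - M) / √(n : ℝ) := by
    rw [normalizedOps, hmean, hsum, ← hl]
    field_simp
    ring
  rw [hX, abs_div, abs_of_pos hsq]
  refine div_le_div_of_nonneg_right ?_ hsq.le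
  rw [abs_le] at hMb ⊢
  constructor <;> linarith

theorem abs_pathSum_sub_le (hp0 : 0 < p) (hp1 : p < 1) {w : List (Fin 2) → ℝ} {D : ℕ → ℝ}
    (hKL : K ≤ L) (hD : ∀ k < L, ∀ u ∈ words k, |w u| ≤ D k) (x : ℕ → Fin 2) :
    |pathSum p w L x - pathSum p w K x| ≤ coefBound p * ∑ k ∈ Finset.Ico K L, D k := by
  rw [pathSum, pathSum, ← Finset.sum_Ico_eq_sub _ hKL, Finset.mul_sum]
  refine (Finset.abs_sum_le_sum_abs _ _).trans (Finset.sum_le_sum fun k hk => ?_)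
  rw [abs_mul]
  exact mul_le_mul (abs_coef_le hp0 hp1 _) (hD k (Finset.mem_Ico.1 hk).2 _ (mem_words.2 (by simp)))
    (abs_nonneg _) (coefBound_pos hp0 hp1).le

/-- After the time change both paths have the same noise sum up to level K. The first entry of the
maximum is the displacement of time. The second is the noise on levels K to L plus the boundary
error. -/
theorem edist_normalizedPath_stepPath_le (hp0 : 0 < p) (hp1 : p < 1) (hn : 0 < n) (hKL : K ≤ L)
    (hpos : ∀ u ∈ words K, 0 < cnt s u) (hL : ∀ u ∈ words L, cnt s u ≤ 1) {D : ℕ → ℝ}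
    (hD : ∀ k < L, ∀ u ∈ words k, |noise p s u| ≤ D k) :
    edist (normalizedPath p s) (stepPath hp0 hp1 K (noise p s)) ≤
      ENNReal.ofReal (max (∑ u ∈ words K, |(cnt s u : ℝ) / n - wordProb p u|)
        (coefBound p * ∑ k ∈ Finset.Ico K L, D k + (L + 2 * coefBound p) / √(n : ℝ))) := by
  obtain ⟨lam, hlam⟩ := exists_orderIso hp0 hp1 hn hpos
  rw [ENNReal.ofReal_max]
  refine (iInf_le _ lam).trans (max_le_max (iSup_le fun t => ?_) (iSup_le fun t => ?_))
  · rw [edist_dist, Subtype.dist_eq, Real.dist_eq, hlam]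
    exact ENNReal.ofReal_le_ofReal (abs_timeChange_sub_le hn hpos t.2.1 t.2.2)
  · rw [edist_dist, Real.dist_eq]
    refine ENNReal.ofReal_le_ofReal ?_
    have h1 := abs_normalizedOps_sub_pathSum_le hp0 hp1 hn hL t
    have h2 := abs_pathSum_sub_le hp0 hp1 hKL hD
      (rankBits s (min (⌊(t : ℝ) * n⌋₊ + 1) n))
    have h3 : stepPath hp0 hp1 K (noise p s) (lam t) =
        pathSum p (noise p s) K (rankBits s (min (⌊(t : ℝ) * n⌋₊ + 1) n)) := by
      change pathSum p (noise p s) K (bits p (lam t)) = _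
      rw [hlam]
      exact pathSum_congr (bits_timeChange_eq_rankBits hp0 hp1 hn hpos t)
    rw [h3]
    change |normalizedOps p s t - _| ≤ _
    refine (abs_sub_le _ (pathSum p (noise p s) L (rankBits s (min (⌊(t : ℝ) * n⌋₊ + 1) n)))
      _).trans ?_
    linarith

/-- A step to a child multiplies the error by a bit probability and adds ± noise/√n. Control of the
noise thus yields the law of large numbers for the frequencies. -/
theorem abs_cnt_div_sub_wordProb_le (hp0 : 0 < p) (hp1 : p < 1) (hn : 0 < n) {D : ℕ → ℝ}
    (u : List (Fin 2)) (hD : ∀ k < u.length, ∀ v ∈ words k, |noise p s v| ≤ D k) :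
    |(cnt s u : ℝ) / n - wordProb p u| ≤ (∑ k ∈ Finset.range u.length, D k) / √(n : ℝ) := by
  have hn' : (0 : ℝ) < n := by exact_mod_cast hn
  have hsq : 0 < √(n : ℝ) := Real.sqrt_pos.2 hn'
  have hq : 0 < 1 - p := by linarith
  induction u with
  | nil => simp [cnt_nil, wordProb, hn'.ne']
  | cons b u ih =>
    have ih := ih fun k hk => hD k (by simp; omega)
    have hDu := hD u.length (by simp) u (mem_words.2 rfl)
    rw [List.length_cons, Finset.sum_range_succ, add_div]
    have hc := cast_cnt_cons_add s u
    have hnoise : noise p s u / √(n : ℝ) = (cnt s (0 :: u) - (1 - p) * cnt s u) / n := by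
      rw [noise, div_div, Real.mul_self_sqrt hn'.le]
    have hb : (cnt s (b :: u) : ℝ) / n - wordProb p (b :: u) =
        bitProb p b * (cnt s u / n - wordProb p u) +
          (if b = 0 then 1 else -1) * (noise p s u / √(n : ℝ)) := by
      rw [hnoise]
      rcases Fin.exists_fin_two.1 ⟨b, rfl⟩ with rfl | rfl
      · simp only [wordProb, bitProb_zero, if_true]; ring
      · have : (cnt s (1 :: u) : ℝ) = cnt s u - cnt s (0 :: u) := by linarith
        simp only [wordProb, bitProb_one, one_ne_zero, if_false, this]; ring
    rw [hb]
    refine (abs_add_le _ _).trans (add_le_add ?_ ?_)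
    · rw [abs_mul, abs_of_pos (bitProb_pos hp0 hp1 b)]
      refine le_trans (mul_le_of_le_one_left (abs_nonneg _) ?_) ih
      unfold bitProb; split_ifs <;> linarith
    · rw [abs_mul, abs_div, abs_of_pos hsq]
      have : |(if b = 0 then 1 else -1 : ℝ)| = 1 := by split_ifs <;> simp
      rw [this, one_mul]
      exact div_le_div_of_nonneg_right hDu hsq.le

end

section

/-! ### Random strings -/

theorem exists_prefixWord_eq (u : List (Fin 2)) : ∃ x : ℕ → Fin 2, prefixWord x u.length = u := by
  induction u with
  | nil => exact ⟨fun _ => 0, rfl⟩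
  | cons b u ih =>
    obtain ⟨x, hx⟩ := ih
    refine ⟨Function.update x u.length b, ?_⟩
    rw [List.length_cons, prefixWord, Function.update_self]
    congr 1
    conv_rhs => rw [← hx]
    exact prefixWord_congr fun j hj => Function.update_of_ne hj.ne _ _

theorem wordProb_prefixWord (p : ℝ) (x : ℕ → Fin 2) (K : ℕ) :
    wordProb p (prefixWord x K) = ∏ k ∈ Finset.range K, bitProb p (x k) := by
  induction K with
  | zero => simp [prefixWord, wordProb]
  | succ K ih => rw [Finset.prod_range_succ, prefixWord, wordProb, ih, mul_comm]

theorem measurableSet_prefixWord_eq (K : ℕ) (u : List (Fin 2)) :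
    MeasurableSet {x : ℕ → Fin 2 | prefixWord x K = u} := by
  induction K generalizing u with
  | zero => by_cases h : [] = u <;> simp [prefixWord, h]
  | succ K ih =>
    cases u with
    | nil => simp [prefixWord]
    | cons b u =>
      simp only [prefixWord, List.cons.injEq]
      exact (measurableSet_eq_fun (measurable_pi_apply K) measurable_const).inter (ih u)

variable {Ω : Type*} [MeasurableSpace Ω] {μ : Measure Ω} {n : ℕ} {p : ℝ}
  {Z : Fin n → Ω → ℕ → Fin 2}

/-- The strings `Z i` are independent, and their bits are independent with `p` the probability
of `1`. -/
structure IsBernoulliSample (p : ℝ) (μ : Measure Ω) (Z : Fin n → Ω → ℕ → Fin 2) : Prop where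
  measurable : ∀ i, Measurable (Z i)
  indep : iIndepFun Z μ
  measureReal_prefixWord : ∀ i u, μ.real {ω | prefixWord (Z i ω) u.length = u} = wordProb p u

/-- Independence of the whole array of bits means that its law is a product measure; currying that
product over rows gives independence of the strings. -/
theorem isBernoulliSample_of_bits [IsProbabilityMeasure μ] (hp0 : 0 < p)
    {B : Fin n → ℕ → Ω → Fin 2} (hm : ∀ i k, Measurable (B i k))
    (hi : iIndepFun (fun q : Fin n × ℕ => B q.1 q.2) μ)
    (hl : ∀ i k, μ {ω | B i k ω = 1} = ENNReal.ofReal p) :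
    IsBernoulliSample p μ fun i ω k => B i k ω where
  measurable i := measurable_pi_lambda _ fun k => hm i k
  indep := by
    have : ∀ i k, IsProbabilityMeasure (μ.map (B i k)) :=
      fun i k => Measure.isProbabilityMeasure_map (hm i k).aemeasurable
    have hrow : ∀ i, μ.map (fun ω k => B i k ω) = Measure.infinitePi fun k => μ.map (B i k) :=
      fun i => (iIndepFun_iff_map_fun_eq_infinitePi_map (hm i)).1
        (hi.precomp (g := fun k => (i, k)) fun a b h => (Prod.ext_iff.1 h).2)
    rw [iIndepFun_iff_map_fun_eq_infinitePi_map
      fun i => measurable_pi_lambda _ fun k => hm i k]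
    simp only [hrow]
    rw [← Measure.infinitePi_map_curry fun i k => μ.map (B i k),
      ← (iIndepFun_iff_map_fun_eq_infinitePi_map fun q : Fin n × ℕ => hm q.1 q.2).1 hi,
      Measure.map_map (MeasurableEquiv.measurable _)
        (measurable_pi_lambda (fun ω (q : Fin n × ℕ) => B q.1 q.2 ω) fun q => hm q.1 q.2)]
    rfl
  measureReal_prefixWord i u := by
    have hbit : ∀ k b, μ.real {ω | B i k ω = b} = bitProb p b := by
      have h1 : ∀ k, μ.real {ω | B i k ω = 1} = p := fun k => by
        rw [measureReal_def, hl, ENNReal.toReal_ofReal hp0.le]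
      intro k b
      rcases Fin.exists_fin_two.1 ⟨b, rfl⟩ with rfl | rfl
      · have hc : {ω | B i k ω = 0} = {ω | B i k ω = 1}ᶜ := by
          ext ω; simp only [Set.mem_ofPred_eq, Set.mem_compl_iff]
          generalize B i k ω = c; revert c; decide
        rw [hc, probReal_compl_eq_one_sub, h1, bitProb_zero]
        exact hm i k (measurableSet_singleton 1)
      · rw [h1, bitProb_one]
    obtain ⟨x, hx⟩ := exists_prefixWord_eq u
    have hset : {ω | prefixWord (fun k => B i k ω) u.length = u} =
        ⋂ k ∈ Finset.range u.length, {ω | B i k ω = x k} := by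
      ext ω
      simp only [Set.mem_ofPred_eq, Set.mem_iInter, Finset.mem_range]
      conv_lhs => rhs; rw [← hx]
      exact ⟨apply_eq_of_prefixWord_eq, prefixWord_congr⟩
    have hrow : iIndepFun (B i) μ :=
      hi.precomp (g := fun k => (i, k)) fun a b h => (Prod.ext_iff.1 h).2
    rw [hset, measureReal_def, hrow.meas_biInter (s := fun k => {ω | B i k ω = x k})
      fun k _ => ⟨{x k}, measurableSet_singleton _, rfl⟩, ENNReal.toReal_prod]
    conv_rhs => rw [← hx, wordProb_prefixWord]
    exact Finset.prod_congr rfl fun k _ => hbit k (x k)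

namespace IsBernoulliSample

theorem measurableSet_prefixWord (h : IsBernoulliSample p μ Z) (i : Fin n) (K : ℕ)
    (u : List (Fin 2)) : MeasurableSet {ω | prefixWord (Z i ω) K = u} :=
  h.measurable i (measurableSet_prefixWord_eq K u)

theorem measurable_comp_prefixWord {E : Type*} [MeasurableSpace E] (f : List (Fin 2) → E) (K : ℕ) :
    Measurable fun x : ℕ → Fin 2 => f (prefixWord x K) := by
  intro A _
  have : (fun x : ℕ → Fin 2 => f (prefixWord x K)) ⁻¹' A =
      ⋃ u ∈ {u | u ∈ words K ∧ f u ∈ A}, {x | prefixWord x K = u} := by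
    ext x
    simp [mem_words, and_assoc]
  rw [this]
  exact Set.Finite.measurableSet_biUnion (Finset.finite_toSet (words K) |>.subset fun u hu => hu.1)
    fun u _ => measurableSet_prefixWord_eq K u

theorem integral_prefixWord [IsProbabilityMeasure μ] (h : IsBernoulliSample p μ Z)
    {E : Type*} [NormedAddCommGroup E] [NormedSpace ℝ E] [CompleteSpace E]
    (i : Fin n) (K : ℕ) (f : List (Fin 2) → E) :
    ∫ ω, f (prefixWord (Z i ω) K) ∂μ = ∑ u ∈ words K, wordProb p u • f u := by
  have hpt : ∀ ω, f (prefixWord (Z i ω) K) =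
      ∑ u ∈ words K, {ω | prefixWord (Z i ω) K = u}.indicator (fun _ => f u) ω := by
    intro ω
    rw [Finset.sum_eq_single (prefixWord (Z i ω) K)]
    · simp
    · intro u _ hu; simp [hu.symm]
    · intro hu; exact absurd (mem_words.2 (by simp)) hu
  simp only [hpt]
  rw [integral_finsetSum]
  · refine Finset.sum_congr rfl fun u hu => ?_
    rw [integral_indicator_const _ (h.measurableSet_prefixWord i K u)]
    have := h.measureReal_prefixWord i u
    rw [mem_words.1 hu] at this
    rw [this]
  · intro u _
    exact (integrable_const _).indicator (h.measurableSet_prefixWord i K u)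

end IsBernoulliSample

/-! ### Centered bit sums and their relation to the noise -/

/-- The centered weight of a bit. -/
def centeredBit (p : ℝ) (b : Fin 2) : ℝ := if b = 0 then p else p - 1

/-- The sum of `θ` along a word, weighted with the centered bits. -/
def bitSum (p : ℝ) (θ : List (Fin 2) → ℝ) : List (Fin 2) → ℝ
  | [] => 0
  | b :: u => bitSum p θ u + θ u * centeredBit p b

/-- `bitSum` is a martingale along a random string: each centered bit has mean zero given the
prefix. -/
theorem sum_wordProb_mul_bitSum (p : ℝ) (θ : List (Fin 2) → ℝ) (K : ℕ) :
    ∑ u ∈ words K, wordProb p u * bitSum p θ u = 0 := by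
  induction K with
  | zero => simp [sum_words_zero, bitSum]
  | succ K ih =>
    rw [sum_words_succ, ← ih]
    refine Finset.sum_congr rfl fun u _ => ?_
    simp only [wordProb, bitSum, centeredBit, bitProb_zero, bitProb_one, if_true, one_ne_zero,
      if_false]
    ring

/-- Martingale increments are orthogonal, and a centered bit has variance p(1-p). This is why the
limiting noises at different nodes are independent. -/
theorem sum_wordProb_mul_bitSum_sq (p : ℝ) (θ : List (Fin 2) → ℝ) (K : ℕ) :
    ∑ u ∈ words K, wordProb p u * bitSum p θ u ^ 2 =
      ∑ k ∈ Finset.range K, ∑ u ∈ words k, wordProb p u * (p * (1 - p)) * θ u ^ 2 := by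
  induction K with
  | zero => simp [sum_words_zero, bitSum]
  | succ K ih =>
    rw [sum_words_succ, Finset.sum_range_succ, ← ih, ← Finset.sum_add_distrib]
    refine Finset.sum_congr rfl fun u _ => ?_
    simp only [wordProb, bitSum, centeredBit, bitProb_zero, bitProb_one, if_true, one_ne_zero,
      if_false]
    ring

theorem bitSum_prefixWord (p : ℝ) (θ : List (Fin 2) → ℝ) (x : ℕ → Fin 2) (K : ℕ) :
    bitSum p θ (prefixWord x K) =
      ∑ k ∈ Finset.range K, θ (prefixWord x k) * centeredBit p (x k) := by
  induction K with
  | zero => simp [bitSum, prefixWord]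
  | succ K ih => rw [prefixWord, bitSum, ih, Finset.sum_range_succ]

theorem sqrt_mul_noise (p : ℝ) (s : Fin n → ℕ → Fin 2) (u : List (Fin 2)) :
    √(n : ℝ) * noise p s u = ∑ i, if prefixWord (s i) u.length = u then
      centeredBit p (s i u.length) else 0 := by
  have h1 : √(n : ℝ) * noise p s u = cnt s (0 :: u) - (1 - p) * cnt s u := by
    rcases Nat.eq_zero_or_pos n with rfl | hn
    · simp [cnt, cyl]
    · have : √(n : ℝ) ≠ 0 := by positivity
      rw [noise]; field_simp
  rw [h1, cnt, cnt, cyl_cons, cyl, Finset.filter_filter, Finset.card_filter, Finset.card_filter]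
  push_cast
  rw [Finset.mul_sum, ← Finset.sum_sub_distrib]
  refine Finset.sum_congr rfl fun i _ => ?_
  by_cases h : prefixWord (s i) u.length = u
  · by_cases h' : s i u.length = 0 <;> simp [h, h', centeredBit]
  · simp [h]

/-- Exchanging the sums over nodes and strings turns any linear functional of the noise into a sum
over the data, hence a sum of i.i.d. terms for a random sample. -/
theorem sum_mul_noise (p : ℝ) (s : Fin n → ℕ → Fin 2) (θ : List (Fin 2) → ℝ) (K : ℕ) :
    √(n : ℝ) * ∑ k ∈ Finset.range K, ∑ u ∈ words k, θ u * noise p s u =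
      ∑ i, bitSum p θ (prefixWord (s i) K) := by
  simp only [bitSum_prefixWord]
  rw [Finset.sum_comm, Finset.mul_sum]
  refine Finset.sum_congr rfl fun k _ => ?_
  rw [Finset.mul_sum]
  have : ∀ u ∈ words k, √(n : ℝ) * (θ u * noise p s u) =
      ∑ i, if prefixWord (s i) k = u then θ u * centeredBit p (s i k) else 0 := by
    intro u hu
    rw [mul_left_comm, sqrt_mul_noise, mem_words.1 hu, Finset.mul_sum]
    simp only [mul_ite, mul_zero]
  rw [Finset.sum_congr rfl this, Finset.sum_comm]
  refine Finset.sum_congr rfl fun i _ => ?_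
  rw [Finset.sum_ite_eq, if_pos (mem_words.2 (by simp))]

/-! ### Moments -/

/-- Adding one variable to the sum kills the monomials with a factor of mean zero. As |X| ≤ 1, the
fourth moment of each summand is at most its second. -/
theorem integral_sum_pow_le [IsProbabilityMeasure μ] {ι : Type*} {X : ι → Ω → ℝ}
    (hm : ∀ i, Measurable (X i)) (hX : iIndepFun X μ) (hb : ∀ i ω, |X i ω| ≤ 1)
    (h0 : ∀ i, ∫ ω, X i ω ∂μ = 0) {a : ℝ} (h2 : ∀ i, ∫ ω, X i ω ^ 2 ∂μ ≤ a) (S : Finset ι) :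
    ∫ ω, (∑ i ∈ S, X i ω) ∂μ = 0 ∧ ∫ ω, (∑ i ∈ S, X i ω) ^ 2 ∂μ ≤ S.card * a ∧
      ∫ ω, (∑ i ∈ S, X i ω) ^ 4 ∂μ ≤ S.card * a + 3 * (S.card * a) ^ 2 := by
  classical
  induction S using Finset.induction_on with
  | empty => simp
  | insert j S hj ih =>
    obtain ⟨i1, i2, i4⟩ := ih
    have ha : 0 ≤ a := le_trans (integral_nonneg fun ω => sq_nonneg _) (h2 j)
    set T : Ω → ℝ := fun ω => ∑ i ∈ S, X i ω with hT
    have hTm : Measurable T := Finset.measurable_fun_sum _ fun i _ => hm i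
    have hTb : ∀ ω, |T ω| ≤ S.card := fun ω =>
      (Finset.abs_sum_le_sum_abs _ _).trans ((Finset.sum_le_sum fun i _ => hb i ω).trans (by simp))
    have hind : IndepFun T (X j) μ := by
      have := hX.indepFun_finsetSum_of_notMem hm hj
      convert this using 1
      ext ω; simp [hT]
    have hInt : ∀ a b : ℕ, Integrable (fun ω => T ω ^ a * X j ω ^ b) μ := by
      intro a b
      refine Integrable.of_bound (by fun_prop) ((S.card : ℝ) ^ a * 1 ^ b) (ae_of_all _ fun ω => ?_)
      rw [Real.norm_eq_abs, abs_mul, abs_pow, abs_pow]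
      gcongr
      · exact hTb ω
      · exact hb j ω
    have hmul : ∀ a b : ℕ, ∫ ω, T ω ^ a * X j ω ^ b ∂μ =
        (∫ ω, T ω ^ a ∂μ) * ∫ ω, X j ω ^ b ∂μ := by
      intro a b
      have hab := hind.comp (φ := fun x => x ^ a) (ψ := fun x => x ^ b) (by fun_prop) (by fun_prop)
      exact hab.integral_fun_mul_eq_mul_integral (by fun_prop) (by fun_prop)
    have hX1 : ∫ ω, X j ω ^ 1 ∂μ = 0 := by simpa using h0 j
    have hT1 : ∫ ω, T ω ^ 1 ∂μ = 0 := by simpa using i1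
    have hX4 : ∫ ω, X j ω ^ 4 ∂μ ≤ a := by
      refine le_trans (integral_mono (by simpa using hInt 0 4) (by simpa using hInt 0 2)
        fun ω => ?_) (h2 j)
      have : X j ω ^ 2 ≤ 1 := (sq_le_one_iff_abs_le_one _).2 (hb j ω)
      change X j ω ^ 4 ≤ X j ω ^ 2
      nlinarith [sq_nonneg (X j ω)]
    have hsum : ∀ ω, ∑ i ∈ insert j S, X i ω = T ω + X j ω := fun ω => by
      rw [Finset.sum_insert hj, add_comm]
    simp only [hsum, Finset.card_insert_of_notMem hj]
    refine ⟨?_, ?_, ?_⟩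
    · rw [integral_add (by simpa using hInt 1 0) (by simpa using hInt 0 1), i1, h0, add_zero]
    -- The zeroth powers keep every monomial in the shape T^a X^b covered by `hInt` and `hmul`.
    · have e : ∀ ω, (T ω + X j ω) ^ 2 =
          T ω ^ 2 * X j ω ^ 0 + 2 * (T ω ^ 1 * X j ω ^ 1) + T ω ^ 0 * X j ω ^ 2 := by
        intro ω; ring
      simp only [e]
      rw [integral_add ((hInt 2 0).fun_add ((hInt 1 1).const_mul 2)) (hInt 0 2),
        integral_add (hInt 2 0) ((hInt 1 1).const_mul 2), integral_const_mul, hmul, hmul, hmul, hX1]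
      simp
      linarith [h2 j]
    · have e : ∀ ω, (T ω + X j ω) ^ 4 =
          T ω ^ 4 * X j ω ^ 0 + 4 * (T ω ^ 3 * X j ω ^ 1) + 6 * (T ω ^ 2 * X j ω ^ 2) +
            4 * (T ω ^ 1 * X j ω ^ 3) + T ω ^ 0 * X j ω ^ 4 := by
        intro ω; ring
      simp only [e]
      have g1 := (hInt 4 0).fun_add ((hInt 3 1).const_mul 4)
      have g2 := g1.fun_add ((hInt 2 2).const_mul 6)
      have g3 := g2.fun_add ((hInt 1 3).const_mul 4)
      rw [integral_add g3 (hInt 0 4), integral_add g2 ((hInt 1 3).const_mul 4),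
        integral_add g1 ((hInt 2 2).const_mul 6), integral_add (hInt 4 0) ((hInt 3 1).const_mul 4),
        integral_const_mul, integral_const_mul, integral_const_mul, hmul, hmul, hmul, hmul, hmul,
        hX1, hT1]
      simp
      have hT2 : 0 ≤ ∫ ω, T ω ^ 2 ∂μ := integral_nonneg fun ω => sq_nonneg _
      have hX2 : 0 ≤ ∫ ω, X j ω ^ 2 ∂μ := integral_nonneg fun ω => sq_nonneg _
      -- The mixed term is at most 6ma² with m the cardinality of S, and 3((m+1)a)² - 3(ma)² absorbs
      -- it.
      have := mul_le_mul i2 (h2 j) hX2 (by positivity)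
      nlinarith

theorem integral_noise_pow_four_le [IsProbabilityMeasure μ] (hp0 : 0 < p) (hp1 : p < 1)
    (hn : 0 < n) (h : IsBernoulliSample p μ Z) (u : List (Fin 2)) :
    ∫ ω, noise p (fun i => Z i ω) u ^ 4 ∂μ ≤ 3 * wordProb p u ^ 2 + wordProb p u / n := by
  have hn' : (0 : ℝ) < n := by exact_mod_cast hn
  have hq : 0 < 1 - p := by linarith
  have hπ := wordProb_pos hp0 hp1 u
  -- With the indicator of u as weight, `bitSum` isolates the contribution of a single string to the
  -- noise at u.
  let θ : List (Fin 2) → ℝ := fun v => if v = u then 1 else 0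
  let f : List (Fin 2) → ℝ := bitSum p θ
  have hfm : Measurable fun x : ℕ → Fin 2 => f (prefixWord x (u.length + 1)) :=
    IsBernoulliSample.measurable_comp_prefixWord f _
  have hf : ∀ x : ℕ → Fin 2, f (prefixWord x (u.length + 1)) =
      if prefixWord x u.length = u then centeredBit p (x u.length) else 0 := by
    intro x
    simp only [f, bitSum_prefixWord, θ, ite_mul, one_mul, zero_mul]
    rw [Finset.sum_eq_single u.length]
    · intro k hk hne
      rw [if_neg]
      intro he
      exact hne (by rw [← he, length_prefixWord])
    · simp
  set X : Fin n → Ω → ℝ := fun i ω => f (prefixWord (Z i ω) (u.length + 1)) with hXdef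
  have hXm : ∀ i, Measurable (X i) := fun i => hfm.comp (h.measurable i)
  have hXi : iIndepFun X μ := h.indep.comp (fun _ x => f (prefixWord x (u.length + 1)))
    fun _ => hfm
  have hXb : ∀ i ω, |X i ω| ≤ 1 := by
    intro i ω
    simp only [hXdef, hf, centeredBit]
    rw [abs_le]
    split_ifs <;> constructor <;> linarith
  have hX0 : ∀ i, ∫ ω, X i ω ∂μ = 0 := by
    intro i
    rw [h.integral_prefixWord i _ f]
    exact sum_wordProb_mul_bitSum p θ _
  have hX2 : ∀ i, ∫ ω, X i ω ^ 2 ∂μ ≤ wordProb p u := by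
    intro i
    rw [h.integral_prefixWord i _ fun v => f v ^ 2]
    change ∑ v ∈ words (u.length + 1), wordProb p v * bitSum p θ v ^ 2 ≤ _
    rw [sum_wordProb_mul_bitSum_sq, Finset.sum_eq_single u.length]
    · simp only [θ]
      rw [Finset.sum_eq_single u (fun v _ hv => by simp [hv])
        fun hu => absurd (mem_words.2 rfl) hu]
      simp only [if_true, one_pow, mul_one]
      nlinarith [sq_nonneg (p - 1 / 2)]
    · intro k _ hk
      refine Finset.sum_eq_zero fun v hv => ?_
      have : v ≠ u := by rintro rfl; exact hk (mem_words.1 hv).symm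
      simp [θ, this]
    · simp
  have key := (integral_sum_pow_le hXm hXi hXb hX0 hX2 Finset.univ).2.2
  have hnoise : ∀ ω, noise p (fun i => Z i ω) u ^ 4 = (∑ i, X i ω) ^ 4 / n ^ 2 := by
    intro ω
    have := sqrt_mul_noise p (fun i => Z i ω) u
    simp only [hXdef, hf]
    rw [← this, mul_pow, show √(n : ℝ) ^ 4 = (√(n : ℝ) ^ 2) ^ 2 by ring, Real.sq_sqrt hn'.le]
    field_simp
  simp only [hnoise]
  rw [integral_div, div_le_iff₀ (by positivity)]
  simp only [Finset.card_univ, Fintype.card_fin] at key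
  refine key.trans (le_of_eq ?_)
  field_simp
  ring

/-- Union bound over pairs of strings: two independent strings share their first L bits with
probability (p² + (1-p)²)^L. -/
theorem measureReal_exists_two_le_cnt_le [IsProbabilityMeasure μ] (h : IsBernoulliSample p μ Z)
    (L : ℕ) :
    μ.real {ω | ∃ u ∈ words L, 2 ≤ cnt (fun i => Z i ω) u} ≤
      (n : ℝ) ^ 2 * ((1 - p) ^ 2 + p ^ 2) ^ L := by
  have hsub : {ω | ∃ u ∈ words L, 2 ≤ cnt (fun i => Z i ω) u} ⊆
      ⋃ q ∈ (Finset.univ : Finset (Fin n × Fin n)).filter (fun q => q.1 ≠ q.2),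
        ⋃ u ∈ words L, ({ω | prefixWord (Z q.1 ω) L = u} ∩ {ω | prefixWord (Z q.2 ω) L = u}) := by
    rintro ω ⟨u, hu, h2⟩
    obtain ⟨i, j, hi, hj, hij⟩ := Finset.one_lt_card_iff.1 h2
    simp only [cyl, Finset.mem_filter, Finset.mem_univ, true_and, mem_words.1 hu] at hi hj
    simp only [Set.mem_iUnion]
    exact ⟨(i, j), by simpa using hij, u, hu, hi, hj⟩
  refine (measureReal_mono hsub (measure_ne_top _ _)).trans ((measureReal_biUnion_finset_le _ _).trans ?_)
  have hq : ∀ q ∈ (Finset.univ : Finset (Fin n × Fin n)).filter (fun q => q.1 ≠ q.2),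
      μ.real (⋃ u ∈ words L, ({ω | prefixWord (Z q.1 ω) L = u} ∩
        {ω | prefixWord (Z q.2 ω) L = u})) ≤ ((1 - p) ^ 2 + p ^ 2) ^ L := by
    intro q hq
    refine (measureReal_biUnion_finset_le _ _).trans ?_
    rw [← sum_wordProb_pow p L 2]
    refine Finset.sum_le_sum fun u hu => ?_
    have hind := h.indep.indepFun (Finset.mem_filter.1 hq).2
    have hm := measurableSet_prefixWord_eq L u
    have h1 := h.measureReal_prefixWord q.1 u
    have h2 := h.measureReal_prefixWord q.2 u
    rw [mem_words.1 hu] at h1 h2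
    have := hind.measure_inter_preimage_eq_mul _ _ hm hm
    change μ ({ω | prefixWord (Z q.1 ω) L = u} ∩ {ω | prefixWord (Z q.2 ω) L = u}) =
      μ {ω | prefixWord (Z q.1 ω) L = u} * μ {ω | prefixWord (Z q.2 ω) L = u} at this
    rw [measureReal_def, this, ENNReal.toReal_mul, ← measureReal_def, ← measureReal_def, h1, h2, sq]
  refine (Finset.sum_le_sum hq).trans ?_
  rw [Finset.sum_const, nsmul_eq_mul]
  refine mul_le_mul_of_nonneg_right ?_ (by positivity)
  have : ((Finset.univ : Finset (Fin n × Fin n)).filter (fun q => q.1 ≠ q.2)).card ≤ n ^ 2 := by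
    refine (Finset.card_filter_le _ _).trans ?_
    simp [sq]
  exact_mod_cast this

end

section

/-! ### Bounds that hold with high probability -/

/-- The fourth root of `(1-p)² + p²`. -/
def decay (p : ℝ) : ℝ := √√((1 - p) ^ 2 + p ^ 2)

theorem decay_pos {p : ℝ} (hp0 : 0 < p) : 0 < decay p :=
  Real.sqrt_pos.2 (Real.sqrt_pos.2 (by positivity))

theorem decay_lt_one {p : ℝ} (hp0 : 0 < p) (hp1 : p < 1) : decay p < 1 := by
  have h : (1 - p) ^ 2 + p ^ 2 < 1 := by nlinarith
  rw [decay, Real.sqrt_lt' one_pos, one_pow, Real.sqrt_lt' one_pos]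
  simpa using h

theorem decay_pow_four (p : ℝ) : decay p ^ 4 = (1 - p) ^ 2 + p ^ 2 := by
  rw [decay, show ∀ x : ℝ, x ^ 4 = (x ^ 2) ^ 2 from fun x => by ring,
    Real.sq_sqrt (Real.sqrt_nonneg _), Real.sq_sqrt (by positivity)]

/-- Truncation at c: above it, |x| = x⁴/|x|³ ≤ x⁴/c³. Summing the fourth powers bounds the maximum
over a level by a quantity with an explicit mean. -/
theorem abs_le_add_pow_four_div {x c : ℝ} (hc : 0 < c) : |x| ≤ c + x ^ 4 / c ^ 3 := by
  have h4 : 0 ≤ x ^ 4 / c ^ 3 := by positivity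
  by_cases h : |x| ≤ c
  · linarith
  · have hx : c < |x| := not_le.1 h
    have : |x| ≤ x ^ 4 / c ^ 3 := by
      rw [le_div_iff₀ (by positivity), show x ^ 4 = |x| * |x| ^ 3 by
        rw [← pow_succ', Even.pow_abs (by decide)]]
      gcongr
    linarith

/-- An upper bound for the absolute values of the weights of the words of length `k`. -/
def levelBound (p r : ℝ) (w : List (Fin 2) → ℝ) (k : ℕ) : ℝ :=
  (decay p ^ k + r) + (∑ u ∈ words k, w u ^ 4) / (decay p ^ k + r) ^ 3

theorem abs_le_levelBound {p r : ℝ} (hp0 : 0 < p) (hr : 0 ≤ r) (w : List (Fin 2) → ℝ) {k : ℕ}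
    {u : List (Fin 2)} (hu : u ∈ words k) : |w u| ≤ levelBound p r w k := by
  have hc : 0 < decay p ^ k + r := add_pos_of_pos_of_nonneg (pow_pos (decay_pos hp0) k) hr
  refine (abs_le_add_pow_four_div hc).trans (add_le_add_right ?_ _)
  refine div_le_div_of_nonneg_right ?_ (by positivity)
  exact Finset.single_le_sum (f := fun u => w u ^ 4) (fun u _ => by positivity) hu

theorem levelBound_nonneg {p r : ℝ} (hp0 : 0 < p) (hr : 0 ≤ r) (w : List (Fin 2) → ℝ) (k : ℕ) :
    0 ≤ levelBound p r w k := by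
  have hc : 0 < decay p ^ k + r := add_pos_of_pos_of_nonneg (pow_pos (decay_pos hp0) k) hr
  unfold levelBound
  positivity

/-- The summed fourth moments are at most M(ρ^k + r⁴) with ρ = p² + (1-p)², hence at most M times
the fourth power of the truncation level ρ^(k/4) + r. It serves for the noise with r = n^(-1/4) and
for the Gaussian weights with r = 0. -/
theorem integral_levelBound_le {Ω : Type*} [MeasurableSpace Ω] {μ : Measure Ω}
    [IsProbabilityMeasure μ] {p r M : ℝ} (hp0 : 0 < p) (hr : 0 ≤ r) (hM : 0 ≤ M)
    {w : Ω → List (Fin 2) → ℝ} (hInt : ∀ u, Integrable (fun ω => w ω u ^ 4) μ)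
    (hw : ∀ u, ∫ ω, w ω u ^ 4 ∂μ ≤ M * (wordProb p u ^ 2 + wordProb p u * r ^ 4)) (k : ℕ) :
    Integrable (fun ω => levelBound p r (w ω) k) μ ∧
      ∫ ω, levelBound p r (w ω) k ∂μ ≤ (1 + M) * (decay p ^ k + r) := by
  have hd := pow_pos (decay_pos hp0) k
  have hc : 0 < decay p ^ k + r := add_pos_of_pos_of_nonneg hd hr
  have hsum : Integrable (fun ω => ∑ u ∈ words k, w ω u ^ 4) μ :=
    integrable_finsetSum _ fun u _ => hInt u
  refine ⟨(integrable_const _).add (hsum.div_const _), ?_⟩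
  simp only [levelBound]
  rw [integral_add (integrable_const _) (hsum.div_const _), integral_div,
    integral_finsetSum _ fun u _ => hInt u]
  have h1 : ∑ u ∈ words k, ∫ ω, w ω u ^ 4 ∂μ ≤ M * (decay p ^ k + r) ^ 4 := by
    refine (Finset.sum_le_sum fun u _ => hw u).trans ?_
    rw [← Finset.mul_sum, Finset.sum_add_distrib, ← Finset.sum_mul, sum_wordProb, sum_wordProb_pow,
      ← decay_pow_four, ← pow_mul, mul_comm 4 k, pow_mul, one_mul]
    refine mul_le_mul_of_nonneg_left ?_ hM
    generalize decay p ^ k = d at *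
    have : (d + r) ^ 4 - d ^ 4 - r ^ 4 = 4 * d ^ 3 * r + 6 * d ^ 2 * r ^ 2 + 4 * d * r ^ 3 := by
      ring
    have h2 : 0 ≤ 4 * d ^ 3 * r + 6 * d ^ 2 * r ^ 2 + 4 * d * r ^ 3 := by positivity
    linarith
  have h2 : (∑ u ∈ words k, ∫ ω, w ω u ^ 4 ∂μ) / (decay p ^ k + r) ^ 3 ≤
      M * (decay p ^ k + r) := by
    rw [div_le_iff₀ (by positivity)]
    exact h1.trans (le_of_eq (by ring))
  simp only [integral_const, probReal_univ, smul_eq_mul, one_mul]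
  linarith

theorem measureReal_sum_ge_le {Ω : Type*} [MeasurableSpace Ω] {μ : Measure Ω}
    [IsProbabilityMeasure μ] {S : ℕ → Ω → ℝ} {c : ℕ → ℝ} (h0 : ∀ k ω, 0 ≤ S k ω)
    (hi : ∀ k, Integrable (S k) μ) (hc : ∀ k, ∫ ω, S k ω ∂μ ≤ c k) (J : Finset ℕ) {a : ℝ}
    (ha : 0 < a) : μ.real {ω | a ≤ ∑ k ∈ J, S k ω} ≤ (∑ k ∈ J, c k) / a := by
  rw [le_div_iff₀ ha, mul_comm]
  refine (mul_meas_ge_le_integral_of_nonneg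
    (ae_of_all _ fun ω => Finset.sum_nonneg fun k _ => h0 k ω)
    (integrable_finsetSum _ fun k _ => hi k) a).trans ?_
  rw [integral_finsetSum _ fun k _ => hi k]
  exact Finset.sum_le_sum fun k _ => hc k

/-! ### The number of levels: enough to separate the strings, few compared with n^(1/4) -/

/-- The largest `j` with `j ^ 8 ≤ n`. -/
def eighthRoot (n : ℕ) : ℕ := Nat.sqrt (Nat.sqrt (Nat.sqrt n))

theorem eighthRoot_pow_le (n : ℕ) : eighthRoot n ^ 8 ≤ n := by
  have h1 := Nat.sqrt_le' n
  have h2 := Nat.sqrt_le' (Nat.sqrt n)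
  have h3 := Nat.sqrt_le' (Nat.sqrt (Nat.sqrt n))
  calc eighthRoot n ^ 8 = ((eighthRoot n ^ 2) ^ 2) ^ 2 := by ring
    _ ≤ n := (Nat.pow_le_pow_left ((Nat.pow_le_pow_left h3 2).trans h2) 2).trans h1

theorem lt_eighthRoot_succ_pow (n : ℕ) : n < (eighthRoot n + 1) ^ 8 := by
  have h1 := Nat.lt_succ_sqrt' n
  have h2 := Nat.lt_succ_sqrt' (Nat.sqrt n)
  have h3 := Nat.lt_succ_sqrt' (Nat.sqrt (Nat.sqrt n))
  calc n < (Nat.sqrt n + 1) ^ 2 := h1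
    _ ≤ ((Nat.sqrt (Nat.sqrt n) + 1) ^ 2) ^ 2 := Nat.pow_le_pow_left h2 2
    _ ≤ (((eighthRoot n + 1) ^ 2) ^ 2) ^ 2 :=
      Nat.pow_le_pow_left (Nat.pow_le_pow_left h3 2) 2
    _ = _ := by ring

theorem tendsto_eighthRoot : Tendsto eighthRoot atTop atTop := by
  refine tendsto_atTop.2 fun b => ?_
  filter_upwards [eventually_ge_atTop (b ^ 8)] with n hn
  by_contra h
  have := lt_eighthRoot_succ_pow n
  have h2 : (eighthRoot n + 1) ^ 8 ≤ b ^ 8 := Nat.pow_le_pow_left (by omega) 8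
  omega

/-- With j the eighth root, n² is at most (j+1)^16, a polynomial in j beaten by x^j. This bounds the
probability that some strings remain unseparated. -/
theorem tendsto_sq_mul_pow_eighthRoot {x : ℝ} (h0 : 0 < x) (h1 : x < 1) :
    Tendsto (fun n : ℕ => (n : ℝ) ^ 2 * x ^ eighthRoot n) atTop (𝓝 0) := by
  have h := tendsto_pow_const_mul_const_pow_of_abs_lt_one 16 (r := x) (by rwa [abs_of_pos h0])
  have h2 : Tendsto (fun n : ℕ => x⁻¹ * ((((eighthRoot n + 1 : ℕ) : ℝ)) ^ 16 *
      x ^ (eighthRoot n + 1))) atTop (𝓝 0) := by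
    have := (h.comp (tendsto_atTop_mono (fun n => Nat.le_succ _) tendsto_eighthRoot)).const_mul x⁻¹
    simpa using this
  refine squeeze_zero (fun n => by positivity) (fun n => ?_) h2
  have hn : (n : ℝ) ≤ ((eighthRoot n + 1 : ℕ) : ℝ) ^ 8 := by
    exact_mod_cast (lt_eighthRoot_succ_pow n).le
  rw [pow_succ x, show ∀ a b : ℝ, x⁻¹ * (a * (b * x)) = a * b from fun a b => by field_simp]
  refine mul_le_mul_of_nonneg_right ?_ (by positivity)
  calc (n : ℝ) ^ 2 ≤ (((eighthRoot n + 1 : ℕ) : ℝ) ^ 8) ^ 2 := by gcongr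
    _ = _ := by ring

/-- `n ^ (-1/4)`. -/
def rootInv (n : ℕ) : ℝ := (√√(n : ℝ))⁻¹

theorem rootInv_nonneg (n : ℕ) : 0 ≤ rootInv n := by unfold rootInv; positivity

theorem rootInv_pow_four (n : ℕ) : rootInv n ^ 4 = (n : ℝ)⁻¹ := by
  rw [rootInv, inv_pow, show ∀ x : ℝ, x ^ 4 = (x ^ 2) ^ 2 from fun x => by ring,
    Real.sq_sqrt (Real.sqrt_nonneg _), Real.sq_sqrt (by positivity)]

theorem rootInv_le_one (n : ℕ) : rootInv n ≤ 1 := by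
  rcases Nat.eq_zero_or_pos n with rfl | hn
  · simp [rootInv]
  · refine inv_le_one_of_one_le₀ (Real.one_le_sqrt.2 (Real.one_le_sqrt.2 ?_))
    exact_mod_cast hn

theorem inv_sqrt_le_rootInv (n : ℕ) : (√(n : ℝ))⁻¹ ≤ rootInv n := by
  have h : (√(n : ℝ))⁻¹ = rootInv n * rootInv n := by
    rw [rootInv, ← mul_inv, Real.mul_self_sqrt (Real.sqrt_nonneg _)]
  rw [h]
  exact mul_le_of_le_one_left (rootInv_nonneg n) (rootInv_le_one n)

theorem tendsto_rootInv : Tendsto rootInv atTop (𝓝 0) :=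
  tendsto_inv_atTop_zero.comp (Real.tendsto_sqrt_atTop.comp
    (Real.tendsto_sqrt_atTop.comp tendsto_natCast_atTop_atTop))

theorem tendsto_eighthRoot_mul_rootInv :
    Tendsto (fun n : ℕ => (eighthRoot n : ℝ) * rootInv n) atTop (𝓝 0) := by
  have h : Tendsto (fun n : ℕ => ((eighthRoot n : ℝ))⁻¹) atTop (𝓝 0) :=
    tendsto_inv_atTop_zero.comp (tendsto_natCast_atTop_atTop.comp tendsto_eighthRoot)
  refine squeeze_zero' (Eventually.of_forall fun n => mul_nonneg (by positivity)
    (rootInv_nonneg n)) ?_ h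
  filter_upwards [tendsto_eighthRoot.eventually_ge_atTop 1] with n hn
  have hj : (0 : ℝ) < eighthRoot n := by exact_mod_cast hn
  have h8 : ((eighthRoot n : ℝ) ^ 2) ^ 4 ≤ n := by
    rw [← pow_mul]; exact_mod_cast eighthRoot_pow_le n
  have h2 : (eighthRoot n : ℝ) ^ 2 ≤ √√(n : ℝ) := by
    refine Real.le_sqrt_of_sq_le (Real.le_sqrt_of_sq_le ?_)
    rw [← pow_mul]; exact h8
  calc (eighthRoot n : ℝ) * rootInv n ≤ eighthRoot n * ((eighthRoot n : ℝ) ^ 2)⁻¹ := by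
        unfold rootInv
        gcongr
    _ = _ := by field_simp

theorem measurable_noise {n : ℕ} (p : ℝ) (u : List (Fin 2)) :
    Measurable fun s : Fin n → ℕ → Fin 2 => noise p s u := by
  have hcnt : ∀ v : List (Fin 2), Measurable fun s : Fin n → ℕ → Fin 2 => (cnt s v : ℝ) := by
    intro v
    have : ∀ s : Fin n → ℕ → Fin 2, (cnt s v : ℝ) =
        ∑ i, (fun w => if w = v then (1 : ℝ) else 0) (prefixWord (s i) v.length) := by
      intro s; simp [cnt, cyl]
    simp only [this]
    exact Finset.measurable_fun_sum _ fun i _ =>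
      (IsBernoulliSample.measurable_comp_prefixWord (fun w => if w = v then (1 : ℝ) else 0)
        v.length).comp (measurable_pi_apply i)
  unfold noise
  exact ((hcnt _).sub ((hcnt _).const_mul _)).div_const _

theorem abs_noise_le {n : ℕ} {p : ℝ} (hp0 : 0 < p) (hp1 : p < 1) (s : Fin n → ℕ → Fin 2)
    (u : List (Fin 2)) : |noise p s u| ≤ n / √(n : ℝ) := by
  rw [noise, abs_div, abs_of_nonneg (Real.sqrt_nonneg _)]
  refine div_le_div_of_nonneg_right ?_ (Real.sqrt_nonneg _)
  have hc : ∀ v, (cnt s v : ℝ) ≤ n := fun v => by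
    exact_mod_cast (Nat.le_add_left _ _).trans (cntBelow_add_cnt_le s v)
  have h0 : ∀ v, (0 : ℝ) ≤ cnt s v := fun v => by positivity
  have h1 := hc (0 :: u)
  have h2 := hc u
  have h3 := h0 (0 :: u)
  have h4 := h0 u
  rw [abs_le]
  constructor <;> nlinarith

/-- The deterministic part of the comparison. The threshold a lies below all cylinder probabilities
of level K, so frequencies within a of them are positive and the time change is a bijection. -/
theorem edist_le_of_levelBound {n K : ℕ} {p : ℝ} (hp0 : 0 < p) (hp1 : p < 1) (hn : 0 < n)
    {s : Fin n → ℕ → Fin 2} {L : ℕ} (hKL : K ≤ L) (hL : ∀ u ∈ words L, cnt s u ≤ 1)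
    {D : ℕ → ℝ} (hD : ∀ k < L, ∀ u ∈ words k, |noise p s u| ≤ D k) {a b ε : ℝ}
    (ha : ∑ k ∈ Finset.range K, D k < a * √(n : ℝ)) (ha1 : ∀ u ∈ words K, a ≤ wordProb p u)
    (ha2 : (words K).card * a ≤ ε) (hb : ∑ k ∈ Finset.Ico K L, D k < b)
    (hb1 : coefBound p * b ≤ ε / 2) (hb2 : (L + 2 * coefBound p) / √(n : ℝ) ≤ ε / 2) :
    edist (normalizedPath p s) (stepPath hp0 hp1 K (noise p s)) ≤ ENNReal.ofReal ε := by
  have hn' : (0 : ℝ) < n := by exact_mod_cast hn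
  have hsq : 0 < √(n : ℝ) := Real.sqrt_pos.2 hn'
  have hlt : ∀ u ∈ words K, |(cnt s u : ℝ) / n - wordProb p u| < a := by
    intro u hu
    have hlen := mem_words.1 hu
    refine lt_of_le_of_lt (abs_cnt_div_sub_wordProb_le hp0 hp1 hn (D := D) u
      fun k hk => hD k (by omega)) ?_
    rw [hlen, div_lt_iff₀ hsq]
    exact ha
  have hpos : ∀ u ∈ words K, 0 < cnt s u := by
    intro u hu
    have h1 := (abs_lt.1 (hlt u hu)).1
    have h2 := ha1 u hu
    have h3 : 0 < (cnt s u : ℝ) / n := by linarith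
    have h4 : (0 : ℝ) < cnt s u := by
      by_contra h
      have : (cnt s u : ℝ) = 0 := le_antisymm (not_lt.1 h) (by positivity)
      rw [this] at h3; simp at h3
    exact_mod_cast h4
  refine (edist_normalizedPath_stepPath_le hp0 hp1 hn hKL hpos hL hD).trans
    (ENNReal.ofReal_le_ofReal (max_le ?_ ?_))
  · refine le_trans (Finset.sum_le_sum fun u hu => (hlt u hu).le) ?_
    rw [Finset.sum_const, nsmul_eq_mul]
    exact ha2
  · have := mul_le_mul_of_nonneg_left hb.le (coefBound_pos hp0 hp1).le
    linarith

/-- For large `K` and large `n`, the normalized path is close to the step path of level `K`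
with high probability. -/
theorem exists_forall_measureReal_edist_le {Ω : ℕ → Type*} [∀ n, MeasurableSpace (Ω n)]
    {P : (n : ℕ) → Measure (Ω n)} [∀ n, IsProbabilityMeasure (P n)] {p : ℝ} (hp0 : 0 < p)
    (hp1 : p < 1) {Z : (n : ℕ) → Fin n → Ω n → ℕ → Fin 2}
    (hZ : ∀ n, IsBernoulliSample p (P n) (Z n)) {ε δ : ℝ} (hε : 0 < ε) (hδ : 0 < δ) :
    ∃ K₀, ∀ K ≥ K₀, ∀ᶠ n in atTop, (P n).real {ω | ¬ edist (normalizedPath p fun i => Z n i ω)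
      (stepPath hp0 hp1 K (noise p fun i => Z n i ω)) ≤ ENNReal.ofReal ε} ≤ δ := by
  have hd0 := decay_pos hp0
  have hd1 := decay_lt_one hp0 hp1
  have hC := coefBound_pos hp0 hp1
  set b := ε / (2 * coefBound p) with hb
  have hb0 : 0 < b := by positivity
  -- Markov bound for the part of the noise beyond level K that persists as n grows. The 4 is 1 + M
  -- with the fourth-moment constant M = 3.
  have hgeo : Tendsto (fun K : ℕ => decay p ^ K * (1 - decay p)⁻¹ * (4 / b)) atTop (𝓝 0) := by
    simpa using ((tendsto_pow_atTop_nhds_zero_of_lt_one hd0.le hd1).mul_const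
      (1 - decay p)⁻¹).mul_const (4 / b)
  obtain ⟨K₀, hK₀⟩ := eventually_atTop.1 (hgeo.eventually_lt_const (half_pos hδ))
  refine ⟨K₀, fun K hK => ?_⟩
  have hKgeo := hK₀ K hK
  obtain ⟨a, ha0, ha1, ha2⟩ : ∃ a : ℝ, 0 < a ∧ (∀ u ∈ words K, a ≤ wordProb p u) ∧
      (words K).card * a ≤ ε := by
    have hne : (words K).Nonempty := ⟨prefixWord (fun _ => 0) K, mem_words.2 (by simp)⟩
    obtain ⟨u₀, hu₀, hmin⟩ := Finset.exists_min_image (words K) (wordProb p) hne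
    have hcard : (0 : ℝ) < (words K).card := by exact_mod_cast hne.card_pos
    refine ⟨min (wordProb p u₀) (ε / (words K).card), lt_min (wordProb_pos hp0 hp1 _)
      (by positivity), fun u hu => (min_le_left _ _).trans (hmin u hu), ?_⟩
    calc ((words K).card : ℝ) * min (wordProb p u₀) (ε / (words K).card)
        ≤ (words K).card * (ε / (words K).card) := by gcongr; exact min_le_right _ _
      _ = ε := by field_simp
  have hρ0 : 0 < (1 - p) ^ 2 + p ^ 2 := by positivity
  have hρ1 : (1 - p) ^ 2 + p ^ 2 < 1 := by nlinarith
  -- Three vanishing probabilities: unseparated strings, large noise below level K, and the n^(-1/4)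
  -- part of the noise on levels K to L.
  have herr : Tendsto (fun n : ℕ => (n : ℝ) ^ 2 * ((1 - p) ^ 2 + p ^ 2) ^ eighthRoot n +
      8 * K / a * rootInv n + 4 / b * (eighthRoot n * rootInv n)) atTop (𝓝 0) := by
    simpa using ((tendsto_sq_mul_pow_eighthRoot hρ0 hρ1).add
      (tendsto_rootInv.const_mul (8 * K / a))).add
      (tendsto_eighthRoot_mul_rootInv.const_mul (4 / b))
  have herr2 : Tendsto (fun n : ℕ => (eighthRoot n : ℝ) * rootInv n + 2 * coefBound p * rootInv n)
      atTop (𝓝 0) := by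
    simpa using tendsto_eighthRoot_mul_rootInv.add (tendsto_rootInv.const_mul (2 * coefBound p))
  filter_upwards [eventually_gt_atTop 0, tendsto_eighthRoot.eventually_ge_atTop K,
    herr.eventually_lt_const (half_pos hδ), herr2.eventually_lt_const (half_pos hε)]
    with n hn hKL he1 he2
  have hn' : (0 : ℝ) < n := by exact_mod_cast hn
  have hsq : 0 < √(n : ℝ) := Real.sqrt_pos.2 hn'
  set L := eighthRoot n with hLdef
  set r := rootInv n with hr
  have hr0 : 0 ≤ r := rootInv_nonneg n
  have hr1 : r ≤ 1 := rootInv_le_one n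
  let W : Ω n → List (Fin 2) → ℝ := fun ω => noise p fun i => Z n i ω
  let S : ℕ → Ω n → ℝ := fun k ω => levelBound p r (W ω) k
  have hZm : Measurable fun (ω : Ω n) (i : Fin n) => Z n i ω :=
    measurable_pi_lambda _ fun i => (hZ n).measurable i
  have hWint : ∀ u, Integrable (fun ω => W ω u ^ 4) (P n) := by
    intro u
    refine Integrable.of_bound (((measurable_noise p u).comp hZm).pow_const 4).aestronglyMeasurable
      ((n / √(n : ℝ)) ^ 4) (ae_of_all _ fun ω => ?_)
    rw [Real.norm_eq_abs, abs_pow]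
    gcongr
    exact abs_noise_le hp0 hp1 _ u
  have hS := integral_levelBound_le (μ := P n) hp0 hr0 zero_le_three hWint fun u => by
    rw [hr, rootInv_pow_four, ← div_eq_mul_inv]
    refine (integral_noise_pow_four_le hp0 hp1 hn (hZ n) u).trans ?_
    have : 0 ≤ wordProb p u / n := div_nonneg (wordProb_pos hp0 hp1 u).le hn'.le
    linarith
  norm_num at hS
  have hS0 : ∀ k ω, 0 ≤ S k ω := fun k ω => levelBound_nonneg hp0 hr0 _ _
  have hsub : {ω | ¬ edist (normalizedPath p fun i => Z n i ω)
      (stepPath hp0 hp1 K (noise p fun i => Z n i ω)) ≤ ENNReal.ofReal ε} ⊆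
      ({ω | ∃ u ∈ words L, 2 ≤ cnt (fun i => Z n i ω) u} ∪
        {ω | a * √(n : ℝ) ≤ ∑ k ∈ Finset.range K, S k ω}) ∪
        {ω | b ≤ ∑ k ∈ Finset.Ico K L, S k ω} := by
    intro ω hω
    by_contra hcon
    simp only [Set.mem_union, Set.mem_ofPred_eq, not_or, not_exists, not_and, not_le] at hcon
    obtain ⟨⟨c1, c2⟩, c3⟩ := hcon
    refine hω (edist_le_of_levelBound hp0 hp1 hn hKL (fun u hu => Nat.lt_succ_iff.1 (c1 u hu))
      (D := fun k => S k ω) (fun k _ u hu => abs_le_levelBound hp0 hr0 (W ω) hu) c2 ha1 ha2 c3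
      (le_of_eq ?_) ?_)
    · rw [hb]; field_simp
    · refine le_trans ?_ he2.le
      rw [← add_mul, div_eq_mul_inv]
      exact mul_le_mul_of_nonneg_left (inv_sqrt_le_rootInv n) (by positivity)
  refine (measureReal_mono hsub).trans ((measureReal_union_le _ _).trans
    (le_trans (add_le_add_left (measureReal_union_le _ _) _) ?_))
  have b1 := measureReal_exists_two_le_cnt_le (hZ n) L
  have b2 := measureReal_sum_ge_le (μ := P n) hS0 (fun k => (hS k).1) (fun k => (hS k).2)
    (Finset.range K) (mul_pos ha0 hsq)
  have b3 := measureReal_sum_ge_le (μ := P n) hS0 (fun k => (hS k).1) (fun k => (hS k).2)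
    (Finset.Ico K L) hb0
  have b2' : (∑ k ∈ Finset.range K, 4 * (decay p ^ k + r)) / (a * √(n : ℝ)) ≤ 8 * K / a * r := by
    have h1 : ∑ k ∈ Finset.range K, 4 * (decay p ^ k + r) ≤ ∑ k ∈ Finset.range K, (8 : ℝ) :=
      Finset.sum_le_sum fun k _ => by
        have := pow_le_one₀ (n := k) hd0.le hd1.le
        linarith
    rw [Finset.sum_const, Finset.card_range, nsmul_eq_mul] at h1
    calc _ ≤ (K * 8) / (a * √(n : ℝ)) := by gcongr
      _ = 8 * K / a * (√(n : ℝ))⁻¹ := by field_simp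
      _ ≤ _ := by gcongr; exact inv_sqrt_le_rootInv n
  have b3' : (∑ k ∈ Finset.Ico K L, 4 * (decay p ^ k + r)) / b ≤
      decay p ^ K * (1 - decay p)⁻¹ * (4 / b) + 4 / b * (L * r) := by
    have h1 : ∑ k ∈ Finset.Ico K L, decay p ^ k ≤ decay p ^ K * (1 - decay p)⁻¹ := by
      have := geom_sum_Ico_le_of_lt_one (m := K) (n := L) hd0.le hd1
      rwa [div_eq_mul_inv] at this
    have h2 : ∑ k ∈ Finset.Ico K L, r ≤ L * r := by
      rw [Finset.sum_const, Nat.card_Ico, nsmul_eq_mul]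
      gcongr
      omega
    rw [← Finset.mul_sum, Finset.sum_add_distrib]
    calc _ ≤ 4 * (decay p ^ K * (1 - decay p)⁻¹ + L * r) / b := by gcongr
      _ = _ := by ring
  linarith

end

section

/-! ### The limiting covariance -/

/-- The covariance of the partial sums of order `K` along `x` and `y`. -/
def covSum (p : ℝ) (K : ℕ) (x y : ℕ → Fin 2) : ℝ :=
  ∑ k ∈ Finset.range K, if prefixWord x k = prefixWord y k then
    coef p (x k) * coef p (y k) * (wordProb p (prefixWord y k) * (p * (1 - p))) else 0

/-- For r(s,t) = ∞ the product in `covFun` is infinite. Convergence to 0 shows that `∏'` does not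
take its default value 1. -/
theorem hasProd_zero_of_le {f : ℕ → ℝ} {c : ℝ} (h0 : ∀ k, 0 ≤ f k) (hc : c < 1)
    (hf : ∀ k, f k ≤ c) : HasProd f 0 := by
  have hc0 : 0 ≤ c := (h0 0).trans (hf 0)
  rw [HasProd, SummationFilter.unconditional_filter, Metric.tendsto_atTop]
  intro ε hε
  obtain ⟨N, hN⟩ := exists_pow_lt_of_lt_one hε hc
  refine ⟨Finset.range N, fun s hs => ?_⟩
  rw [Real.dist_eq, sub_zero, abs_of_nonneg (Finset.prod_nonneg fun k _ => h0 k)]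
  refine lt_of_le_of_lt ?_ hN
  calc ∏ k ∈ s, f k ≤ ∏ k ∈ Finset.range N, f k := by
        rw [← Finset.prod_sdiff hs]
        exact mul_le_of_le_one_left (Finset.prod_nonneg fun k _ => h0 k)
          (Finset.prod_le_one (fun k _ => h0 k) fun k _ => (hf k).trans hc.le)
    _ ≤ ∏ k ∈ Finset.range N, c := Finset.prod_le_prod (fun k _ => h0 k) fun k _ => hf k
    _ = c ^ N := by simp

theorem prod_Icc_bitProb (p t : ℝ) (k : ℕ) :
    ∏ j ∈ Finset.Icc 1 k, bitProb p (gFun p t j) = wordProb p (prefixWord (bits p t) k) := by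
  rw [wordProb_prefixWord, Finset.range_eq_Ico]
  have := Finset.prod_Ico_add' (fun j => bitProb p (gFun p t j)) 0 k 1
  rw [zero_add] at this
  exact this.symm

theorem coef_mul_self {p : ℝ} (hp0 : 0 < p) (hp1 : p < 1) (b : Fin 2) (a : ℝ) :
    coef p b * coef p b * (a * (p * (1 - p))) = bitProb p b * a / bitProb p (1 - b) := by
  have hq : 1 - p ≠ 0 := by linarith
  rcases Fin.exists_fin_two.1 ⟨b, rfl⟩ with rfl | rfl
  · simp [coef, bitProb]; field_simp
  · simp [coef, bitProb]; field_simp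

/-- The two coefficients have opposite signs and product -1/(p(1-p)). This is the source of the
negative product in the covariance. -/
theorem coef_mul_of_ne {p : ℝ} (hp0 : 0 < p) (hp1 : p < 1) {b c : Fin 2} (h : b ≠ c) (a : ℝ) :
    coef p b * coef p c * (a * (p * (1 - p))) = -a := by
  have hq : 1 - p ≠ 0 := by linarith
  rcases Fin.exists_fin_two.1 ⟨b, rfl⟩ with rfl | rfl <;>
  rcases Fin.exists_fin_two.1 ⟨c, rfl⟩ with rfl | rfl
  · exact absurd rfl h
  · simp [coef]; field_simp
  · simp [coef]; field_simp
  · exact absurd rfl h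

theorem bitProb_le_max (p : ℝ) (b : Fin 2) : bitProb p b ≤ max (1 - p) p := by
  unfold bitProb; split_ifs <;> simp

theorem wordProb_le_pow {p : ℝ} (hp0 : 0 < p) (hp1 : p < 1) (u : List (Fin 2)) :
    wordProb p u ≤ max (1 - p) p ^ u.length := by
  induction u with
  | nil => simp [wordProb]
  | cons b u ih =>
    rw [List.length_cons, pow_succ', wordProb]
    exact mul_le_mul (bitProb_le_max p b) ih (wordProb_pos hp0 hp1 u).le
      (le_max_of_le_right hp0.le)

theorem covFun_of_forall_eq {p s t : ℝ} (hp0 : 0 < p) (hp1 : p < 1)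
    (h : ∀ k, bits p s k = bits p t k) :
    Tendsto (fun K => covSum p K (bits p s) (bits p t)) atTop (𝓝 (covFun p s t)) := by
  have hr : rFun p s t = ⊤ := by
    refine ENat.eq_top_iff_forall_ge.2 fun m => ?_
    refine le_iSup₂_of_le (f := fun (n : ℕ) (_ : ∀ l : ℕ, 1 ≤ l → l ≤ n →
      gFun p s l = gFun p t l) => (n : ℕ∞)) m (fun l hl _ => ?_) le_rfl
    obtain ⟨k, rfl⟩ := Nat.exists_eq_add_of_le' hl
    exact h k
  have hmax : max (1 - p) p < 1 := max_lt (by linarith) hp1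
  have hmax0 : 0 ≤ max (1 - p) p := le_max_of_le_right hp0.le
  -- The shift by one matches `bits`, indexed from 0, with `gFun`, whose relevant values start at
  -- index 1.
  let e : ℕ ≃ {k : ℕ // 1 ≤ k ∧ (k : ℕ∞) ≤ rFun p s t} :=
    { toFun := fun k => ⟨k + 1, by omega, by rw [hr]; exact le_top⟩
      invFun := fun k => k - 1
      left_inv := fun k => by simp
      right_inv := fun k => Subtype.ext (Nat.sub_add_cancel k.2.1) }
  have hprod : ∏' k : {k : ℕ // 1 ≤ k ∧ (k : ℕ∞) ≤ rFun p s t}, bitProb p (gFun p t k) = 0 := by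
    rw [← e.tprod_eq]
    exact (hasProd_zero_of_le (fun k => (bitProb_pos hp0 hp1 _).le) hmax
      fun k => bitProb_le_max p _).tprod_eq
  have hx : prefixWord (bits p s) = prefixWord (bits p t) :=
    funext fun k => prefixWord_congr fun j _ => h j
  have hterm : ∀ k : ℕ, (if prefixWord (bits p s) k = prefixWord (bits p t) k then
      coef p (bits p s k) * coef p (bits p t k) * (wordProb p (prefixWord (bits p t) k) *
        (p * (1 - p))) else 0) =
      (∏ j ∈ Finset.Icc 1 (e k : ℕ), bitProb p (gFun p t j)) / bitProb p (1 - gFun p t (e k)) := by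
    intro k
    rw [if_pos (congrFun hx k), h k, coef_mul_self hp0 hp1, prod_Icc_bitProb]
    rfl
  have hsum : Summable fun k : ℕ => (∏ j ∈ Finset.Icc 1 (e k : ℕ), bitProb p (gFun p t j)) /
      bitProb p (1 - gFun p t (e k)) := by
    refine Summable.of_nonneg_of_le (fun k => div_nonneg
      (Finset.prod_nonneg fun j _ => (bitProb_pos hp0 hp1 _).le) (bitProb_pos hp0 hp1 _).le)
      (fun k => ?_) (((summable_geometric_of_lt_one hmax0 hmax).mul_left
        (max (1 - p) p)).div_const (min (1 - p) p))
    rw [prod_Icc_bitProb]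
    have h1 := wordProb_le_pow hp0 hp1 (prefixWord (bits p t) (e k))
    rw [length_prefixWord] at h1
    refine div_le_div₀ (by positivity) (h1.trans (le_of_eq (pow_succ' _ k))) ?_ ?_
    · exact lt_min (by linarith) hp0
    · unfold bitProb; split_ifs <;> simp
  rw [covFun, hprod, neg_zero, zero_add, ← e.tsum_eq]
  simp only [covSum, hterm]
  exact hsum.hasSum.tendsto_sum_nat

/-- Nodes before m give the sum, node m is still shared but left along different bits and gives the
negative product, and later nodes are not shared. -/
theorem covFun_of_ne {p s t : ℝ} (hp0 : 0 < p) (hp1 : p < 1) {m : ℕ}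
    (h : ∀ k < m, bits p s k = bits p t k) (hm : bits p s m ≠ bits p t m) :
    Tendsto (fun K => covSum p K (bits p s) (bits p t)) atTop (𝓝 (covFun p s t)) := by
  have hr : rFun p s t = m := by
    refine le_antisymm (iSup₂_le fun n hn => ?_) ?_
    · by_contra hlt
      have hmn : m + 1 ≤ n := by
        have : (m : ℕ∞) < n := not_le.1 hlt
        exact_mod_cast this
      exact hm (hn (m + 1) (by omega) hmn)
    · refine le_iSup₂_of_le (f := fun (n : ℕ) (_ : ∀ l : ℕ, 1 ≤ l → l ≤ n →
        gFun p s l = gFun p t l) => (n : ℕ∞)) m (fun l hl hlm => ?_) le_rfl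
      obtain ⟨k, rfl⟩ := Nat.exists_eq_add_of_le' hl
      exact h k (by omega)
  let e : Finset.Icc 1 m ≃ {k : ℕ // 1 ≤ k ∧ (k : ℕ∞) ≤ rFun p s t} :=
    Equiv.subtypeEquivRight fun k => by rw [hr, Finset.mem_Icc]; simp
  have hprod : ∏' k : {k : ℕ // 1 ≤ k ∧ (k : ℕ∞) ≤ rFun p s t}, bitProb p (gFun p t k) =
      wordProb p (prefixWord (bits p t) m) := by
    rw [← e.tprod_eq, ← prod_Icc_bitProb]
    exact Finset.tprod_subtype (Finset.Icc 1 m) fun k => bitProb p (gFun p t k)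
  have hsum : (∑' k : {k : ℕ // 1 ≤ k ∧ (k : ℕ∞) ≤ rFun p s t},
      (∏ j ∈ Finset.Icc 1 (k : ℕ), bitProb p (gFun p t j)) / bitProb p (1 - gFun p t k)) =
      ∑ k ∈ Finset.range m, wordProb p (prefixWord (bits p t) (k + 1)) /
        bitProb p (1 - bits p t k) := by
    rw [← e.tsum_eq]
    refine (Finset.tsum_subtype (Finset.Icc 1 m) fun k =>
      (∏ j ∈ Finset.Icc 1 k, bitProb p (gFun p t j)) / bitProb p (1 - gFun p t k)).trans ?_
    have := Finset.sum_Ico_add' (fun k =>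
      (∏ j ∈ Finset.Icc 1 k, bitProb p (gFun p t j)) / bitProb p (1 - gFun p t k)) 0 m 1
    rw [zero_add] at this
    rw [Finset.range_eq_Ico]
    refine this.symm.trans (Finset.sum_congr rfl fun k _ => ?_)
    rw [prod_Icc_bitProb]
    rfl
  refine tendsto_const_nhds.congr' ?_
  filter_upwards [eventually_ge_atTop (m + 1)] with K hK
  rw [covFun, hprod, hsum, covSum, ← Finset.sum_subset (Finset.range_mono hK) fun k _ hk => ?_,
    Finset.sum_range_succ, if_pos (prefixWord_congr h), coef_mul_of_ne hp0 hp1 hm, add_comm]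
  · congr 1
    refine Finset.sum_congr rfl fun k hk => ?_
    have hk := Finset.mem_range.1 hk
    rw [if_pos (prefixWord_congr fun j hj => h j (hj.trans hk)), h k hk, coef_mul_self hp0 hp1]
    rfl
  · refine if_neg fun he => hm (apply_eq_of_prefixWord_eq he m ?_)
    simp only [Finset.mem_range] at hk
    omega

theorem tendsto_covSum {p : ℝ} (hp0 : 0 < p) (hp1 : p < 1) (s t : ℝ) :
    Tendsto (fun K => covSum p K (bits p s) (bits p t)) atTop (𝓝 (covFun p s t)) := by
  by_cases h : ∀ k, bits p s k = bits p t k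
  · exact covFun_of_forall_eq hp0 hp1 h
  · push Not at h
    classical
    exact covFun_of_ne hp0 hp1 (m := Nat.find h) (fun k hk => not_not.1 (Nat.find_min h hk))
      (Nat.find_spec h)

/-! ### Gaussian weights -/

/-- The words of length less than `K`. -/
def wordsLT (K : ℕ) : Finset (List (Fin 2)) := (Finset.range K).biUnion words

theorem mem_wordsLT {K : ℕ} {u : List (Fin 2)} : u ∈ wordsLT K ↔ u.length < K := by
  simp [wordsLT, mem_words]

theorem sum_wordsLT {M : Type*} [AddCommMonoid M] (K : ℕ) (f : List (Fin 2) → M) :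
    ∑ u ∈ wordsLT K, f u = ∑ k ∈ Finset.range K, ∑ u ∈ words k, f u := by
  refine Finset.sum_biUnion fun i _ j _ hij => Finset.disjoint_left.2 fun u hi hj => hij ?_
  rw [← mem_words.1 hi, mem_words.1 hj]

/-- The law of a family of independent standard Gaussian variables indexed by words. -/
def gaussMeasure : Measure (List (Fin 2) → ℝ) := Measure.infinitePi fun _ => gaussianReal 0 1

instance : IsProbabilityMeasure gaussMeasure := by unfold gaussMeasure; infer_instance

theorem iIndepFun_eval_gaussMeasure :
    iIndepFun (fun (u : List (Fin 2)) (ω : List (Fin 2) → ℝ) => ω u) gaussMeasure :=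
  iIndepFun_infinitePi (X := fun _ x => x) fun _ => measurable_id

theorem map_eval_gaussMeasure (u : List (Fin 2)) :
    gaussMeasure.map (fun ω => ω u) = gaussianReal 0 1 :=
  Measure.infinitePi_map_eval _ u

theorem map_sum_gaussMeasure (F : Finset (List (Fin 2))) (a : List (Fin 2) → ℝ) :
    gaussMeasure.map (fun ω => ∑ u ∈ F, a u * ω u) =
      gaussianReal 0 (∑ u ∈ F, a u ^ 2).toNNReal := by
  have hm : Measurable fun ω : List (Fin 2) → ℝ => ∑ u ∈ F, a u * ω u := by fun_prop
  have := Measure.isProbabilityMeasure_map (μ := gaussMeasure) hm.aemeasurable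
  refine Measure.ext_of_charFun ?_
  have hi : iIndepFun (fun u (ω : List (Fin 2) → ℝ) => a u * ω u) gaussMeasure :=
    iIndepFun_eval_gaussMeasure.comp (fun u x => a u * x) fun u => by fun_prop
  have hmu : ∀ u ∈ F, AEMeasurable (fun ω : List (Fin 2) → ℝ => a u * ω u) gaussMeasure :=
    fun u _ => Measurable.aemeasurable (by fun_prop)
  rw [iIndepFun.charFun_map_fun_finsetSum_eq_prod hmu (hi.restrict F)]
  ext θ
  rw [Finset.prod_apply, charFun_gaussianReal]
  have hu : ∀ u ∈ F, charFun (gaussMeasure.map fun ω => a u * ω u) θ =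
      Complex.exp (-((a u ^ 2 : ℝ) : ℂ) * θ ^ 2 / 2) := by
    intro u _
    rw [charFun_map_mul_comp (measurable_pi_apply u).aemeasurable, map_eval_gaussMeasure, charFun_gaussianReal]
    congr 1
    push_cast
    ring
  rw [Finset.prod_congr rfl hu, ← Complex.exp_sum, Real.coe_toNNReal _ (by positivity)]
  congr 1
  push_cast
  rw [Finset.sum_mul, Finset.sum_div, mul_zero, zero_mul, zero_sub, ← Finset.sum_neg_distrib]
  exact Finset.sum_congr rfl fun u _ => by ring

/-- The standard deviation of the limiting noise at a node. -/
def nodeStd (p : ℝ) (u : List (Fin 2)) : ℝ := √(wordProb p u * (p * (1 - p)))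

theorem nodeStd_mul_self {p : ℝ} (hp0 : 0 < p) (hp1 : p < 1) (u : List (Fin 2)) :
    nodeStd p u * nodeStd p u = wordProb p u * (p * (1 - p)) :=
  Real.mul_self_sqrt (mul_nonneg (wordProb_pos hp0 hp1 u).le
    (mul_nonneg hp0.le (by linarith)))

/-- The limiting noise. -/
def gaussW (p : ℝ) (ω : List (Fin 2) → ℝ) (u : List (Fin 2)) : ℝ := nodeStd p u * ω u

/-- The coefficient of the Gaussian variable at `u` in the partial sum along `x`. -/
def nodeCoef (p : ℝ) (x : ℕ → Fin 2) (u : List (Fin 2)) : ℝ :=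
  if prefixWord x u.length = u then coef p (x u.length) * nodeStd p u else 0

theorem pathSum_gaussW (p : ℝ) (ω : List (Fin 2) → ℝ) (K : ℕ) (x : ℕ → Fin 2) :
    pathSum p (gaussW p ω) K x = ∑ u ∈ wordsLT K, nodeCoef p x u * ω u := by
  rw [sum_wordsLT, pathSum]
  refine Finset.sum_congr rfl fun k _ => ?_
  rw [Finset.sum_eq_single (prefixWord x k)]
  · simp [nodeCoef, gaussW, mul_assoc]
  · intro u hu hne
    rw [nodeCoef, mem_words.1 hu, if_neg hne.symm, zero_mul]
  · intro hu; exact absurd (mem_words.2 (by simp)) hu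

theorem sum_nodeCoef_mul {p : ℝ} (hp0 : 0 < p) (hp1 : p < 1) (K : ℕ) (x y : ℕ → Fin 2) :
    ∑ u ∈ wordsLT K, nodeCoef p x u * nodeCoef p y u = covSum p K x y := by
  rw [sum_wordsLT, covSum]
  refine Finset.sum_congr rfl fun k _ => ?_
  rw [Finset.sum_eq_single (prefixWord y k)]
  · rw [nodeCoef, nodeCoef, length_prefixWord]
    split_ifs with h1 h2 <;> simp_all
    rw [← nodeStd_mul_self hp0 hp1]; ring
  · intro u hu hne
    have : nodeCoef p y u = 0 := by rw [nodeCoef, mem_words.1 hu, if_neg hne.symm]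
    rw [this, mul_zero]
  · intro hu; exact absurd (mem_words.2 (by simp)) hu

theorem map_sum_pathSum {p : ℝ} (hp0 : 0 < p) (hp1 : p < 1) {ι : Type*} (J : Finset ι) (c : ι → ℝ)
    (x : ι → ℕ → Fin 2) (K : ℕ) :
    gaussMeasure.map (fun ω => ∑ j ∈ J, c j * pathSum p (gaussW p ω) K (x j)) =
      gaussianReal 0 (∑ i ∈ J, ∑ j ∈ J, c i * c j * covSum p K (x i) (x j)).toNNReal := by
  have h1 : ∀ ω, ∑ j ∈ J, c j * pathSum p (gaussW p ω) K (x j) =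
      ∑ u ∈ wordsLT K, (∑ j ∈ J, c j * nodeCoef p (x j) u) * ω u := by
    intro ω
    simp only [pathSum_gaussW, Finset.mul_sum, Finset.sum_mul]
    rw [Finset.sum_comm]
    exact Finset.sum_congr rfl fun u _ => Finset.sum_congr rfl fun j _ => by ring
  simp only [h1]
  rw [map_sum_gaussMeasure]
  congr 2
  simp only [← sum_nodeCoef_mul hp0 hp1, sq, Finset.mul_sum]
  rw [Finset.sum_comm]
  refine Finset.sum_congr rfl fun i _ => ?_
  rw [Finset.sum_comm]
  refine Finset.sum_congr rfl fun u _ => ?_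
  rw [Finset.sum_mul]
  exact Finset.sum_congr rfl fun j _ => by ring

/-- Characteristic functions of centered Gaussian laws converge with their variances, and an almost
sure limit determines the limiting law. -/
theorem map_eq_gaussianReal_of_tendsto {Ω : Type*} [MeasurableSpace Ω] {μ : Measure Ω}
    [IsProbabilityMeasure μ] {X : ℕ → Ω → ℝ} {Y : Ω → ℝ} {v : ℕ → ℝ} {a : ℝ}
    (hX : ∀ K, AEMeasurable (X K) μ) (hY : AEMeasurable Y μ)
    (hlim : ∀ᵐ ω ∂μ, Tendsto (fun K => X K ω) atTop (𝓝 (Y ω)))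
    (hlaw : ∀ K, μ.map (X K) = gaussianReal 0 (v K).toNNReal) (hv : Tendsto v atTop (𝓝 a)) :
    μ.map Y = gaussianReal 0 a.toNNReal := by
  have := Measure.isProbabilityMeasure_map hY
  refine Measure.ext_of_charFun (funext fun θ => ?_)
  have h1 := ProbabilityMeasure.tendsto_iff_tendsto_charFun.1
    (tendstoInDistribution_of_ae_tendsto hX hY hlim).tendsto θ
  simp only [ProbabilityMeasure.coe_mk, hlaw, charFun_gaussianReal] at h1
  refine tendsto_nhds_unique h1 ?_
  rw [charFun_gaussianReal]
  have h2 : Tendsto (fun K => (((v K).toNNReal : ℝ) : ℂ)) atTop (𝓝 ((a.toNNReal : ℝ) : ℂ)) :=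
    (Complex.continuous_ofReal.tendsto _).comp
      (NNReal.continuous_coe.tendsto _ |>.comp ((continuous_real_toNNReal.tendsto a).comp hv))
  exact (Complex.continuous_exp.tendsto _).comp
    (tendsto_const_nhds.sub ((h2.mul_const _).div_const _))

end

section

/-! ### The limit process -/

theorem CadlagSpace.ext_of_forall {x y : CadlagSpace} (h : ∀ t, x t = y t) : x = y := by
  obtain ⟨f, _, _⟩ := x
  obtain ⟨g, _, _⟩ := y
  obtain rfl : f = g := funext h
  rfl

theorem abs_pathSum_sub_pathSum_le {p : ℝ} (hp0 : 0 < p) (hp1 : p < 1) (w w' : List (Fin 2) → ℝ)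
    (K : ℕ) (x : ℕ → Fin 2) :
    |pathSum p w K x - pathSum p w' K x| ≤ coefBound p * ∑ u ∈ wordsLT K, |w u - w' u| := by
  rw [pathSum, pathSum, ← Finset.sum_sub_distrib, sum_wordsLT, Finset.mul_sum]
  refine (Finset.abs_sum_le_sum_abs _ _).trans (Finset.sum_le_sum fun k _ => ?_)
  rw [← mul_sub, abs_mul]
  refine mul_le_mul (abs_coef_le hp0 hp1 _) ?_ (abs_nonneg _) (coefBound_pos hp0 hp1).le
  exact Finset.single_le_sum (f := fun u => |w u - w' u|) (fun u _ => abs_nonneg _)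
    (mem_words.2 (by simp))

/-- The path depends on finitely many weights, uniformly in t. The continuous mapping theorem can
therefore carry the convergence of the noise to D[0,1]. -/
theorem continuous_stepPath {p : ℝ} (hp0 : 0 < p) (hp1 : p < 1) (K : ℕ) :
    Continuous (stepPath hp0 hp1 K) := by
  refine continuous_iff_continuousAt.2 fun w => ?_
  rw [ContinuousAt, tendsto_iff_edist_tendsto_0]
  have h : Tendsto (fun w' : List (Fin 2) → ℝ => ENNReal.ofReal
      (coefBound p * ∑ u ∈ wordsLT K, |w' u - w u|)) (𝓝 w) (𝓝 0) := by
    have hc : Continuous fun w' : List (Fin 2) → ℝ => ENNReal.ofReal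
        (coefBound p * ∑ u ∈ wordsLT K, |w' u - w u|) :=
      ENNReal.continuous_ofReal.comp (by fun_prop)
    simpa using hc.tendsto w
  exact tendsto_of_tendsto_of_tendsto_of_le_of_le tendsto_const_nhds h (fun _ => zero_le)
    fun w' => edist_le_of_forall_abs_sub_le fun t => abs_pathSum_sub_pathSum_le hp0 hp1 _ _ _ _

theorem abs_pathSum_sub_pathSeries_le {p : ℝ} (hp0 : 0 < p) (hp1 : p < 1) {w : List (Fin 2) → ℝ}
    {D : ℕ → ℝ} (hD : Summable D) (hw : ∀ u, |w u| ≤ D u.length) (K : ℕ) (x : ℕ → Fin 2) :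
    |pathSum p w K x - pathSeries p w x| ≤ coefBound p * ∑' k, D (k + K) := by
  have hterm : ∀ k, ‖coef p (x k) * w (prefixWord x k)‖ ≤ coefBound p * D k := fun k => by
    rw [Real.norm_eq_abs, abs_mul]
    refine mul_le_mul (abs_coef_le hp0 hp1 _) ?_ (abs_nonneg _) (coefBound_pos hp0 hp1).le
    simpa using hw (prefixWord x k)
  have hs : Summable fun k => coef p (x k) * w (prefixWord x k) :=
    Summable.of_norm_bounded (hD.mul_left _) hterm
  rw [pathSeries, ← hs.sum_add_tsum_nat_add K, pathSum, sub_add_cancel_left, abs_neg,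
    ← Real.norm_eq_abs, ← tsum_mul_left]
  exact tsum_of_norm_bounded (((summable_nat_add_iff K).2 hD).mul_left _).hasSum fun k =>
    hterm (k + K)

theorem tendsto_stepPath {p : ℝ} (hp0 : 0 < p) (hp1 : p < 1) {w : List (Fin 2) → ℝ}
    {D : ℕ → ℝ} (hD : Summable D) (hw : ∀ u, |w u| ≤ D u.length) :
    Tendsto (fun K => stepPath hp0 hp1 K w) atTop (𝓝 (seriesPath hp0 hp1 w hD hw)) := by
  rw [tendsto_iff_edist_tendsto_0]
  have h : Tendsto (fun K => ENNReal.ofReal (coefBound p * ∑' k, D (k + K))) atTop (𝓝 0) := by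
    have := (ENNReal.continuous_ofReal.tendsto _).comp
      ((tendsto_sum_nat_add D).const_mul (coefBound p))
    simpa [Function.comp_def] using this
  exact tendsto_of_tendsto_of_tendsto_of_le_of_le tendsto_const_nhds h (fun _ => zero_le)
    fun K => edist_le_of_forall_abs_sub_le fun t => abs_pathSum_sub_pathSeries_le hp0 hp1 hD hw _ _

theorem tendsto_pathSum {p : ℝ} (hp0 : 0 < p) (hp1 : p < 1) {w : List (Fin 2) → ℝ}
    {D : ℕ → ℝ} (hD : Summable D) (hw : ∀ u, |w u| ≤ D u.length) (x : ℕ → Fin 2) :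
    Tendsto (fun K => pathSum p w K x) atTop (𝓝 (pathSeries p w x)) := by
  rw [tendsto_iff_dist_tendsto_zero]
  refine squeeze_zero (fun _ => dist_nonneg)
    (fun K => abs_pathSum_sub_pathSeries_le hp0 hp1 hD hw K x) ?_
  simpa using (tendsto_sum_nat_add D).const_mul (coefBound p)

/-- The event that the Gaussian weights are summably bounded. -/
def goodSet (p : ℝ) : Set (List (Fin 2) → ℝ) :=
  {ω | ∑' k, ENNReal.ofReal (levelBound p 0 (gaussW p ω) k) ≠ ⊤}

theorem measurable_levelBound_gaussW (p : ℝ) (k : ℕ) :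
    Measurable fun ω => levelBound p 0 (gaussW p ω) k := by
  unfold levelBound gaussW
  fun_prop

theorem measurableSet_goodSet (p : ℝ) : MeasurableSet (goodSet p) :=
  (measurableSet_eq_fun (Measurable.tsum fun k =>
    (measurable_levelBound_gaussW p k).ennreal_ofReal) measurable_const).compl

theorem summable_of_mem_goodSet {p : ℝ} (hp0 : 0 < p) {ω : List (Fin 2) → ℝ}
    (h : ω ∈ goodSet p) : Summable (levelBound p 0 (gaussW p ω)) := by
  refine (ENNReal.summable_toReal h).congr fun k => ?_
  rw [ENNReal.toReal_ofReal (levelBound_nonneg hp0 le_rfl _ _)]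

/-- The expected sum of the level bounds is dominated by a geometric series, so the sum is almost
surely finite. -/
theorem ae_mem_goodSet {p : ℝ} (hp0 : 0 < p) (hp1 : p < 1) :
    ∀ᵐ ω ∂gaussMeasure, ω ∈ goodSet p := by
  have hInt4 : Integrable (fun x : ℝ => x ^ 4) (gaussianReal 0 1) := by
    have := (memLp_id_gaussianReal (μ := 0) (v := 1) 4).integrable_norm_pow (by norm_num)
    refine this.congr (ae_of_all _ fun x => ?_)
    simp [Even.pow_abs (show Even 4 by decide)]
  have hInt : ∀ u, Integrable (fun ω => gaussW p ω u ^ 4) gaussMeasure := by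
    intro u
    have h1 : Integrable (fun ω : List (Fin 2) → ℝ => ω u ^ 4) gaussMeasure := by
      have := hInt4
      rw [← map_eval_gaussMeasure u] at this
      exact this.comp_measurable (measurable_pi_apply u)
    simp only [gaussW, mul_pow]
    exact h1.const_mul _
  set M := ∫ x, x ^ 4 ∂(gaussianReal 0 1) with hM
  have hM0 : 0 ≤ M := integral_nonneg fun x => by positivity
  have hw : ∀ u, ∫ ω, gaussW p ω u ^ 4 ∂gaussMeasure ≤
      M * (wordProb p u ^ 2 + wordProb p u * (0 : ℝ) ^ 4) := by
    intro u
    simp only [gaussW, mul_pow]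
    rw [integral_const_mul]
    have h1 : ∫ ω, ω u ^ 4 ∂gaussMeasure = M := by
      rw [hM, ← map_eval_gaussMeasure u,
        integral_map (measurable_pi_apply u).aemeasurable (by fun_prop)]
    have h2 : nodeStd p u ^ 4 ≤ wordProb p u ^ 2 := by
      have hπ := wordProb_pos hp0 hp1 u
      rw [show nodeStd p u ^ 4 = (nodeStd p u * nodeStd p u) ^ 2 by ring, nodeStd_mul_self hp0 hp1]
      have hpq : 0 ≤ p * (1 - p) := mul_nonneg hp0.le (by linarith)
      refine pow_le_pow_left₀ (mul_nonneg hπ.le hpq) (mul_le_of_le_one_right hπ.le ?_) 2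
      nlinarith
    rw [h1, mul_comm]
    refine mul_le_mul_of_nonneg_left ?_ hM0
    simpa using h2
  have hS := integral_levelBound_le (μ := gaussMeasure) hp0 le_rfl hM0 hInt hw
  have hfin : ∫⁻ ω, ∑' k, ENNReal.ofReal (levelBound p 0 (gaussW p ω) k) ∂gaussMeasure ≠ ⊤ := by
    rw [lintegral_tsum fun k => (measurable_levelBound_gaussW p k).ennreal_ofReal.aemeasurable]
    have hgeo : Summable fun k => (1 + M) * (decay p ^ k + 0) := by
      simpa using (summable_geometric_of_lt_one (decay_pos hp0).le
        (decay_lt_one hp0 hp1)).mul_left (1 + M)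
    refine ne_top_of_le_ne_top hgeo.tsum_ofReal_ne_top (ENNReal.tsum_le_tsum fun k => ?_)
    rw [← ofReal_integral_eq_lintegral_ofReal (hS k).1
      (ae_of_all _ fun ω => levelBound_nonneg hp0 le_rfl _ _)]
    exact ENNReal.ofReal_le_ofReal (hS k).2
  filter_upwards [ae_lt_top (Measurable.tsum fun k =>
    (measurable_levelBound_gaussW p k).ennreal_ofReal) hfin] with ω hω
  exact hω.ne

open Classical in
/-- The limit process. -/
def limitPath {p : ℝ} (hp0 : 0 < p) (hp1 : p < 1) (ω : List (Fin 2) → ℝ) : CadlagSpace :=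
  if h : ω ∈ goodSet p then seriesPath hp0 hp1 (gaussW p ω) (summable_of_mem_goodSet hp0 h)
    (fun _ => abs_le_levelBound hp0 le_rfl _ (mem_words.2 rfl))
  -- An empty sum: the zero path, used on a null set.
  else stepPath hp0 hp1 0 (gaussW p ω)

theorem measurable_gaussW (p : ℝ) : Measurable (gaussW p) := by
  refine measurable_pi_lambda _ fun u => ?_
  unfold gaussW
  fun_prop

theorem measurable_stepPath_gaussW {p : ℝ} (hp0 : 0 < p) (hp1 : p < 1) (K : ℕ) :
    Measurable fun ω => stepPath hp0 hp1 K (gaussW p ω) :=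
  (continuous_stepPath hp0 hp1 K).measurable.comp (measurable_gaussW p)

theorem tendsto_stepPath_limitPath {p : ℝ} (hp0 : 0 < p) (hp1 : p < 1) {ω : List (Fin 2) → ℝ}
    (h : ω ∈ goodSet p) :
    Tendsto (fun K => stepPath hp0 hp1 K (gaussW p ω)) atTop (𝓝 (limitPath hp0 hp1 ω)) := by
  rw [limitPath, dif_pos h]
  exact tendsto_stepPath hp0 hp1 _ _

theorem tendsto_pathSum_limitPath {p : ℝ} (hp0 : 0 < p) (hp1 : p < 1) {ω : List (Fin 2) → ℝ}
    (h : ω ∈ goodSet p) (t : I) :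
    Tendsto (fun K => pathSum p (gaussW p ω) K (bits p t)) atTop (𝓝 (limitPath hp0 hp1 ω t)) := by
  rw [limitPath, dif_pos h]
  exact tendsto_pathSum hp0 hp1 (summable_of_mem_goodSet hp0 h)
    (fun _ => abs_le_levelBound hp0 le_rfl _ (mem_words.2 rfl)) _

theorem measurable_limitPath {p : ℝ} (hp0 : 0 < p) (hp1 : p < 1) :
    Measurable (limitPath hp0 hp1) := by
  classical
  refine measurable_of_tendsto_metrizable
    (f := fun K => (goodSet p).piecewise (fun ω => stepPath hp0 hp1 K (gaussW p ω))
      fun ω => stepPath hp0 hp1 0 (gaussW p ω))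
    (fun K => (measurable_stepPath_gaussW hp0 hp1 K).piecewise (measurableSet_goodSet p)
      (measurable_stepPath_gaussW hp0 hp1 0)) (tendsto_pi_nhds.2 fun ω => ?_)
  by_cases h : ω ∈ goodSet p
  · simpa only [Set.piecewise_eq_of_mem _ _ _ h] using tendsto_stepPath_limitPath hp0 hp1 h
  · simp only [Set.piecewise_eq_of_notMem _ _ _ h, limitPath, dif_neg h]
    exact tendsto_const_nhds

/-- Evaluation at t is not continuous for the Skorokhod topology in general, so measurability is
obtained from the partial sums at t and not from `measurable_limitPath`. -/
theorem measurable_limitPath_apply {p : ℝ} (hp0 : 0 < p) (hp1 : p < 1) (t : I) :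
    Measurable fun ω => limitPath hp0 hp1 ω t := by
  classical
  have hm : ∀ K, Measurable fun ω => pathSum p (gaussW p ω) K (bits p t) := fun K => by
    unfold pathSum gaussW
    fun_prop
  refine measurable_of_tendsto_metrizable
    (f := fun K => (goodSet p).piecewise (fun ω => pathSum p (gaussW p ω) K (bits p t))
      fun ω => pathSum p (gaussW p ω) 0 (bits p t))
    (fun K => (hm K).piecewise (measurableSet_goodSet p) (hm 0)) (tendsto_pi_nhds.2 fun ω => ?_)
  by_cases h : ω ∈ goodSet p
  · simpa only [Set.piecewise_eq_of_mem _ _ _ h] using tendsto_pathSum_limitPath hp0 hp1 h t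
  · simp only [Set.piecewise_eq_of_notMem _ _ _ h, limitPath, dif_neg h]
    exact tendsto_const_nhds

theorem map_sum_limitPath {p : ℝ} (hp0 : 0 < p) (hp1 : p < 1) {ι : Type*} (J : Finset ι)
    (c : ι → ℝ) (t : ι → I) :
    gaussMeasure.map (fun ω => ∑ j ∈ J, c j * limitPath hp0 hp1 ω (t j)) =
      gaussianReal 0 (∑ i ∈ J, ∑ j ∈ J, c i * c j * covFun p (t i) (t j)).toNNReal := by
  refine map_eq_gaussianReal_of_tendsto
    (X := fun K ω => ∑ j ∈ J, c j * pathSum p (gaussW p ω) K (bits p (t j)))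
    (fun K => ?_) ?_ ?_ (fun K => map_sum_pathSum hp0 hp1 J c (fun j => bits p (t j)) K) ?_
  · refine Measurable.aemeasurable ?_
    unfold pathSum gaussW
    fun_prop
  · exact (Finset.measurable_fun_sum _ fun j _ =>
      (measurable_limitPath_apply hp0 hp1 (t j)).const_mul (c j)).aemeasurable
  · filter_upwards [ae_mem_goodSet hp0 hp1] with ω hω
    exact tendsto_finsetSum _ fun j _ => (tendsto_pathSum_limitPath hp0 hp1 hω (t j)).const_mul _
  · exact tendsto_finsetSum _ fun i _ => tendsto_finsetSum _ fun j _ =>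
      (tendsto_covSum hp0 hp1 (t i) (t j)).const_mul _

theorem isGaussianProcess_limitPath {p : ℝ} (hp0 : 0 < p) (hp1 : p < 1) :
    IsGaussianProcess (fun (t : I) ω => limitPath hp0 hp1 ω t) gaussMeasure where
  hasGaussianLaw J := by
    have hm : Measurable fun ω => J.restrict fun t => limitPath hp0 hp1 ω t :=
      measurable_pi_lambda _ fun t => measurable_limitPath_apply hp0 hp1 t
    refine ⟨isGaussian_of_map_eq_gaussianReal fun Λ => ⟨0, (∑ i : J, ∑ j : J,
      Λ (Pi.single i 1) * Λ (Pi.single j 1) * covFun p (i : I) (j : I)).toNNReal, ?_⟩⟩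
    · rw [Measure.map_map Λ.continuous.measurable hm]
      have : (Λ ∘ fun ω => J.restrict fun t => limitPath hp0 hp1 ω t) =
          fun ω => ∑ j : J, Λ (Pi.single j 1) * limitPath hp0 hp1 ω (j : I) := by
        ext ω
        have h := Λ.toLinearMap.pi_apply_eq_sum_univ (J.restrict fun t => limitPath hp0 hp1 ω t)
        simp only [ContinuousLinearMap.coe_coe] at h
        rw [Function.comp_apply, h]
        refine Finset.sum_congr rfl fun j _ => ?_
        rw [smul_eq_mul, mul_comm]
        congr 2
        ext i
        simp [Pi.single_apply, eq_comm]
      rw [this]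
      exact map_sum_limitPath hp0 hp1 Finset.univ _ fun j : J => (j : I)

/-- A limit of sums of squares over the nodes. It removes `toNNReal` from the variance in
`map_sum_limitPath`. -/
theorem covFun_self_nonneg_of_sum {p : ℝ} (hp0 : 0 < p) (hp1 : p < 1) {ι : Type*} (J : Finset ι)
    (c : ι → ℝ) (t : ι → I) : 0 ≤ ∑ i ∈ J, ∑ j ∈ J, c i * c j * covFun p (t i) (t j) := by
  refine ge_of_tendsto' (tendsto_finsetSum _ fun i _ => tendsto_finsetSum _ fun j _ =>
    (tendsto_covSum hp0 hp1 (t i) (t j)).const_mul (c i * c j)) fun K => ?_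
  simp only [← sum_nodeCoef_mul hp0 hp1]
  calc (0 : ℝ) ≤ ∑ u ∈ wordsLT K, (∑ j ∈ J, c j * nodeCoef p (bits p (t j)) u) ^ 2 := by positivity
    _ = _ := by
      simp only [sq, Finset.mul_sum]
      rw [Finset.sum_comm]
      refine Finset.sum_congr rfl fun i _ => ?_
      rw [Finset.sum_comm]
      refine Finset.sum_congr rfl fun u _ => ?_
      rw [Finset.sum_mul]
      exact Finset.sum_congr rfl fun j _ => by ring

theorem integral_sum_limitPath_sq {p : ℝ} (hp0 : 0 < p) (hp1 : p < 1) {ι : Type*} (J : Finset ι)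
    (c : ι → ℝ) (t : ι → I) :
    ∫ ω, (∑ j ∈ J, c j * limitPath hp0 hp1 ω (t j)) ^ 2 ∂gaussMeasure =
      ∑ i ∈ J, ∑ j ∈ J, c i * c j * covFun p (t i) (t j) := by
  have hm : Measurable fun ω => ∑ j ∈ J, c j * limitPath hp0 hp1 ω (t j) :=
    Finset.measurable_fun_sum _ fun j _ => (measurable_limitPath_apply hp0 hp1 (t j)).const_mul _
  have hv := variance_fun_id_gaussianReal (μ := 0)
    (v := (∑ i ∈ J, ∑ j ∈ J, c i * c j * covFun p (t i) (t j)).toNNReal)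
  rw [variance_of_integral_eq_zero aemeasurable_id' integral_id_gaussianReal,
    Real.coe_toNNReal _ (covFun_self_nonneg_of_sum hp0 hp1 J c t), ← map_sum_limitPath hp0 hp1,
    integral_map hm.aemeasurable (by fun_prop)] at hv
  exact hv

theorem memLp_limitPath {p : ℝ} (hp0 : 0 < p) (hp1 : p < 1) (t : I) :
    MemLp (fun ω => limitPath hp0 hp1 ω t) 2 gaussMeasure :=
  ((isGaussianProcess_limitPath hp0 hp1).hasGaussianLaw_eval t).memLp_two

theorem integral_limitPath {p : ℝ} (hp0 : 0 < p) (hp1 : p < 1) (t : I) :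
    ∫ ω, limitPath hp0 hp1 ω t ∂gaussMeasure = 0 := by
  have h := map_sum_limitPath hp0 hp1 ({()} : Finset Unit) (fun _ => 1) fun _ => t
  simp only [Finset.sum_singleton, one_mul] at h
  have h2 := integral_id_gaussianReal (μ := 0) (v := (covFun p t t).toNNReal)
  rw [← h, integral_map (measurable_limitPath_apply hp0 hp1 t).aemeasurable (by fun_prop)] at h2
  exact h2

theorem covFun_comm {p : ℝ} (hp0 : 0 < p) (hp1 : p < 1) (s t : ℝ) :
    covFun p s t = covFun p t s := by
  refine tendsto_nhds_unique (tendsto_covSum hp0 hp1 s t)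
    ((tendsto_covSum hp0 hp1 t s).congr fun K => ?_)
  refine Finset.sum_congr rfl fun k _ => ?_
  by_cases h : prefixWord (bits p s) k = prefixWord (bits p t) k
  · rw [if_pos h, if_pos h.symm, h, mul_comm (coef p _)]
  · rw [if_neg h, if_neg fun h' => h h'.symm]

/-- Polarization of the second moments of G(s), G(t) and G(s) + G(t). The symmetry of `covFun`, not
visible in its formula, is needed here. -/
theorem integral_limitPath_mul {p : ℝ} (hp0 : 0 < p) (hp1 : p < 1) (s t : I) :
    ∫ ω, limitPath hp0 hp1 ω s * limitPath hp0 hp1 ω t ∂gaussMeasure = covFun p s t := by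
  have hs := integral_sum_limitPath_sq hp0 hp1 ({()} : Finset Unit) (fun _ => 1) fun _ => s
  have ht := integral_sum_limitPath_sq hp0 hp1 ({()} : Finset Unit) (fun _ => 1) fun _ => t
  have hst := integral_sum_limitPath_sq hp0 hp1 (Finset.univ : Finset (Fin 2)) (fun _ => 1) ![s, t]
  simp only [Finset.sum_singleton, one_mul, Fin.sum_univ_two, Matrix.cons_val_zero,
    Matrix.cons_val_one] at hs ht hst
  have i1 := (memLp_limitPath hp0 hp1 s).integrable_sq
  have i2 := (memLp_limitPath hp0 hp1 t).integrable_sq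
  have i3 : Integrable (fun ω => limitPath hp0 hp1 ω s * limitPath hp0 hp1 ω t) gaussMeasure :=
    (memLp_limitPath hp0 hp1 s).integrable_mul (memLp_limitPath hp0 hp1 t)
  have e : ∀ ω, (limitPath hp0 hp1 ω s + limitPath hp0 hp1 ω t) ^ 2 = limitPath hp0 hp1 ω s ^ 2 +
      2 * (limitPath hp0 hp1 ω s * limitPath hp0 hp1 ω t) + limitPath hp0 hp1 ω t ^ 2 :=
    fun ω => by ring
  simp only [e] at hst
  rw [integral_add (i1.fun_add (i3.const_mul 2)) i2, integral_add i1 (i3.const_mul 2),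
    integral_const_mul, hs, ht, covFun_comm hp0 hp1 t s] at hst
  linarith

end

section

/-! ### Measurability of the normalized path -/

theorem selectState_congr {n : ℕ} {s s' : Fin n → ℕ → Fin 2} (l : ℕ) {k : ℕ}
    (h : ∀ i, ∀ j < k, s i j = s' i j) : selectState s l k = selectState s' l k := by
  induction k with
  | zero => rfl
  | succ k ih =>
    have h1 := ih fun i j hj => h i j (by omega)
    simp only [selectState, h1, h _ k (Nat.lt_succ_self k)]

theorem measurable_selectState {n : ℕ} (l k : ℕ) (f : Finset (Fin n) × ℕ → ℕ) :
    Measurable fun s : Fin n → ℕ → Fin 2 => f (selectState s l k) := by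
  have h : (fun s : Fin n → ℕ → Fin 2 => f (selectState s l k)) =
      (fun b : Fin n → Fin k → Fin 2 =>
        f (selectState (fun i j => if hj : j < k then b i ⟨j, hj⟩ else 0) l k)) ∘
      fun s i j => s i j := by
    funext s
    refine congrArg f (selectState_congr l fun i j hj => ?_)
    simp [hj]
  rw [h]
  exact Measurable.of_discrete.comp (by fun_prop)

theorem measurable_bucketOps {n : ℕ} (l : ℕ) :
    Measurable fun s : Fin n → ℕ → Fin 2 => bucketOps s l :=
  Measurable.tsum fun k =>
    measurable_selectState l k fun S => if 2 ≤ S.1.card then S.1.card else 0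

/-- The path is a function of the finitely many integers Y_n(0), …, Y_n(n). Every map on that
countable discrete space is measurable, so the Skorokhod σ-algebra need not be analyzed. -/
theorem measurable_normalizedPath (p : ℝ) (n : ℕ) :
    Measurable fun s : Fin n → ℕ → Fin 2 => normalizedPath p s := by
  let ops : (Fin n → ℕ → Fin 2) → Fin (n + 1) → ℕ := fun s l => bucketOps s l
  have hops : Measurable ops := measurable_pi_iff.2 fun l => measurable_bucketOps _
  have hfac : Function.FactorsThrough (fun s : Fin n → ℕ → Fin 2 => normalizedPath p s) ops := by
    intro s s' h
    refine CadlagSpace.ext_of_forall fun t => ?_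
    have := congrFun h ⟨min (⌊(t : ℝ) * n⌋₊ + 1) n, by omega⟩
    simp only [ops] at this
    simp only [normalizedPath, normalizedOps, this]
  have h : (fun s : Fin n → ℕ → Fin 2 => normalizedPath p s) =
      Function.extend ops (fun s => normalizedPath p s)
        (fun _ => normalizedPath p (fun (_ : Fin n) _ => 0)) ∘ ops := by
    funext s
    exact (hfac.extend_apply _ s).symm
  rw [h]
  exact Measurable.of_discrete.comp hops

end

section

/-! ### Central limit theorem for the noise -/

/-- Second-order Taylor expansion of the exponential at iy/√n, with remainder at most |x|³e^|x| for
x = y/√n. -/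
theorem tendsto_mul_exp_sub (y : ℝ) :
    Tendsto (fun n : ℕ => (n : ℂ) * (Complex.exp (((√(n : ℝ))⁻¹ * y : ℝ) * Complex.I) - 1 -
      ((√(n : ℝ))⁻¹ * y : ℝ) * Complex.I)) atTop (𝓝 (-(y : ℂ) ^ 2 / 2)) := by
  have hs : Tendsto (fun n : ℕ => (√(n : ℝ))⁻¹) atTop (𝓝 0) :=
    tendsto_inv_atTop_zero.comp (Real.tendsto_sqrt_atTop.comp tendsto_natCast_atTop_atTop)
  have hb : Tendsto (fun n : ℕ => (√(n : ℝ))⁻¹ * (|y| ^ 3 * Real.exp ((√(n : ℝ))⁻¹ * |y|))) atTop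
      (𝓝 0) := by
    have h := hs.mul (((Real.continuous_exp.tendsto _).comp (hs.mul_const |y|)).const_mul (|y| ^ 3))
    simpa using h
  rw [tendsto_iff_norm_sub_tendsto_zero]
  refine squeeze_zero' (Eventually.of_forall fun _ => norm_nonneg _) ?_ hb
  filter_upwards [eventually_gt_atTop 0] with n hn
  have hn' : (0 : ℝ) < n := by exact_mod_cast hn
  have hsq : √(n : ℝ) ^ 2 = n := Real.sq_sqrt hn'.le
  have hspos : 0 < √(n : ℝ) := Real.sqrt_pos.2 hn'
  set x : ℂ := ((√(n : ℝ))⁻¹ * y : ℝ) * Complex.I with hx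
  have hnx : (n : ℂ) * x ^ 2 = -(y : ℂ) ^ 2 := by
    have : (n : ℝ) * ((√(n : ℝ))⁻¹ * y) ^ 2 = y ^ 2 := by
      rw [mul_pow, inv_pow, hsq]; field_simp
    rw [hx, mul_pow, Complex.I_sq]
    have h := congrArg (fun r : ℝ => (r : ℂ)) this
    push_cast at h ⊢
    linear_combination -h
  have hnorm : ‖x‖ = (√(n : ℝ))⁻¹ * |y| := by
    rw [hx, norm_mul, Complex.norm_I, mul_one, Complex.norm_real, Real.norm_eq_abs, abs_mul,
      abs_of_pos (inv_pos.2 hspos)]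
  have h := Complex.norm_exp_sub_sum_le_norm_mul_exp x 3
  simp only [Finset.sum_range_succ, Finset.sum_range_zero, Nat.factorial] at h
  have he : (n : ℂ) * (Complex.exp x - 1 - x) - -(y : ℂ) ^ 2 / 2 =
      n * (Complex.exp x - (0 + x ^ 0 / 1 + x ^ 1 / 1 + x ^ 2 / 2)) := by
    linear_combination hnx / 2
  rw [he, norm_mul, Complex.norm_natCast]
  norm_num at h
  calc (n : ℝ) * ‖Complex.exp x - (0 + x ^ 0 / 1 + x ^ 1 / 1 + x ^ 2 / 2)‖
      ≤ n * (‖x‖ ^ 3 * Real.exp ‖x‖) := by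
        refine mul_le_mul_of_nonneg_left ?_ hn'.le
        simpa using h
    _ = _ := by
        rw [hnorm, mul_pow, ← mul_assoc, ← mul_assoc, ← mul_assoc]
        congr 2
        nth_rw 1 [← hsq]
        field_simp

/-- The central limit theorem for a finitely supported law, from (1 + g_n)^n → e^z when n g_n → z.
The mean-zero condition removes the linear term, which would be of order √n. -/
theorem tendsto_sum_exp_pow {ι : Type*} (F : Finset ι) (a y : ι → ℝ) (h1 : ∑ v ∈ F, a v = 1)
    (h0 : ∑ v ∈ F, a v * y v = 0) :
    Tendsto (fun n : ℕ =>
      (∑ v ∈ F, (a v : ℂ) * Complex.exp (((√(n : ℝ))⁻¹ * y v : ℝ) * Complex.I)) ^ n) atTop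
      (𝓝 (Complex.exp (-((∑ v ∈ F, a v * y v ^ 2 : ℝ) : ℂ) / 2))) := by
  have h := Complex.tendsto_one_add_pow_exp_of_tendsto
    (g := fun n => ∑ v ∈ F, (a v : ℂ) *
      (Complex.exp (((√(n : ℝ))⁻¹ * y v : ℝ) * Complex.I) - 1))
    (t := -((∑ v ∈ F, a v * y v ^ 2 : ℝ) : ℂ) / 2) ?_
  · refine h.congr fun n => ?_
    congr 1
    simp only [mul_sub, mul_one, Finset.sum_sub_distrib]
    rw [← Complex.ofReal_sum, h1]
    push_cast; ring
  · have ht := tendsto_finsetSum F fun v _ => (tendsto_mul_exp_sub (y v)).const_mul (a v : ℂ)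
    have hlim : ∑ v ∈ F, (a v : ℂ) * (-(y v : ℂ) ^ 2 / 2) =
        -((∑ v ∈ F, a v * y v ^ 2 : ℝ) : ℂ) / 2 := by
      push_cast
      rw [← Finset.sum_neg_distrib, Finset.sum_div]
      exact Finset.sum_congr rfl fun v _ => by ring
    rw [hlim] at ht
    refine ht.congr fun n => ?_
    have h0' : ∑ v ∈ F, (a v : ℂ) * (n * (((√(n : ℝ))⁻¹ * y v : ℝ) * Complex.I)) = 0 := by
      have : ∑ v ∈ F, (a v : ℂ) * (n * (((√(n : ℝ))⁻¹ * y v : ℝ) * Complex.I)) =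
          n * ((√(n : ℝ))⁻¹ : ℝ) * Complex.I * ((∑ v ∈ F, a v * y v : ℝ) : ℂ) := by
        push_cast
        rw [Finset.mul_sum]
        exact Finset.sum_congr rfl fun v _ => by ring
      rw [this, h0]; simp
    rw [← add_zero (∑ v ∈ F, _), ← h0', ← Finset.sum_add_distrib, Finset.mul_sum]
    exact Finset.sum_congr rfl fun v _ => by ring

/-- The values of `w` at the words of length less than `K`. -/
def restrictLT (K : ℕ) (w : List (Fin 2) → ℝ) : EuclideanSpace ℝ (wordsLT K) :=
  WithLp.toLp 2 fun u => w u

/-- The extension by zero of a vector indexed by the words of length less than `K`. -/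
def extendLT {K : ℕ} (v : EuclideanSpace ℝ (wordsLT K)) (u : List (Fin 2)) : ℝ :=
  if h : u ∈ wordsLT K then v ⟨u, h⟩ else 0

theorem continuous_extendLT (K : ℕ) :
    Continuous (extendLT : EuclideanSpace ℝ (wordsLT K) → List (Fin 2) → ℝ) := by
  refine continuous_pi fun u => ?_
  by_cases h : u ∈ wordsLT K
  · simp only [extendLT, h, dite_true]; fun_prop
  · simp only [extendLT, h, dite_false]; fun_prop

theorem measurable_restrictLT (K : ℕ) : Measurable (restrictLT K) := by
  unfold restrictLT
  fun_prop

theorem extendLT_restrictLT {K : ℕ} (w : List (Fin 2) → ℝ) {u : List (Fin 2)}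
    (hu : u.length < K) : extendLT (restrictLT K w) u = w u := by
  simp [extendLT, restrictLT, mem_wordsLT.2 hu]

theorem inner_restrictLT {K : ℕ} (w : List (Fin 2) → ℝ) (θ : EuclideanSpace ℝ (wordsLT K)) :
    inner ℝ (restrictLT K w) θ = ∑ u ∈ wordsLT K, extendLT θ u * w u := by
  rw [PiLp.inner_apply, ← Finset.sum_attach (wordsLT K)]
  refine Finset.sum_congr rfl fun u _ => ?_
  simp [extendLT, restrictLT, u.2]

theorem stepPath_extendLT_restrictLT {p : ℝ} (hp0 : 0 < p) (hp1 : p < 1) (K : ℕ)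
    (w : List (Fin 2) → ℝ) :
    stepPath hp0 hp1 K (extendLT (restrictLT K w)) = stepPath hp0 hp1 K w := by
  refine CadlagSpace.ext_of_forall fun t => ?_
  change pathSum p _ K _ = pathSum p _ K _
  refine Finset.sum_congr rfl fun k hk => ?_
  rw [extendLT_restrictLT w (by simpa using hk)]

/-- The exponent is written as the variance of `bitSum` over words of length K, the form in which
the limit of the noise appears. -/
theorem charFun_map_restrictLT_gaussW {p : ℝ} (hp0 : 0 < p) (hp1 : p < 1) (K : ℕ)
    (θ : EuclideanSpace ℝ (wordsLT K)) :
    charFun (gaussMeasure.map fun ω => restrictLT K (gaussW p ω)) θ =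
      Complex.exp (-((∑ v ∈ words K, wordProb p v * bitSum p (extendLT θ) v ^ 2 : ℝ) : ℂ) / 2) := by
  have hm : Measurable fun ω => restrictLT K (gaussW p ω) :=
    (measurable_restrictLT K).comp (measurable_gaussW p)
  rw [charFun_apply, integral_map hm.aemeasurable (by fun_prop)]
  have h := congrArg (fun ν => charFun ν 1)
    (map_sum_gaussMeasure (wordsLT K) fun u => extendLT θ u * nodeStd p u)
  simp only [charFun_gaussianReal] at h
  have hs : Measurable fun ω : List (Fin 2) → ℝ =>
      ∑ u ∈ wordsLT K, extendLT θ u * nodeStd p u * ω u :=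
    Finset.measurable_fun_sum _ fun u _ => (measurable_pi_apply u).const_mul _
  rw [charFun_apply, integral_map hs.aemeasurable (by fun_prop)] at h
  have hv : ∑ u ∈ wordsLT K, (extendLT θ u * nodeStd p u) ^ 2 =
      ∑ v ∈ words K, wordProb p v * bitSum p (extendLT θ) v ^ 2 := by
    rw [sum_wordProb_mul_bitSum_sq, sum_wordsLT]
    refine Finset.sum_congr rfl fun k _ => Finset.sum_congr rfl fun u _ => ?_
    rw [← nodeStd_mul_self hp0 hp1]; ring
  have hnn : 0 ≤ ∑ u ∈ wordsLT K, (extendLT θ u * nodeStd p u) ^ 2 :=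
    Finset.sum_nonneg fun u _ => sq_nonneg _
  rw [Real.coe_toNNReal _ hnn, hv] at h
  simp only [inner_restrictLT, gaussW]
  convert h using 1
  · refine integral_congr_ae (Eventually.of_forall fun ω => ?_)
    simp [mul_assoc]
  · congr 1; simp [neg_div]

theorem charFun_map_restrictLT_noise {p : ℝ} {n : ℕ} (hn : 0 < n) {Ω : Type*}
    [MeasurableSpace Ω] {μ : Measure Ω} [IsProbabilityMeasure μ] {Z : Fin n → Ω → ℕ → Fin 2}
    (hZ : IsBernoulliSample p μ Z) (K : ℕ) (θ : EuclideanSpace ℝ (wordsLT K)) :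
    charFun (μ.map fun ω => restrictLT K (noise p fun i => Z i ω)) θ =
      (∑ v ∈ words K, (wordProb p v : ℂ) *
        Complex.exp (((√(n : ℝ))⁻¹ * bitSum p (extendLT θ) v : ℝ) * Complex.I)) ^ n := by
  have hZm : Measurable fun ω i => Z i ω := measurable_pi_iff.2 hZ.measurable
  have hm : Measurable fun ω => restrictLT K (noise p fun i => Z i ω) :=
    (measurable_restrictLT K).comp
      ((measurable_pi_iff.2 fun u => measurable_noise p u).comp hZm)
  have hs : √(n : ℝ) ≠ 0 := (Real.sqrt_pos.2 (by exact_mod_cast hn)).ne'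
  rw [charFun_apply, integral_map hm.aemeasurable (by fun_prop)]
  let f : List (Fin 2) → ℂ := fun v =>
    Complex.exp (((√(n : ℝ))⁻¹ * bitSum p (extendLT θ) v : ℝ) * Complex.I)
  have hpt : ∀ ω, Complex.exp ((inner ℝ (restrictLT K (noise p fun i => Z i ω)) θ : ℝ) *
      Complex.I) = ∏ i, f (prefixWord (Z i ω) K) := by
    intro ω
    have h := sum_mul_noise p (fun i => Z i ω) (extendLT θ) K
    rw [← sum_wordsLT, ← inner_restrictLT, mul_comm, ← eq_div_iff hs] at h
    rw [h, ← Complex.exp_sum, ← Finset.sum_mul, ← Complex.ofReal_sum, ← Finset.mul_sum]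
    congr 3
    field_simp
  simp only [hpt]
  rw [hZ.indep.integral_fun_prod_comp (f := fun _ x => f (prefixWord x K))
    (fun i => (hZ.measurable i).aemeasurable) fun i =>
      (IsBernoulliSample.measurable_comp_prefixWord f K).aestronglyMeasurable]
  rw [Finset.prod_congr rfl fun i _ => hZ.integral_prefixWord i K f, Finset.prod_const,
    Finset.card_univ, Fintype.card_fin]
  simp only [Complex.real_smul, f]

end

section

/-! ### Convergence in distribution -/

variable {p : ℝ} {Ω : ℕ → Type*} [∀ n, MeasurableSpace (Ω n)] {P : (n : ℕ) → Measure (Ω n)}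
  [∀ n, IsProbabilityMeasure (P n)] {Z : (n : ℕ) → Fin n → Ω n → ℕ → Fin 2}

theorem tendstoInDistribution_restrictLT_noise (hp0 : 0 < p) (hp1 : p < 1)
    (hZ : ∀ n, IsBernoulliSample p (P n) (Z n)) (K : ℕ) :
    TendstoInDistribution (fun n ω => restrictLT K (noise p fun i => Z n i ω)) atTop
      (fun ω => restrictLT K (gaussW p ω)) P gaussMeasure where
  forall_aemeasurable n :=
    ((measurable_restrictLT K).comp ((measurable_pi_iff.2 fun u => measurable_noise p u).comp
      (measurable_pi_iff.2 (hZ n).measurable))).aemeasurable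
  aemeasurable_limit := ((measurable_restrictLT K).comp (measurable_gaussW p)).aemeasurable
  tendsto := by
    refine ProbabilityMeasure.tendsto_iff_tendsto_charFun.2 fun θ => ?_
    simp only [ProbabilityMeasure.coe_mk]
    rw [charFun_map_restrictLT_gaussW hp0 hp1]
    refine (tendsto_sum_exp_pow (words K) (wordProb p) (bitSum p (extendLT θ)) (sum_wordProb p K)
      (sum_wordProb_mul_bitSum p _ K)).congr' ?_
    filter_upwards [eventually_gt_atTop 0] with n hn
    exact (charFun_map_restrictLT_noise hn (hZ n) K θ).symm

theorem tendstoInDistribution_stepPath_noise (hp0 : 0 < p) (hp1 : p < 1)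
    (hZ : ∀ n, IsBernoulliSample p (P n) (Z n)) (K : ℕ) :
    TendstoInDistribution (fun n ω => stepPath hp0 hp1 K (noise p fun i => Z n i ω)) atTop
      (fun ω => stepPath hp0 hp1 K (gaussW p ω)) P gaussMeasure := by
  have h := (tendstoInDistribution_restrictLT_noise hp0 hp1 hZ K).continuous_comp
    ((continuous_stepPath hp0 hp1 K).comp (continuous_extendLT K))
  simpa only [Function.comp_def, stepPath_extendLT_restrictLT] using h

theorem tendstoInDistribution_stepPath_gaussW (hp0 : 0 < p) (hp1 : p < 1) :
    TendstoInDistribution (fun K ω => stepPath hp0 hp1 K (gaussW p ω)) atTop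
      (limitPath hp0 hp1) (fun _ => gaussMeasure) gaussMeasure := by
  refine tendstoInDistribution_of_ae_tendsto
    (fun K => (measurable_stepPath_gaussW hp0 hp1 K).aemeasurable)
    (measurable_limitPath hp0 hp1).aemeasurable ?_
  filter_upwards [ae_mem_goodSet hp0 hp1] with ω hω
  exact tendsto_stepPath_limitPath hp0 hp1 hω

/-- The Lipschitz bound is used where X and Y are close, the bounded oscillation C elsewhere. -/
theorem abs_integral_sub_integral_le {Ω E : Type*} [MeasurableSpace Ω] {μ : Measure Ω}
    [IsProbabilityMeasure μ] [PseudoEMetricSpace E] [MeasurableSpace E] [OpensMeasurableSpace E]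
    {X Y : Ω → E} (hX : AEMeasurable X μ) (hY : AEMeasurable Y μ) {f : E → ℝ} {C : ℝ}
    (hC : ∀ x y, dist (f x) (f y) ≤ C) {L : NNReal} (hL : LipschitzWith L f) {ε δ : ℝ}
    (hε : 0 ≤ ε) (h : μ.real {ω | ¬ edist (X ω) (Y ω) ≤ ENNReal.ofReal ε} ≤ δ) :
    |∫ ω, f (X ω) ∂μ - ∫ ω, f (Y ω) ∂μ| ≤ L * ε + C * δ := by
  obtain ⟨ω₀⟩ := μ.nonempty_of_neZero
  have hC0 : 0 ≤ C := dist_nonneg.trans (hC (X ω₀) (X ω₀))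
  have hInt : ∀ {W : Ω → E}, AEMeasurable W μ → Integrable (fun ω => f (W ω)) μ := by
    intro W hW
    refine Integrable.of_bound (hL.continuous.measurable.comp_aemeasurable hW).aestronglyMeasurable
      (|f (X ω₀)| + C) (Eventually.of_forall fun ω => ?_)
    have h1 := hC (W ω) (X ω₀)
    rw [Real.dist_eq] at h1
    rw [Real.norm_eq_abs]
    have h2 := abs_add_le (f (W ω) - f (X ω₀)) (f (X ω₀))
    rw [sub_add_cancel] at h2
    linarith
  -- The event is not assumed measurable; its measurable hull has the same measure.
  set A := toMeasurable μ {ω | ¬ edist (X ω) (Y ω) ≤ ENNReal.ofReal ε} with hA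
  have hAm : MeasurableSet A := measurableSet_toMeasurable _ _
  have hAμ : μ.real A ≤ δ := by
    rwa [measureReal_def, hA, measure_toMeasurable, ← measureReal_def]
  have hI : Integrable (fun ω => L * ε + A.indicator (fun _ => C) ω) μ :=
    (integrable_const _).fun_add ((integrable_const C).indicator hAm)
  rw [← integral_sub (hInt hX) (hInt hY)]
  calc |∫ ω, (f (X ω) - f (Y ω)) ∂μ| ≤ ∫ ω, |f (X ω) - f (Y ω)| ∂μ := abs_integral_le_integral_abs
    _ ≤ ∫ ω, (L * ε + A.indicator (fun _ => C) ω) ∂μ := by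
      refine integral_mono ((hInt hX).sub (hInt hY)).abs hI fun ω => ?_
      change |f (X ω) - f (Y ω)| ≤ L * ε + A.indicator (fun _ => C) ω
      by_cases hω : ω ∈ A
      · rw [Set.indicator_of_mem hω, ← Real.dist_eq]
        have := hC (X ω) (Y ω)
        have := mul_nonneg L.coe_nonneg hε
        linarith
      · rw [Set.indicator_of_notMem hω, add_zero, ← Real.dist_eq]
        have hle : edist (X ω) (Y ω) ≤ ENNReal.ofReal ε := by
          by_contra hne
          exact hω (subset_toMeasurable μ _ hne)
        have h1 : edist (f (X ω)) (f (Y ω)) ≤ ENNReal.ofReal (L * ε) := by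
          rw [ENNReal.ofReal_mul L.coe_nonneg]
          refine (hL (X ω) (Y ω)).trans ?_
          simpa using mul_le_mul_right hle (L : ENNReal)
        rwa [edist_dist, ENNReal.ofReal_le_ofReal_iff (mul_nonneg L.coe_nonneg hε)] at h1
    _ = L * ε + μ.real A * C := by
      rw [integral_add (integrable_const _) ((integrable_const C).indicator hAm),
        integral_indicator hAm]
      simp
    _ ≤ L * ε + C * δ := by
      rw [mul_comm (μ.real A)]
      gcongr

theorem tendstoInDistribution_normalizedPath (hp0 : 0 < p) (hp1 : p < 1)
    (hZ : ∀ n, IsBernoulliSample p (P n) (Z n)) :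
    TendstoInDistribution (fun n ω => normalizedPath p fun i => Z n i ω) atTop
      (limitPath hp0 hp1) P gaussMeasure := by
  have hm : ∀ n, AEMeasurable (fun ω => normalizedPath p fun i => Z n i ω) (P n) := fun n =>
    ((measurable_normalizedPath p n).comp
      (measurable_pi_iff.2 (hZ n).measurable)).aemeasurable
  have hG := (measurable_limitPath hp0 hp1).aemeasurable (μ := gaussMeasure)
  refine ⟨hm, hG, tendsto_iff_forall_lipschitz_integral_tendsto.2 ?_⟩
  rintro f ⟨C, hC⟩ ⟨L, hL⟩
  have hfm : Measurable f := hL.continuous.measurable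
  have hstep := fun K => tendsto_iff_forall_lipschitz_integral_tendsto.1
    (tendstoInDistribution_stepPath_noise hp0 hp1 hZ K).tendsto f ⟨C, hC⟩ ⟨L, hL⟩
  have hlim := tendsto_iff_forall_lipschitz_integral_tendsto.1
    (tendstoInDistribution_stepPath_gaussW hp0 hp1).tendsto f ⟨C, hC⟩ ⟨L, hL⟩
  have hsm := fun K => (tendstoInDistribution_stepPath_noise hp0 hp1 hZ K).forall_aemeasurable
  simp only [ProbabilityMeasure.coe_mk] at hstep hlim ⊢
  rw [Metric.tendsto_atTop]
  intro η hη
  have hC0 : 0 ≤ C := dist_nonneg.trans (hC (limitPath hp0 hp1 0) (limitPath hp0 hp1 0))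
  have hden : 0 < (L : ℝ) + C + 1 := by linarith [L.coe_nonneg]
  set ε := η / 4 / (L + C + 1) with hε
  have hε0 : 0 < ε := by positivity
  have hεle : L * ε + C * ε ≤ η / 4 := by
    have : (L + C + 1) * ε = η / 4 := by rw [hε]; field_simp
    linarith
  obtain ⟨K₀, hK₀⟩ := exists_forall_measureReal_edist_le hp0 hp1 hZ hε0 hε0
  obtain ⟨K₁, hK₁⟩ := Metric.tendsto_atTop.1 hlim (η / 4) (by positivity)
  -- K is fixed before n: K₀ makes the normalized path close to its step path, K₁ brings the
  -- Gaussian step path close to the limit in law.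
  let K := max K₀ K₁
  obtain ⟨N, hN⟩ := Metric.tendsto_atTop.1 (hstep K) (η / 4) (by positivity)
  obtain ⟨N', hN'⟩ := eventually_atTop.1 (hK₀ K (le_max_left _ _))
  refine ⟨max N N', fun n hn => ?_⟩
  have h1 := abs_integral_sub_integral_le (hm n) (hsm K n) hC hL hε0.le
    (hN' n (le_of_max_le_right hn))
  have h2 := hN n (le_of_max_le_left hn)
  have h3 := hK₁ K (le_max_right _ _)
  rw [← integral_map (hm n) hfm.aestronglyMeasurable,
    ← integral_map (hsm K n) hfm.aestronglyMeasurable] at h1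
  rw [Real.dist_eq, abs_lt] at h2 h3 ⊢
  rw [abs_le] at h1
  constructor <;> linarith [h1.1, h1.2, h2.1, h2.2, h3.1, h3.2]

end

end RadixSelection

end

theorem theorem3p3 (p : ℝ) (hp0 : 0 < p) (hp1 : p < 1) (hp : p ≠ 1 / 2)
    {Ω : ℕ → Type*} [∀ n, MeasurableSpace (Ω n)]
    (P : (n : ℕ) → Measure (Ω n)) [∀ n, IsProbabilityMeasure (P n)]
    -- `B n i k` is the `k`-th bit of the `i`-th of `n` data
    (B : (n : ℕ) → Fin n → ℕ → Ω n → Fin 2)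
    (hB_meas : ∀ n i k, Measurable (B n i k))
    (hB_indep : ∀ n, iIndepFun (fun q : Fin n × ℕ => B n q.1 q.2) (P n))
    (hB_law : ∀ n i k, (P n) {ω | B n i k ω = 1} = ENNReal.ofReal p) :
    ∃ (Ω' : Type) (_ : MeasurableSpace Ω') (P' : Measure Ω') (_ : IsProbabilityMeasure P')
      (G : Ω' → RadixSelection.CadlagSpace),
      Measurable G ∧
      IsGaussianProcess (fun (t : unitInterval) ω => G ω t) P' ∧
      (∀ t : unitInterval, ∫ ω, G ω t ∂P' = 0) ∧
      (∀ s t : unitInterval, ∫ ω, G ω s * G ω t ∂P' = RadixSelection.covFun p s t) ∧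
      TendstoInDistribution
        (fun n ω => RadixSelection.normalizedPath p (fun i k => B n i k ω)) atTop G P P' :=
  ⟨List (Fin 2) → ℝ, inferInstance, RadixSelection.gaussMeasure, inferInstance,
    RadixSelection.limitPath hp0 hp1, RadixSelection.measurable_limitPath hp0 hp1,
    RadixSelection.isGaussianProcess_limitPath hp0 hp1,
    RadixSelection.integral_limitPath hp0 hp1, RadixSelection.integral_limitPath_mul hp0 hp1,
    RadixSelection.tendstoInDistribution_normalizedPath hp0 hp1 fun n =>
      RadixSelection.isBernoulliSample_of_bits hp0 (hB_meas n) (hB_indep n) (hB_law n)⟩
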